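/- **Theorem 3.4.** Let $q$ be a nonzero complex number that is not a root of unity, and put $[m]_q=\frac{q^m-q^{-m}}{q-q^{-1}}$. Let $H_q$ be the complex Lie algebra with basis $c$, $\beta_m$ ($m\in\mathbb Z$), where $c$ is central and $$[\beta_m,\beta_n]=[m]_q\,\delta_{m+n,0}\,c\qquad(m,n\in\mathbb Z).$$ Let $B$ be the complex vector space with basis $\{\beta^{(r)}\mid r\in\mathbb Z\}$ and bilinear form $\langle\beta^{(r)},\beta^{(s)}\rangle=\frac{1}{q-q^{-1}}(\delta_{r,s+1}-\delta_{r,s-1})$. Let $\hat B=B\otimes\mathbb C[t,t^{-1}]\oplus\mathbb C c$ be the Lie algebra in which $c$ is central and $[a\otimes t^m,b\otimes t^n]=\langle a,b\rangle\delta_{m+n+1,0}\,c$. Write $b_n=b\otimes t^n$. For $\ell\in\mathbb C$ let $V_{\hat B}(\ell,0)=U(\hat B)\otimes_{U(B\otimes\mathbb C[t]\oplus\mathbb C c)}\mathbb C_\ell$, where $B\otimes\mathbb C[t]$ acts on $\mathbb C_\ell=\mathbb C$ as $0$ and $c$ as $\ell$; put $\mathbf 1=1\otimes 1$ and identify $b\in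 B$ with $b_{-1}\mathbf 1$. On $V_{\hat B}(\ell,0)$ there is exactly one vertex algebra structure with vacuum vector $\mathbf 1$ and $Y(b,x)=\sum_{n\in\mathbb Z}b_nx^{-n-1}$ for all $b\in B$. For $m\in\mathbb Z$ let $\rho_m$ be the linear map of $V_{\hat B}(\ell,0)$ with $\rho_m\mathbf 1=\mathbf 1$ and $\rho_m(\beta^{(r)}_n v)=\beta^{(r+m)}_n\rho_m(v)$; it is an automorphism of this vertex algebra. Let $W$ be an $H_q$-module on which $c$ acts as the scalar $\ell$ and which is restricted: for every $w\in W$, $\beta_nw=0$ for all sufficiently large $n$. Put $\beta(x)=\sum_{n\in\mathbb Z}\beta_nx^{-n}$. Then there is a linear map $Y_W(\cdot,x):V_{\hat B}(\ell,0)\to\mathrm{Hom}(W,W((x)))$ such that 1. $(W,Y_W)$ is a $\phi$-coordinated quasi module for $\phi(x,z)=xe^z$: $Y_W(\mathbf 1,x)=1_W$, and for all $u,v\in V_{\hat B}(\ell,0)$ there is a nonzero polynomial $p(x_1,x_2)$ with $p(x_1,x_2)Y_W(u,x_1)Y_W(v,x_2)\in\mathrm{Hom}(W,W((x_1,x_2)))$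 and $$p(x_2e^{x_0},x_2)\,Y_W(Y(u,x_0)v,x_2)=\bigl(p(x_1,x_2)Y_W(u,x_1)Y_W(v,x_2)\bigr)\big|_{x_1=x_2e^{x_0}};$$ 2. it is $\Gamma_q$-covariant, $\Gamma_q=\{q^m\mid m\in\mathbb Z\}$: $Y_W(\rho_m v,x)=Y_W(v,q^mx)$ for all $m\in\mathbb Z$ and $v\in V_{\hat B}(\ell,0)$; 3. $Y_W(\beta^{(r)},x)=\beta(q^rx)$ for all $r\in\mathbb Z$. Moreover, $Y_W$ is the only linear map $V_{\hat B}(\ell,0)\to\mathrm{Hom}(W,W((x)))$ that satisfies 1 and 3. -/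

import Mathlib

noncomputable section

open scoped TensorProduct LaurentPolynomial

namespace QHeis

open VertexOperator (ncoeff)

/-! ### Heisenberg Lie algebras attached to alternating forms -/

/-- The Heisenberg Lie algebra `A ⊕ ℂ c` of a complex vector space `A` with an alternating
bilinear form `ω`: the element `c` is central and `[a, b] = ω(a, b) c` for `a, b ∈ A`.
An element `a + s c` is the pair with `vec = a` and `cen = s`. -/
@[ext]
structure Heisenberg {A : Type*} [AddCommGroup A] [Module ℂ A]
    {ω : LinearMap.BilinForm ℂ A} (hω : ω.IsAlt) where
  /-- the component in `A` -/
  vec : A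
  /-- the coefficient of the central element -/
  cen : ℂ

namespace Heisenberg

variable {A : Type*} [AddCommGroup A] [Module ℂ A] {ω : LinearMap.BilinForm ℂ A} {hω : ω.IsAlt}

/-- The underlying set of the Heisenberg Lie algebra is `A × ℂ`. -/
def equivProd (hω : ω.IsAlt) : Heisenberg hω ≃ A × ℂ where
  toFun x := (x.vec, x.cen)
  invFun x := ⟨x.1, x.2⟩
  left_inv _ := rfl
  right_inv _ := rfl

instance : AddCommGroup (Heisenberg hω) := (equivProd hω).addCommGroup

instance : Module ℂ (Heisenberg hω) := (equivProd hω).module ℂ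

@[simp] theorem vec_add (x y : Heisenberg hω) : (x + y).vec = x.vec + y.vec := rfl
@[simp] theorem cen_add (x y : Heisenberg hω) : (x + y).cen = x.cen + y.cen := rfl
@[simp] theorem vec_zero : (0 : Heisenberg hω).vec = 0 := rfl
@[simp] theorem cen_zero : (0 : Heisenberg hω).cen = 0 := rfl
@[simp] theorem vec_smul (s : ℂ) (x : Heisenberg hω) : (s • x).vec = s • x.vec := rfl
@[simp] theorem cen_smul (s : ℂ) (x : Heisenberg hω) : (s • x).cen = s * x.cen := rfl

instance : Bracket (Heisenberg hω) (Heisenberg hω) := ⟨fun x y => ⟨0, ω x.vec y.vec⟩⟩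

@[simp] theorem vec_lie (x y : Heisenberg hω) : ⁅x, y⁆.vec = 0 := rfl
@[simp] theorem cen_lie (x y : Heisenberg hω) : ⁅x, y⁆.cen = ω x.vec y.vec := rfl

instance : LieRing (Heisenberg hω) where
  add_lie x y z := by ext <;> simp
  lie_add x y z := by ext <;> simp
  lie_self x := by
    ext
    · simp
    · simpa using hω x.vec
  leibniz_lie x y z := by ext <;> simp

instance : LieAlgebra ℂ (Heisenberg hω) where
  lie_smul s x y := by ext <;> simp

/-- The inclusion of `A`. -/
def of (hω : ω.IsAlt) : A →ₗ[ℂ] Heisenberg hω where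
  toFun a := ⟨a, 0⟩
  map_add' a b := by ext <;> simp
  map_smul' s a := by ext <;> simp

/-- The central element `c`. -/
def c (hω : ω.IsAlt) : Heisenberg hω := ⟨0, 1⟩

/-- A linear map preserving the form extends to a Lie algebra homomorphism that fixes `c`. -/
def map (hω : ω.IsAlt) (f : A →ₗ[ℂ] A) (hf : ∀ a b, ω (f a) (f b) = ω a b) :
    Heisenberg hω →ₗ⁅ℂ⁆ Heisenberg hω where
  toFun x := ⟨f x.vec, x.cen⟩
  map_add' x y := by ext <;> simp
  map_smul' s x := by ext <;> simp
  map_lie' {x y} := by ext <;> simp [hf]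

end Heisenberg

/-! ### The `q`-Heisenberg Lie algebra and its modules -/

/-- The `q`-integer `[m]_q`. -/
def qInt (q : ℂ) (m : ℤ) : ℂ := (q ^ m - q ^ (-m)) / (q - q⁻¹)

/-- The form on the space with basis `(β_m)` such that `ω(β_m, β_n) = [m]_q δ_{m+n,0}`. -/
def qForm (q : ℂ) : LinearMap.BilinForm ℂ (ℤ →₀ ℂ) :=
  Finsupp.linearCombination ℂ fun m : ℤ => qInt q m • Finsupp.lapply (R := ℂ) (-m)

theorem qForm_single (q : ℂ) (m n : ℤ) :
    qForm q (Finsupp.single m 1) (Finsupp.single n 1) = if m + n = 0 then qInt q m else 0 := by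
  have h : n = -m ↔ m + n = 0 := by omega
  simp [qForm, Finsupp.single_apply, h]

/-- A form on a space with a basis is alternating if it is skew on basis vectors. -/
theorem isAlt_of_single {ω : LinearMap.BilinForm ℂ (ℤ →₀ ℂ)}
    (h : ∀ m n, ω (Finsupp.single m 1) (Finsupp.single n 1) =
      - ω (Finsupp.single n 1) (Finsupp.single m 1)) : ω.IsAlt := by
  have key : ω = -ω.flip := by
    ext m n
    simpa using h m n
  intro x
  have hx : ω x x = - ω x x := by
    conv_lhs => rw [key]
    simp
  exact self_eq_neg.mp hx

theorem qForm_isAlt (q : ℂ) : (qForm q).IsAlt := by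
  refine isAlt_of_single fun m n => ?_
  rw [qForm_single, qForm_single, add_comm n m]
  split_ifs with h
  · obtain rfl : n = -m := by omega
    simp only [qInt, neg_neg]
    ring
  · simp

/-- The `q`-Heisenberg Lie algebra: it has basis `c`, `β_m` (`m ∈ ℤ`), with `c` central and
`[β_m, β_n] = [m]_q δ_{m+n,0} c`. -/
abbrev QHeisenberg (q : ℂ) := Heisenberg (qForm_isAlt q)

/-- The generator `β_m` of the `q`-Heisenberg Lie algebra. -/
def β (q : ℂ) (m : ℤ) : QHeisenberg q := Heisenberg.of _ (Finsupp.single m 1)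

theorem lie_β (q : ℂ) (m n : ℤ) :
    ⁅β q m, β q n⁆ = (if m + n = 0 then qInt q m else 0) • Heisenberg.c (qForm_isAlt q) := by
  apply Heisenberg.ext
  · rw [Heisenberg.vec_lie, Heisenberg.vec_smul]
    simp [Heisenberg.c]
  · rw [Heisenberg.cen_smul, Heisenberg.cen_lie, ← qForm_single]
    simp [β, Heisenberg.c, Heisenberg.of]

section Modules

variable (q : ℂ) (W : Type*) [AddCommGroup W] [Module ℂ W]
  [LieRingModule (QHeisenberg q) W] [LieModule ℂ (QHeisenberg q) W]

/-- The central element acts as the scalar `ℓ`. -/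
def HasLevel (ℓ : ℂ) : Prop := ∀ w : W, ⁅Heisenberg.c (qForm_isAlt q), w⁆ = ℓ • w

/-- For every `w`, one has `β_n w = 0` for all sufficiently large `n`. -/
def IsRestricted : Prop := ∀ w : W, ∃ N : ℤ, ∀ n ≥ N, ⁅β q n, w⁆ = 0

variable {W}

/-- The field `β(x) = ∑_n β_n x^{-n}` in `Hom(W, W((x)))`; its coefficient of `x^n` is `β_{-n}`. -/
def βField (hW : IsRestricted q W) : VertexOperator ℂ W :=
  VertexOperator.of_coeff (fun n => LieModule.toEnd ℂ (QHeisenberg q) W (β q (-n))) (by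
    intro w
    obtain ⟨N, hN⟩ := hW w
    refine ⟨-N, fun n hn => ?_⟩
    by_contra hlt
    exact hn (by simpa using hN (-n) (by omega)))

end Modules

/-- For `A(x)` in `Hom(W, W((x)))` and a scalar `a`, the field `A(a x)`. -/
def dilate {W : Type*} [AddCommGroup W] [Module ℂ W] (a : ℂ) (A : VertexOperator ℂ W) :
    VertexOperator ℂ W :=
  HVertexOperator.of_coeff (fun n : ℤ => a ^ n • HVertexOperator.coeff A n) (by
    intro w
    refine (HVertexOperator.coeff_isPWOsupport A w).mono fun n hn hA => hn ?_
    have hA' : HVertexOperator.coeff A n w = 0 := hA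
    simp only [LinearMap.smul_apply, hA', smul_zero])

/-! ### Vertex algebras -/

/-- A vertex algebra structure on a complex vector space `V`: a state-field map
`Y(u, x) = ∑_n u_n x^{-n-1}` with values in `Hom(V, V((x)))`, where `u_n` is
`ncoeff (Y u) n`, and a vacuum vector, such that the vacuum and creation properties and the Borcherds identity (the
component form of the Jacobi identity) hold. By truncation all sums in it are finite. -/
@[ext]
structure VertexAlgebra (V : Type*) [AddCommGroup V] [Module ℂ V] where
  /-- the state-field map -/
  Y : V →ₗ[ℂ] VertexOperator ℂ V
  /-- the vacuum vector -/
  vac : V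
  vacuum : ∀ (n : ℤ) (v : V), ncoeff (Y vac) n v = if n = -1 then v else 0
  creation : ∀ v : V, ncoeff (Y v) (-1) vac = v
  creation_regular : ∀ (v : V) (n : ℤ), 0 ≤ n → ncoeff (Y v) n vac = 0
  borcherds : ∀ (u v w : V) (l m n : ℤ),
    ∑ᶠ i : ℕ, Ring.choose m i • ncoeff (Y (ncoeff (Y u) (l + i) v)) (m + n - i) w =
      ∑ᶠ i : ℕ, ((-1) ^ i * Ring.choose l i) •
        (ncoeff (Y u) (m + l - i) (ncoeff (Y v) (n + i) w)
          - Int.negOnePow l • ncoeff (Y v) (n + l - i) (ncoeff (Y u) (m + i) w))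

namespace VertexAlgebra

variable {V : Type*} [AddCommGroup V] [Module ℂ V] (𝒱 : VertexAlgebra V)

/-- Automorphisms of a vertex algebra. -/
structure IsAutomorphism (σ : V →ₗ[ℂ] V) : Prop where
  bijective : Function.Bijective σ
  map_vac : σ 𝒱.vac = 𝒱.vac
  map_Y : ∀ (u v : V) (n : ℤ), σ (ncoeff (𝒱.Y u) n v) =
    ncoeff (𝒱.Y (σ u)) n (σ v)

end VertexAlgebra

/-! ### `φ`-coordinated quasi modules for `φ(x, z) = x e^z` -/

section PhiModules

variable {V W : Type*} [AddCommGroup V] [Module ℂ V] [AddCommGroup W] [Module ℂ W]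

/-- The coefficient of `x₁^m x₂^n` in `p(x₁, x₂) A(x₁) B(x₂)`. -/
def polyMulCoeff (p : MvPolynomial (Fin 2) ℂ) (A B : VertexOperator ℂ W) (m n : ℤ) :
    Module.End ℂ W :=
  ∑ s ∈ p.support, p.coeff s •
    (HVertexOperator.coeff A (m - s 0) ∘ₗ HVertexOperator.coeff B (n - s 1))

/-- `p(x₁, x₂) A(x₁) B(x₂)` lies in `Hom(W, W((x₁, x₂)))`, where `W((x₁, x₂))` is the space of
doubly infinite series in which the exponents of both variables are bounded below. -/
def IsQuasiCompatible (p : MvPolynomial (Fin 2) ℂ) (A B : VertexOperator ℂ W) : Prop :=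
  ∀ w : W, ∃ N : ℤ, ∀ m n : ℤ, m < N ∨ n < N → polyMulCoeff p A B m n w = 0

/-- The coefficient of `z^k` in `e^{m z}`. -/
def expCoeff (m : ℤ) (k : ℕ) : ℂ := (m : ℂ) ^ k / (k.factorial : ℂ)

/-- The coefficient of `x₀^i x₂^j` in `F(x₂ e^{x₀}, x₂)`, for a series
`F(x₁, x₂) = ∑ F_{m,n} x₁^m x₂^n` in `W((x₁, x₂))` (for which the sum is finite). -/
def substCoeff (F : ℤ → ℤ → W) (i j : ℤ) : W :=
  if 0 ≤ i then ∑ᶠ m : ℤ, expCoeff m i.toNat • F m (j - m) else 0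

/-- The coefficient of `x₀^i x₂^j` in `p(x₂ e^{x₀}, x₂) Y_W(Y(u, x₀) v, x₂) w`; the sums over `k`
are finite because `Y(u, x₀) v` lies in `V((x₀))`. -/
def iterateCoeff (𝒱 : VertexAlgebra V) (YW : V →ₗ[ℂ] VertexOperator ℂ W)
    (p : MvPolynomial (Fin 2) ℂ) (u v : V) (w : W) (i j : ℤ) : W :=
  ∑ s ∈ p.support, p.coeff s • ∑ᶠ k : ℕ, expCoeff (s 0) k •
    HVertexOperator.coeff (YW (HVertexOperator.coeff (𝒱.Y u) (i - k) v)) (j - s 0 - s 1) w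

/-- `(W, Y_W)` is a `φ`-coordinated quasi module for the vertex algebra, with `φ(x, z) = x e^z`. -/
structure IsPhiQuasiModule (𝒱 : VertexAlgebra V) (YW : V →ₗ[ℂ] VertexOperator ℂ W) : Prop where
  map_vac : ∀ (n : ℤ) (w : W),
    HVertexOperator.coeff (YW 𝒱.vac) n w = if n = 0 then w else 0
  quasi_assoc : ∀ u v : V, ∃ p : MvPolynomial (Fin 2) ℂ, p ≠ 0 ∧
    IsQuasiCompatible p (YW u) (YW v) ∧
    ∀ (w : W) (i j : ℤ), iterateCoeff 𝒱 YW p u v w i j =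
      substCoeff (fun m n => polyMulCoeff p (YW u) (YW v) m n w) i j

end PhiModules

/-! ### The Heisenberg vertex algebra -/

/-- The form on the space `B` with basis `β^{(r)} = Finsupp.single r 1`, `r ∈ ℤ`, such that
`⟨β^{(r)}, β^{(s)}⟩ = (q - q⁻¹)⁻¹ (δ_{r,s+1} - δ_{r,s-1})`. -/
def formB (q : ℂ) : LinearMap.BilinForm ℂ (ℤ →₀ ℂ) :=
  Finsupp.linearCombination ℂ fun r : ℤ =>
    (q - q⁻¹)⁻¹ • (Finsupp.lapply (R := ℂ) (r - 1) - Finsupp.lapply (R := ℂ) (r + 1))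

theorem formB_single (q : ℂ) (r s : ℤ) :
    formB q (Finsupp.single r 1) (Finsupp.single s 1) =
      (q - q⁻¹)⁻¹ * ((if r = s + 1 then 1 else 0) - (if r = s - 1 then 1 else 0)) := by
  have h1 : s = r - 1 ↔ r = s + 1 := by omega
  have h2 : s = r + 1 ↔ r = s - 1 := by omega
  simp [formB, Finsupp.single_apply, h1, h2]

theorem formB_isAlt (q : ℂ) : (formB q).IsAlt := by
  refine isAlt_of_single fun m n => ?_
  rw [formB_single, formB_single]
  have h1 : m = n + 1 ↔ n = m - 1 := by omega
  have h2 : m = n - 1 ↔ n = m + 1 := by omega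
  simp only [h1, h2]
  ring

/-- The pairing `(f, g) ↦ Res_t f(t) g(t)` on Laurent polynomials. -/
def resForm : LinearMap.BilinForm ℂ ℂ[T;T⁻¹] :=
  (LinearMap.mul ℂ ℂ[T;T⁻¹]).compr₂
    (Finsupp.lapply (R := ℂ) (-1 : ℤ) ∘ₗ (AddMonoidAlgebra.coeffLinearEquiv ℂ).toLinearMap)

theorem resForm_comm (f g : ℂ[T;T⁻¹]) : resForm f g = resForm g f := by
  simp [resForm, mul_comm]

/-- The space `B ⊗ ℂ[t, t⁻¹]`. -/
abbrev LB := (ℤ →₀ ℂ) ⊗[ℂ] ℂ[T;T⁻¹]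

/-- The form on `B ⊗ ℂ[t, t⁻¹]` such that
`ω(a ⊗ t^m, b ⊗ t^n) = ⟨a, b⟩ δ_{m+n+1,0}`. -/
def affForm (q : ℂ) : LinearMap.BilinForm ℂ LB :=
  LinearMap.BilinForm.tmul (formB q) resForm

theorem affForm_tmul (q : ℂ) (a b : ℤ →₀ ℂ) (f g : ℂ[T;T⁻¹]) :
    affForm q (a ⊗ₜ f) (b ⊗ₜ g) = formB q a b * resForm f g := by
  simp [affForm, LinearMap.BilinForm.tmul, mul_comm]

theorem affForm_T (q : ℂ) (a b : ℤ →₀ ℂ) (m n : ℤ) :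
    affForm q (a ⊗ₜ LaurentPolynomial.T m) (b ⊗ₜ LaurentPolynomial.T n) =
      if m + n + 1 = 0 then formB q a b else 0 := by
  have h : m + n = -1 ↔ m + n + 1 = 0 := by omega
  rw [affForm_tmul]
  have : resForm (LaurentPolynomial.T m) (LaurentPolynomial.T n) =
      if m + n + 1 = 0 then 1 else 0 := by
    change ((LaurentPolynomial.T m : ℂ[T;T⁻¹]) * LaurentPolynomial.T n).coeff (-1) = _
    rw [← LaurentPolynomial.T_add]
    change (Finsupp.single (m + n) (1 : ℂ)) (-1) = _
    rw [Finsupp.single_apply]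
    simp only [h]
  simp [this]

theorem affForm_isAlt (q : ℂ) : (affForm q).IsAlt := by
  have key : affForm q = -(affForm q).flip := by
    refine TensorProduct.ext' fun a f => ?_
    refine TensorProduct.ext' fun b g => ?_
    change affForm q (a ⊗ₜ f) (b ⊗ₜ g) = - affForm q (b ⊗ₜ g) (a ⊗ₜ f)
    rw [affForm_tmul, affForm_tmul, resForm_comm f g, ← (formB_isAlt q).neg_eq a b]
    ring
  intro x
  have hx : affForm q x x = - affForm q x x := by
    conv_lhs => rw [key]
    simp
  exact self_eq_neg.mp hx

/-- The affine Heisenberg Lie algebra `B ⊗ ℂ[t, t⁻¹] ⊕ ℂ c`. -/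
abbrev BHat (q : ℂ) := Heisenberg (A := LB) (affForm_isAlt q)

/-- The element `b_n = b ⊗ t^n`, for `b ∈ B`. -/
def bMode (q : ℂ) (n : ℤ) : (ℤ →₀ ℂ) →ₗ[ℂ] BHat q :=
  Heisenberg.of (A := LB) (affForm_isAlt q) ∘ₗ
    (TensorProduct.mk ℂ (ℤ →₀ ℂ) ℂ[T;T⁻¹]).flip (LaurentPolynomial.T n)

theorem lie_bMode (q : ℂ) (m n : ℤ) (a b : ℤ →₀ ℂ) :
    ⁅bMode q m a, bMode q n b⁆ =
      (if m + n + 1 = 0 then formB q a b else 0) • Heisenberg.c (A := LB) (affForm_isAlt q) := by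
  apply Heisenberg.ext
  · rw [Heisenberg.vec_lie, Heisenberg.vec_smul]
    simp [Heisenberg.c]
  · rw [Heisenberg.cen_smul, Heisenberg.cen_lie, ← affForm_T]
    simp [bMode, Heisenberg.c, Heisenberg.of]

/-- The universal enveloping algebra of the affine Heisenberg Lie algebra. -/
abbrev UB (q : ℂ) := UniversalEnvelopingAlgebra ℂ (BHat q)

/-- The elements `b_n` (`b ∈ B`, `n ≥ 0`) and `c - ℓ` of the enveloping algebra. -/
def annihilators (q ℓ : ℂ) : Set (UB q) :=
  {x | ∃ (b : ℤ →₀ ℂ) (n : ℤ), 0 ≤ n ∧ x = UniversalEnvelopingAlgebra.ι ℂ (bMode q n b)} ∪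
    {UniversalEnvelopingAlgebra.ι ℂ (Heisenberg.c (A := LB) (affForm_isAlt q)) - algebraMap ℂ (UB q) ℓ}

/-- The left ideal generated by these elements. -/
def vacIdeal (q ℓ : ℂ) : Submodule (UB q) (UB q) := Submodule.span (UB q) (annihilators q ℓ)

/-- The vacuum module of level `ℓ`, that is, the module induced from the one-dimensional module of
`B ⊗ ℂ[t] ⊕ ℂ c` on which `B ⊗ ℂ[t]` acts as `0` and `c` as `ℓ`. The induced module is realized
as the quotient of the enveloping algebra by the left ideal generated by the `x - χ(x)`, where
`χ` is the character of the one-dimensional module. -/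
abbrev VB (q ℓ : ℂ) := UB q ⧸ vacIdeal q ℓ

/-- The vector `𝟏 = 1 ⊗ 1`. -/
def vacVec (q ℓ : ℂ) : VB q ℓ := (vacIdeal q ℓ).mkQ 1

/-- The vector `b_{-1} 𝟏`, with which `b ∈ B` is identified. -/
def ofB (q ℓ : ℂ) (b : ℤ →₀ ℂ) : VB q ℓ :=
  UniversalEnvelopingAlgebra.ι ℂ (bMode q (-1) b) • vacVec q ℓ

/-- The vertex algebra structure on the vacuum module is the one for which `𝟏` is the vacuum vector
and `Y(b, x) = b(x) = ∑_n b_n x^{-n-1}` for `b ∈ B`. -/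
structure IsHeisenbergVA {q ℓ : ℂ} (𝒱 : VertexAlgebra (VB q ℓ)) : Prop where
  vac_eq : 𝒱.vac = vacVec q ℓ
  Y_ofB : ∀ (b : ℤ →₀ ℂ) (n : ℤ) (v : VB q ℓ),
    ncoeff (𝒱.Y (ofB q ℓ b)) n v =
      UniversalEnvelopingAlgebra.ι ℂ (bMode q n b) • v

/-! ### The action of `ℤ` on the vacuum module -/

/-- The linear map of `B` with `β^{(r)} ↦ β^{(r+m)}`. -/
def shiftB (m : ℤ) : (ℤ →₀ ℂ) →ₗ[ℂ] (ℤ →₀ ℂ) := Finsupp.lmapDomain ℂ ℂ fun r => r + m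

theorem formB_shiftB (q : ℂ) (m : ℤ) (a b : ℤ →₀ ℂ) :
    formB q (shiftB m a) (shiftB m b) = formB q a b := by
  have h : (formB q).compl₁₂ (shiftB m) (shiftB m) = formB q := by
    ext r s
    have h1 : r + m = s + m + 1 ↔ r = s + 1 := by omega
    have h2 : r + m = s + m - 1 ↔ r = s - 1 := by omega
    simp [shiftB, formB_single, h1, h2]
  exact LinearMap.congr_fun₂ h a b

theorem affForm_shiftB (q : ℂ) (m : ℤ) (x y : LB) :
    affForm q ((shiftB m).rTensor _ x) ((shiftB m).rTensor _ y) = affForm q x y := by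
  have h : (affForm q).compl₁₂ ((shiftB m).rTensor _) ((shiftB m).rTensor _) = affForm q := by
    refine TensorProduct.ext' fun a f => ?_
    refine TensorProduct.ext' fun b g => ?_
    simp [affForm_tmul, formB_shiftB]
  exact LinearMap.congr_fun₂ h x y

/-- The Lie algebra endomorphism with `β^{(r)} ⊗ t^n ↦ β^{(r+m)} ⊗ t^n` and `c ↦ c`. -/
def shiftBHat (q : ℂ) (m : ℤ) : BHat q →ₗ⁅ℂ⁆ BHat q :=
  Heisenberg.map (A := LB) (affForm_isAlt q) ((shiftB m).rTensor _) (affForm_shiftB q m)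

theorem shiftBHat_bMode (q : ℂ) (m n : ℤ) (b : ℤ →₀ ℂ) :
    shiftBHat q m (bMode q n b) = bMode q n (shiftB m b) := by
  ext <;> simp [shiftBHat, Heisenberg.map, bMode, Heisenberg.of]

theorem shiftBHat_c (q : ℂ) (m : ℤ) :
    shiftBHat q m (Heisenberg.c (A := LB) (affForm_isAlt q)) = Heisenberg.c (A := LB) (affForm_isAlt q) := by
  ext <;> simp [shiftBHat, Heisenberg.map, Heisenberg.c]

attribute [local instance 100] LieRing.ofAssociativeRing

/-- The induced algebra endomorphism of the enveloping algebra. -/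
def shiftUB (q : ℂ) (m : ℤ) : UB q →ₐ[ℂ] UB q :=
  UniversalEnvelopingAlgebra.lift ℂ ((UniversalEnvelopingAlgebra.ι ℂ).comp (shiftBHat q m))

theorem shiftUB_ι (q : ℂ) (m : ℤ) (x : BHat q) :
    shiftUB q m (UniversalEnvelopingAlgebra.ι ℂ x) =
      UniversalEnvelopingAlgebra.ι ℂ (shiftBHat q m x) :=
  UniversalEnvelopingAlgebra.lift_ι_apply ℂ _ x

theorem shiftUB_mem (q ℓ : ℂ) (m : ℤ) {x : UB q} (hx : x ∈ vacIdeal q ℓ) :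
    shiftUB q m x ∈ vacIdeal q ℓ := by
  induction hx using Submodule.span_induction with
  | mem x hx =>
    refine Submodule.subset_span ?_
    rcases hx with ⟨b, n, hn, rfl⟩ | hx
    · exact Or.inl ⟨shiftB m b, n, hn, by rw [shiftUB_ι, shiftBHat_bMode]⟩
    · obtain rfl := hx
      refine Or.inr ?_
      rw [map_sub, shiftUB_ι, shiftBHat_c, AlgHom.commutes]
      rfl
  | zero => simp
  | add x y _ _ hx hy => rw [map_add]; exact add_mem hx hy
  | smul a x _ hx =>
    rw [smul_eq_mul, map_mul]
    exact Submodule.smul_mem _ _ hx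

/-- The linear map `ρ_m` of the vacuum module with `ρ_m 𝟏 = 𝟏` that intertwines the actions of
`β^{(r)} ⊗ t^n` and `β^{(r+m)} ⊗ t^n`. -/
def ρ (q ℓ : ℂ) (m : ℤ) : VB q ℓ →ₗ[ℂ] VB q ℓ :=
  ((vacIdeal q ℓ).restrictScalars ℂ).mapQ ((vacIdeal q ℓ).restrictScalars ℂ)
    (shiftUB q m).toLinearMap fun _ hx => shiftUB_mem q ℓ m hx

theorem ρ_vacVec (q ℓ : ℂ) (m : ℤ) : ρ q ℓ m (vacVec q ℓ) = vacVec q ℓ := by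
  change (vacIdeal q ℓ).mkQ (shiftUB q m 1) = (vacIdeal q ℓ).mkQ 1
  rw [map_one]

theorem ρ_smul (q ℓ : ℂ) (m : ℤ) (a : UB q) (v : VB q ℓ) :
    ρ q ℓ m (a • v) = shiftUB q m a • ρ q ℓ m v := by
  obtain ⟨x, rfl⟩ := (vacIdeal q ℓ).mkQ_surjective v
  change (vacIdeal q ℓ).mkQ (shiftUB q m (a * x)) =
    shiftUB q m a • (vacIdeal q ℓ).mkQ (shiftUB q m x)
  rw [map_mul, ← smul_eq_mul, map_smul]

theorem ρ_ofB (q ℓ : ℂ) (m r : ℤ) :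
    ρ q ℓ m (ofB q ℓ (Finsupp.single r 1)) = ofB q ℓ (Finsupp.single (r + m) 1) := by
  rw [ofB, ρ_smul, ρ_vacVec, shiftUB_ι, shiftBHat_bMode]
  simp [ofB, shiftB]

/-- A `φ`-coordinated quasi module structure on `W` for the Heisenberg vertex algebra is covariant
with respect to `Γ_q = {q^m : m ∈ ℤ}` if every `ρ_m` is an automorphism of the vertex algebra and
`Y_W(ρ_m v, x) = Y_W(v, q^m x)`. -/
structure IsGammaCovariant {q ℓ : ℂ} {W : Type*} [AddCommGroup W] [Module ℂ W]
    (𝒱 : VertexAlgebra (VB q ℓ)) (YW : VB q ℓ →ₗ[ℂ] VertexOperator ℂ W) : Prop where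
  isAutomorphism : ∀ m : ℤ, 𝒱.IsAutomorphism (ρ q ℓ m)
  covariant : ∀ (m : ℤ) (v : VB q ℓ), YW (ρ q ℓ m v) = dilate (q ^ m) (YW v)

end QHeis

end

noncomputable section

open scoped TensorProduct LaurentPolynomial
open Filter Finset

namespace QHeis

open VertexOperator (ncoeff)

/-! ### Locally finite sums over `ℕ` -/

section Finsum

variable {M N : Type*} [AddCommGroup M] [AddCommGroup N]

/-! The vacuum module is a Fock space, the polynomial ring in variables `X (r, k)` standing for the
creation operators `β^{(r)}_{-k-1}`; the operators `β^{(r)}_k` with `k ≥ 0` act as derivations with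
constant coefficients. `Fock.equivVB` proves this by mapping in both directions, using only the
relations of the enveloping algebra. On the Fock space, the field of `X (r, k) * u` is the normally
ordered product of `(1/k!) ∂^k β^{(r)}(x)` with the field of `u`. The three sums of the Borcherds
identity obey parallel recursions under `u ↦ X (r, k) * u`, the sign `(-1)^l` accounting for the
only difference between them (`Fock.compSum_X_mul`, `Fock.revSum_X_mul`, `Fock.iterSum_X_mul`), so
the identity follows from the binomial identity for `u = 1`. Uniqueness of the structure holds
because the modes of `u_l v` are determined by those of `u` and `v`.

On `W` the generating fields are `(x∂)^k β(q^r x) / k!`. Two of them have a contraction which is a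
rational function of `t = x₂/x₁`: for `k = 0` it is `∑_n ℓ [n]_q q^{(s-r)n} t^n = ℓ (q - q⁻¹)⁻¹
(1/(1 - q^{s-r+1} t) - 1/(1 - q^{s-r-1} t))`. At `t = e^{-z}` it has at most a simple pole at `z =
0`. Since `q` is not a root of unity, the pole occurs only for `r = s ± 1`, and its residue is `ℓ
⟨β^{(r)}, β^{(s)}⟩`: the singular part is exactly that of the vertex algebra. The regular part is a
discrepancy between the two normal orderings. Its constant terms `gconst` are symmetric, so they
define a commuting family of operators "multiply by `X_a`, then add the contraction with `X_a`", and
hence a map `Fock.wick` from Fock space to itself. The state-field map `quasiY` is `Fock.wick`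
followed by normal ordering on `W`.

For condition 1, the product `Y_W(u, x₁) Y_W(v, x₂) w` is written as a series in `t` and the total
degree `d`, and the iterate `Y_W(Y(u, z) v, x₂) w` as a series in `z` and `d`, multiplied by
`e^{-dz}`. Multiplying `u` by `X_a` changes both by the same recursion (`prodH_X_mul`,
`iterH_X_mul`), except that the product involves the expansion of the contraction in `t` and the
iterate its expansion at `t = e^{-z}`. Induction on `u` (`isGood`) therefore gives a polynomial `π ≠
0` such that, in every degree, `π(t)` times the product is a Laurent polynomial in `t`, and
`π(e^{-z})` times the iterate is its value at `t = e^{-z}`. Homogenizing `π` gives the required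
`p(x₁, x₂)`.

Covariance holds because the contraction depends only on `s - r`, so shifting all upper indices by
`m` amounts to replacing `x` by `q^m x`. Uniqueness of `Y_W` holds because multiplication by `p(x₂
e^z, x₂)` is injective (`expPoly_injective`): the iterate is then determined by the two fields
(`compH_eq`), and the states `β^{(r)}` generate. -/

theorem hasFiniteSupport_of_eventually {f : ℕ → M} (h : ∀ᶠ i in atTop, f i = 0) :
    f.HasFiniteSupport := by
  rw [← Nat.cofinite_eq_atTop] at h
  exact h

theorem finsum_eq_sum_range {f : ℕ → M} {n : ℕ} (h : ∀ i, n ≤ i → f i = 0) :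
    ∑ᶠ i, f i = ∑ i ∈ range n, f i := by
  refine finsum_eq_sum_of_support_subset _ fun i hi => ?_
  by_contra hn
  exact hi (h i (by simpa using hn))

theorem finsum_add_eventually {f g : ℕ → M} (hf : ∀ᶠ i in atTop, f i = 0)
    (hg : ∀ᶠ i in atTop, g i = 0) : ∑ᶠ i, (f i + g i) = ∑ᶠ i, f i + ∑ᶠ i, g i :=
  finsum_add_distrib (hasFiniteSupport_of_eventually hf) (hasFiniteSupport_of_eventually hg)

theorem finsum_sub_eventually {f g : ℕ → M} (hf : ∀ᶠ i in atTop, f i = 0)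
    (hg : ∀ᶠ i in atTop, g i = 0) : ∑ᶠ i, (f i - g i) = ∑ᶠ i, f i - ∑ᶠ i, g i :=
  finsum_sub_distrib (hasFiniteSupport_of_eventually hf) (hasFiniteSupport_of_eventually hg)

theorem map_finsum_eventually {F : Type*} [FunLike F M N] [AddMonoidHomClass F M N] (L : F)
    {f : ℕ → M} (hf : ∀ᶠ i in atTop, f i = 0) : L (∑ᶠ i, f i) = ∑ᶠ i, L (f i) :=
  (AddMonoidHomClass.toAddMonoidHom L).map_finsum (hasFiniteSupport_of_eventually hf)

theorem smul_finsum_eventually {R : Type*} [Semiring R] [Module R M] (c : R)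
    {f : ℕ → M} (hf : ∀ᶠ i in atTop, f i = 0) : c • (∑ᶠ i, f i) = ∑ᶠ i, c • f i :=
  (DistribSMul.toAddMonoidHom M c).map_finsum (hasFiniteSupport_of_eventually hf)

/-- A doubly indexed family vanishes outside of some square. -/
def VanishesFar (f : ℕ → ℕ → M) : Prop := ∃ n, ∀ i j, n ≤ i ∨ n ≤ j → f i j = 0

theorem vanishesFar_of_eventually {f : ℕ → ℕ → M} (h1 : ∀ᶠ i in atTop, ∀ j, f i j = 0)
    (h2 : ∀ i, ∀ᶠ j in atTop, f i j = 0) : VanishesFar f := by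
  obtain ⟨a, ha⟩ := eventually_atTop.1 h1
  choose b hb using fun i => eventually_atTop.1 (h2 i)
  -- The sum dominates each of the finitely many bounds `b i`, `i < a`; rows beyond `a` vanish
  -- identically.
  refine ⟨a + ∑ i ∈ range a, b i, fun i j hij => ?_⟩
  rcases le_or_gt a i with h | h
  · exact ha i h j
  · refine hb i j ?_
    have := Finset.single_le_sum (f := b) (fun _ _ => Nat.zero_le _) (Finset.mem_range.2 h)
    omega

theorem VanishesFar.swap {f : ℕ → ℕ → M} (h : VanishesFar f) : VanishesFar fun i j => f j i := by
  obtain ⟨n, hn⟩ := h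
  exact ⟨n, fun i j hij => hn j i hij.symm⟩

theorem VanishesFar.left {f : ℕ → ℕ → M} (h : VanishesFar f) (j : ℕ) :
    ∀ᶠ i in atTop, f i j = 0 := by
  obtain ⟨n, hn⟩ := h
  exact eventually_atTop.2 ⟨n, fun i hi => hn i j (.inl hi)⟩

theorem VanishesFar.right {f : ℕ → ℕ → M} (h : VanishesFar f) (i : ℕ) :
    ∀ᶠ j in atTop, f i j = 0 := h.swap.left i

theorem VanishesFar.finsum_eq {f : ℕ → ℕ → M} {n : ℕ}
    (hn : ∀ i j, n ≤ i ∨ n ≤ j → f i j = 0) :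
    ∑ᶠ i, ∑ᶠ j, f i j = ∑ i ∈ range n, ∑ j ∈ range n, f i j := by
  rw [finsum_eq_sum_range (n := n)]
  · exact Finset.sum_congr rfl fun i _ => finsum_eq_sum_range fun j hj => hn i j (.inr hj)
  · intro i hi
    exact finsum_eq_zero_of_forall_eq_zero fun j => hn i j (.inl hi)

theorem VanishesFar.finsum_left {f : ℕ → ℕ → M} (h : VanishesFar f) :
    ∀ᶠ i in atTop, ∑ᶠ j, f i j = 0 := by
  obtain ⟨n, hn⟩ := h
  exact eventually_atTop.2 ⟨n, fun i hi =>
    finsum_eq_zero_of_forall_eq_zero fun j => hn i j (.inl hi)⟩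

theorem VanishesFar.finsum_comm {f : ℕ → ℕ → M} (h : VanishesFar f) :
    ∑ᶠ i, ∑ᶠ j, f i j = ∑ᶠ j, ∑ᶠ i, f i j := by
  obtain ⟨n, hn⟩ := h
  rw [VanishesFar.finsum_eq hn, VanishesFar.finsum_eq fun i j h => hn j i h.symm, Finset.sum_comm]

theorem VanishesFar.finsum_antidiagonal {f : ℕ → ℕ → M} (h : VanishesFar f) :
    ∑ᶠ i, ∑ᶠ j, f i j = ∑ᶠ p, ∑ x ∈ antidiagonal p, f x.1 x.2 := by
  obtain ⟨n, hn⟩ := h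
  rw [VanishesFar.finsum_eq hn, finsum_eq_sum_range (n := 2 * n)]
  · rw [← Finset.sum_product',
      ← Finset.sum_fiberwise_of_maps_to (s := range n ×ˢ range n) (t := range (2 * n))
        (g := fun x : ℕ × ℕ => x.1 + x.2)]
    · refine Finset.sum_congr rfl fun p _ => ?_
      refine Finset.sum_subset (fun x hx => ?_) fun x hx hx' => ?_
      · rw [Finset.mem_filter] at hx
        exact HasAntidiagonal.mem_antidiagonal.2 hx.2
      · refine hn _ _ ?_
        rw [HasAntidiagonal.mem_antidiagonal] at hx
        by_contra hcon
        refine hx' ?_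
        simp only [Finset.mem_filter, Finset.mem_product, Finset.mem_range]
        omega
    · intro x hx
      simp only [Finset.mem_product, Finset.mem_range] at hx ⊢
      omega
  · intro p hp
    refine Finset.sum_eq_zero fun x hx => hn _ _ ?_
    rw [HasAntidiagonal.mem_antidiagonal] at hx
    omega

/-- Regroup a double sum along antidiagonals with scalar coefficients. -/
theorem finsum_antidiagonal_smul (c : ℕ → ℕ → ℤ) (f : ℕ → M)
    (h : ∀ᶠ i in atTop, f i = 0) (d : ℕ → ℤ)
    (hd : ∀ p, d p = ∑ x ∈ antidiagonal p, c x.1 x.2) :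
    ∑ᶠ i, ∑ᶠ j, c i j • f (i + j) = ∑ᶠ p, d p • f p := by
  obtain ⟨n, hn⟩ := eventually_atTop.1 h
  rw [VanishesFar.finsum_antidiagonal (f := fun i j => c i j • f (i + j))]
  · refine finsum_congr fun p => ?_
    rw [hd, Finset.sum_smul]
    refine Finset.sum_congr rfl fun x hx => ?_
    rw [HasAntidiagonal.mem_antidiagonal.1 hx]
  · exact ⟨n, fun i j hij => by simp only [hn (i + j) (by omega), smul_zero]⟩

/-- Discard the first `k` terms when they vanish. -/
theorem finsum_shift {f : ℕ → M} (k : ℕ) (h : ∀ i < k, f i = 0) :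
    ∑ᶠ i, f i = ∑ᶠ i, f (i + k) := by
  rw [← finsum_mem_univ fun i => f (i + k), ← finsum_mem_image (g := fun i : ℕ => i + k)
    (s := Set.univ) (f := f) (fun a _ b _ hab => by simpa using hab),
    ← finsum_mem_univ f]
  refine finsum_mem_inter_support_eq f _ _ ?_
  ext i
  simp only [Set.image_univ, Set.mem_inter_iff, Set.mem_range, Set.mem_univ, true_and,
    Function.mem_support, iff_and_self]
  intro hi
  exact ⟨i - k, Nat.sub_add_cancel (not_lt.1 fun hik => hi (h i hik))⟩

end Finsum

/-! ### Binomial identities -/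

/-- The coefficients of `(1 + x)^{-k-1}`. They let the normal ordering coefficients take part in
Vandermonde convolutions. -/
theorem choose_add_neg (k i : ℕ) :
    Ring.choose (-(k + 1 : ℤ)) i = (-1) ^ i * ((i + k).choose k : ℤ) := by
  rw [Ring.choose_neg', Ring.multichoose_eq]
  have : ((k : ℤ) + 1 + i - 1) = ((i + k : ℕ) : ℤ) := by push_cast; ring
  rw [this, Ring.choose_natCast, ← Nat.choose_symm_add, Units.smul_def, smul_eq_mul]
  simp [Int.negOnePow_def]

/-- Vandermonde's convolution for `l + (-(k + 1))`, with all signs moved to the other factor. It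
lowers the parameter `l` in the recursions for the composites. -/
theorem sum_choose_mul_choose (l : ℤ) (k p : ℕ) :
    ∑ x ∈ antidiagonal p, (-1) ^ x.1 * Ring.choose l x.1 * ((x.2 + k).choose k : ℤ) =
      (-1) ^ p * Ring.choose (l - k - 1) p := by
  have h : l - k - 1 = l + -(k + 1 : ℤ) := by ring
  rw [h, Ring.add_choose_eq _ (Commute.all _ _), Finset.mul_sum]
  refine Finset.sum_congr rfl fun x hx => ?_
  rw [choose_add_neg, ← HasAntidiagonal.mem_antidiagonal.1 hx, pow_add]
  have : ((-1 : ℤ) ^ x.2) * (-1) ^ x.2 = 1 := by rw [← mul_pow]; simp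
  linear_combination (-((-1) ^ x.1 * Ring.choose l x.1 * ((x.2 + k).choose k : ℤ))) * this

/-- `C(i+k,k) C(h+i+k,h)` is symmetric under `i ↔ h`, up to a common factor. -/
theorem choose_mul_choose_add (i h k : ℕ) :
    (i + k).choose k * (h + i + k).choose h = (h + k).choose k * (i + (h + k)).choose (h + k) := by
  have e1 := Nat.add_choose_mul_factorial_mul_factorial i k
  have e2 := Nat.add_choose_mul_factorial_mul_factorial h k
  have e3 := Nat.add_choose_mul_factorial_mul_factorial i (h + k)
  have e4 := Nat.add_choose_mul_factorial_mul_factorial h (i + k)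
  rw [← Nat.choose_symm_add] at e4
  have a5 : h + i + k = h + (i + k) := by ring
  have a6 : i + (h + k) = h + (i + k) := by ring
  rw [a6] at e3
  rw [a5, a6]
  have hpos : 0 < i.factorial * h.factorial * k.factorial := by positivity
  refine Nat.eq_of_mul_eq_mul_left hpos ?_
  calc _ = ((i + k).choose k * i.factorial * k.factorial) * ((h + (i + k)).choose h) * h.factorial := by ring
    _ = (h + (i + k)).choose h * h.factorial * (i + k).factorial := by rw [e1]; ring
    _ = (h + (i + k)).choose (h + k) * i.factorial * (h + k).factorial := by rw [e4, e3]
    _ = (h + (i + k)).choose (h + k) * i.factorial * ((h + k).choose k * h.factorial * k.factorial) := by rw [e2]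
    _ = _ := by ring

/-! ### Evaluating polynomials at commuting elements -/

section CommEval

variable {σ A : Type*} [Ring A] [Algebra ℂ A]

/-- Evaluation of polynomials at a commuting family of elements of an algebra. -/
theorem exists_commEval (f : σ → A) (hf : ∀ i j, f i * f j = f j * f i) :
    ∃ φ : MvPolynomial σ ℂ →ₐ[ℂ] A, ∀ i, φ (MvPolynomial.X i) = f i := by
  have hc : ∀ a ∈ Set.range f, ∀ b ∈ Set.range f, a * b = b * a := by
    rintro _ ⟨i, rfl⟩ _ ⟨j, rfl⟩
    exact hf i j
  -- `MvPolynomial.aeval` needs a commutative target; the subalgebra generated by a commuting family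
  -- is one.
  let _ : CommRing (Algebra.adjoin ℂ (Set.range f)) :=
    { (inferInstance : Ring (Algebra.adjoin ℂ (Set.range f))) with
      mul_comm := (Algebra.isMulCommutative_adjoin ℂ hc).is_comm.comm }
  refine ⟨(Algebra.adjoin ℂ (Set.range f)).val.comp (MvPolynomial.aeval fun i =>
    (⟨f i, Algebra.subset_adjoin ⟨i, rfl⟩⟩ : Algebra.adjoin ℂ (Set.range f))), fun i => ?_⟩
  simp

/-- The evaluation homomorphism at a commuting family. -/
def commEval (f : σ → A) (hf : ∀ i j, f i * f j = f j * f i) : MvPolynomial σ ℂ →ₐ[ℂ] A :=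
  (exists_commEval f hf).choose

@[simp]
theorem commEval_X (f : σ → A) (hf : ∀ i j, f i * f j = f j * f i) (i : σ) :
    commEval f hf (MvPolynomial.X i) = f i :=
  (exists_commEval f hf).choose_spec i

end CommEval

end QHeis

namespace QHeis

open VertexOperator (ncoeff)

/-! ### Coefficients of fields -/

section Fields

variable {W : Type*} [AddCommGroup W] [Module ℂ W]

/-- The coefficients of a field. -/
def cf : VertexOperator ℂ W →ₗ[ℂ] ℤ → Module.End ℂ W := HVertexOperator.coeff

theorem coeff_eq_cf (A : VertexOperator ℂ W) (n : ℤ) : HVertexOperator.coeff A n = cf A n := rfl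

theorem ncoeff_eq_cf (A : VertexOperator ℂ W) (n : ℤ) : ncoeff A n = cf A (-n - 1) := rfl

theorem cf_eq_ncoeff (A : VertexOperator ℂ W) (n : ℤ) : cf A n = ncoeff A (-n - 1) := by
  rw [ncoeff_eq_cf, show -(-n - 1) - 1 = n by ring]

theorem cf_injective : Function.Injective (cf (W := W)) := HVertexOperator.coeff_inj

theorem cf_ext {A B : VertexOperator ℂ W} (h : ∀ n w, cf A n w = cf B n w) : A = B :=
  cf_injective (funext fun n => LinearMap.ext (h n))

theorem cf_eventually (A : VertexOperator ℂ W) (w : W) : ∀ᶠ n in atBot, cf A n w = 0 := by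
  refine eventually_atBot.2 ⟨HahnSeries.order ((HahnModule.of ℂ).symm (A w)) - 1, fun n hn => ?_⟩
  exact VertexOperator.coeff_eq_zero_of_lt_order A n w (by omega)

/-- A field with given coefficients. -/
def mkField (f : ℤ → Module.End ℂ W) (hf : ∀ w, ∀ᶠ n in atBot, f n w = 0) : VertexOperator ℂ W :=
  VertexOperator.of_coeff f fun w => by
    obtain ⟨N, hN⟩ := eventually_atBot.1 (hf w)
    refine ⟨N, fun n hn => ?_⟩
    by_contra hlt
    exact hn (hN n (by omega))

@[simp]
theorem cf_mkField (f : ℤ → Module.End ℂ W) (hf : ∀ w, ∀ᶠ n in atBot, f n w = 0) :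
    cf (mkField f hf) = f := rfl

theorem tendsto_sub_natCast (n : ℤ) : Tendsto (fun i : ℕ => n - (i : ℤ)) atTop atBot := by
  refine tendsto_atBot.2 fun b => eventually_atTop.2 ⟨(n - b).toNat, fun i hi => ?_⟩
  have := Int.self_le_toNat (n - b)
  omega

theorem cf_sub_eventually (A : VertexOperator ℂ W) (n : ℤ) (w : W) :
    ∀ᶠ i : ℕ in atTop, cf A (n - i) w = 0 :=
  (tendsto_sub_natCast n).eventually (cf_eventually A w)

/-- The identity field. -/
def idField (W : Type*) [AddCommGroup W] [Module ℂ W] : VertexOperator ℂ W :=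
  mkField (fun n => if n = 0 then 1 else 0) fun w =>
    eventually_atBot.2 ⟨-1, fun n hn => by rw [if_neg (by omega)]; rfl⟩

theorem cf_idField (n : ℤ) (w : W) : cf (idField W) n w = if n = 0 then w else 0 := by
  simp only [idField, cf_mkField]
  split_ifs <;> rfl

/-! ### Normally ordered products -/

/-- A formal series `∑_i cm_i x^{i+sm} + ∑_i cp_i x^{-i-sp}` of operators, split into a part whose
exponents are bounded below and a part for which, on every vector, only finitely many
coefficients are nonzero. -/
structure SplitField (W : Type*) [AddCommGroup W] [Module ℂ W] where
  /-- the coefficients of the creation part -/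
  cm : ℕ → Module.End ℂ W
  /-- the coefficients of the annihilation part -/
  cp : ℕ → Module.End ℂ W
  /-- the offset of the creation part -/
  sm : ℤ
  /-- the offset of the annihilation part -/
  sp : ℤ
  eventually_cp : ∀ w, ∀ᶠ i in atTop, cp i w = 0

namespace SplitField

variable (c c' : SplitField W) (A B : VertexOperator ℂ W)

theorem eventually_cm_cf (n : ℤ) (w : W) :
    ∀ᶠ i : ℕ in atTop, c.cm i (cf A (n - c.sm - i) w) = 0 :=
  (cf_sub_eventually A (n - c.sm) w).mono fun i hi => by rw [hi, map_zero]

theorem eventually_cf_cp (n : ℤ) (w : W) :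
    ∀ᶠ i : ℕ in atTop, cf A (n + c.sp + i) (c.cp i w) = 0 :=
  (c.eventually_cp w).mono fun i hi => by rw [hi, map_zero]

/-- The coefficients of the normally ordered product. -/
def nprodCoeff (n : ℤ) : Module.End ℂ W where
  toFun w := ∑ᶠ i : ℕ, c.cm i (cf A (n - c.sm - i) w) +
    ∑ᶠ i : ℕ, cf A (n + c.sp + i) (c.cp i w)
  map_add' w w' := by
    simp only [map_add]
    rw [finsum_add_eventually (c.eventually_cm_cf A n w) (c.eventually_cm_cf A n w'),
      finsum_add_eventually (c.eventually_cf_cp A n w) (c.eventually_cf_cp A n w')]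
    abel
  map_smul' s w := by
    simp only [map_smul, RingHom.id_apply]
    rw [← smul_finsum_eventually s (c.eventually_cm_cf A n w),
      ← smul_finsum_eventually s (c.eventually_cf_cp A n w), smul_add]

theorem nprodCoeff_apply (n : ℤ) (w : W) : c.nprodCoeff A n w =
    ∑ᶠ i : ℕ, c.cm i (cf A (n - c.sm - i) w) + ∑ᶠ i : ℕ, cf A (n + c.sp + i) (c.cp i w) := rfl

theorem eventually_nprodCoeff (w : W) : ∀ᶠ n in atBot, c.nprodCoeff A n w = 0 := by
  have h1 : ∀ᶠ n : ℤ in atBot, ∑ᶠ i : ℕ, c.cm i (cf A (n - c.sm - i) w) = 0 := by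
    obtain ⟨N, hN⟩ := eventually_atBot.1 (cf_eventually A w)
    refine eventually_atBot.2 ⟨N + c.sm, fun n hn => ?_⟩
    refine finsum_eq_zero_of_forall_eq_zero fun i => ?_
    rw [hN _ (by omega), map_zero]
  have h2 : ∀ᶠ n : ℤ in atBot, ∑ᶠ i : ℕ, cf A (n + c.sp + i) (c.cp i w) = 0 := by
    obtain ⟨I, hI⟩ := eventually_atTop.1 (c.eventually_cp w)
    have : ∀ᶠ n : ℤ in atBot, ∀ i ∈ range I, cf A (n + c.sp + i) (c.cp i w) = 0 := by
      refine (Filter.eventually_all_finset _).2 fun i _ => ?_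
      have ht : Tendsto (fun n : ℤ => n + c.sp + i) atBot atBot := by
        refine tendsto_atBot.2 fun b => eventually_atBot.2 ⟨b - c.sp - i, fun n hn => by omega⟩
      exact ht.eventually (cf_eventually A (c.cp i w))
    filter_upwards [this] with n hn
    refine finsum_eq_zero_of_forall_eq_zero fun i => ?_
    by_cases hi : i < I
    · exact hn i (Finset.mem_range.2 hi)
    · rw [hI i (by omega), map_zero]
  filter_upwards [h1, h2] with n h1 h2
  rw [nprodCoeff_apply, h1, h2, add_zero]

/-- The normally ordered product of `c(x)` with a field. -/
def nprod : Module.End ℂ (VertexOperator ℂ W) where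
  toFun A := mkField (c.nprodCoeff A) (c.eventually_nprodCoeff A)
  map_add' A B := by
    refine cf_ext fun n w => ?_
    simp only [map_add, cf_mkField, Pi.add_apply, LinearMap.add_apply, nprodCoeff_apply]
    rw [finsum_add_eventually (c.eventually_cm_cf A n w) (c.eventually_cm_cf B n w),
      finsum_add_eventually (c.eventually_cf_cp A n w) (c.eventually_cf_cp B n w)]
    abel
  map_smul' s A := by
    refine cf_ext fun n w => ?_
    simp only [map_smul, cf_mkField, Pi.smul_apply, LinearMap.smul_apply, nprodCoeff_apply,
      RingHom.id_apply]
    rw [← smul_finsum_eventually s (c.eventually_cm_cf A n w),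
      ← smul_finsum_eventually s (c.eventually_cf_cp A n w), smul_add]

theorem cf_nprod (n : ℤ) (w : W) : cf (c.nprod A) n w =
    ∑ᶠ i : ℕ, c.cm i (cf A (n - c.sm - i) w) + ∑ᶠ i : ℕ, cf A (n + c.sp + i) (c.cp i w) := rfl

/-- In all four terms the creation parts stand to the left of `A` and the annihilation parts to its
right, so every double sum is locally finite. -/
theorem cf_nprod_nprod (n : ℤ) (w : W) : cf (c.nprod (c'.nprod A)) n w =
    (∑ᶠ i : ℕ, ∑ᶠ j : ℕ, c.cm i (c'.cm j (cf A (n - c.sm - c'.sm - i - j) w)) +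
      ∑ᶠ i : ℕ, ∑ᶠ j : ℕ, c.cm i (cf A (n - c.sm + c'.sp - i + j) (c'.cp j w))) +
    (∑ᶠ i : ℕ, ∑ᶠ j : ℕ, c'.cm j (cf A (n + c.sp - c'.sm + i - j) (c.cp i w)) +
      ∑ᶠ i : ℕ, ∑ᶠ j : ℕ, cf A (n + c.sp + c'.sp + i + j) (c'.cp j (c.cp i w))) := by
  have key1 : ∀ i : ℕ, c.cm i (cf (c'.nprod A) (n - c.sm - i) w) =
      ∑ᶠ j : ℕ, c.cm i (c'.cm j (cf A (n - c.sm - c'.sm - i - j) w)) +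
        ∑ᶠ j : ℕ, c.cm i (cf A (n - c.sm + c'.sp - i + j) (c'.cp j w)) := by
    intro i
    rw [cf_nprod, map_add, map_finsum_eventually (c.cm i) (c'.eventually_cm_cf A _ w),
      map_finsum_eventually (c.cm i) (c'.eventually_cf_cp A _ w)]
    simp only [show n - c.sm - i - c'.sm = n - c.sm - c'.sm - i by ring,
      show n - c.sm - i + c'.sp = n - c.sm + c'.sp - i by ring]
  have key2 : ∀ i : ℕ, cf (c'.nprod A) (n + c.sp + i) (c.cp i w) =
      ∑ᶠ j : ℕ, c'.cm j (cf A (n + c.sp - c'.sm + i - j) (c.cp i w)) +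
      ∑ᶠ j : ℕ, cf A (n + c.sp + c'.sp + i + j) (c'.cp j (c.cp i w)) := by
    intro i
    rw [cf_nprod]
    simp only [show n + c.sp + i - c'.sm = n + c.sp - c'.sm + i by ring,
      show n + c.sp + i + c'.sp = n + c.sp + c'.sp + i by ring]
  rw [cf_nprod, finsum_congr key1, finsum_congr key2, finsum_add_eventually,
    finsum_add_eventually]
  · filter_upwards [c.eventually_cp w] with i hi
    simp [hi]
  · filter_upwards [c.eventually_cp w] with i hi
    simp [hi]
  · obtain ⟨N, hN⟩ := eventually_atBot.1 (cf_eventually A w)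
    refine eventually_atTop.2 ⟨(n - c.sm - c'.sm - N).toNat, fun i hi => ?_⟩
    refine finsum_eq_zero_of_forall_eq_zero fun j => ?_
    rw [hN _ (by have := Int.self_le_toNat (n - c.sm - c'.sm - N); omega), map_zero, map_zero]
  · obtain ⟨J, hJ⟩ := eventually_atTop.1 (c'.eventually_cp w)
    have : ∀ᶠ i : ℕ in atTop, ∀ j ∈ range J,
        cf A (n - c.sm + c'.sp - i + j) (c'.cp j w) = 0 := by
      refine (Filter.eventually_all_finset _).2 fun j _ => ?_
      filter_upwards [cf_sub_eventually A (n - c.sm + c'.sp + j) (c'.cp j w)] with i hi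
      rw [show n - c.sm + c'.sp - i + j = n - c.sm + c'.sp + j - i by ring, hi]
    filter_upwards [this] with i hi
    refine finsum_eq_zero_of_forall_eq_zero fun j => ?_
    by_cases hj : j < J
    · rw [hi j (Finset.mem_range.2 hj), map_zero]
    · rw [hJ j (by omega), map_zero, map_zero]

/-- The mixed term needs no commutation: the creation factor is to the left of `A` and the
annihilation factor to its right in either order of nesting. -/
theorem finsum_cm_cf_cp_comm (n : ℤ) (w : W) :
    ∑ᶠ i : ℕ, ∑ᶠ j : ℕ, c.cm i (cf A (n - c.sm + c'.sp - i + j) (c'.cp j w)) =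
      ∑ᶠ i : ℕ, ∑ᶠ j : ℕ, c.cm j (cf A (n + c'.sp - c.sm + i - j) (c'.cp i w)) := by
  have e : ∀ i j : ℕ, n + c'.sp - c.sm + i - j = n - c.sm + c'.sp - j + i := fun i j => by ring
  simp only [e]
  refine VanishesFar.finsum_comm (VanishesFar.swap (vanishesFar_of_eventually ?_ fun i => ?_))
  · filter_upwards [c'.eventually_cp w] with i hi j
    rw [hi, map_zero, map_zero]
  · filter_upwards [cf_sub_eventually A (n - c.sm + c'.sp + i) (c'.cp i w)] with j hj
    rw [show n - c.sm + c'.sp - j + i = n - c.sm + c'.sp + i - j by ring, hj, map_zero]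

/-- Nothing is assumed about creation operators against annihilation operators, because these never
meet. This commutativity is what lets normal ordering be defined by evaluating a polynomial. -/
theorem nprod_comm (hm : ∀ i j, c.cm i * c'.cm j = c'.cm j * c.cm i)
    (hp : ∀ i j, c.cp i * c'.cp j = c'.cp j * c.cp i) :
    c.nprod * c'.nprod = c'.nprod * c.nprod := by
  refine LinearMap.ext fun A => cf_ext fun n w => ?_
  rw [Module.End.mul_apply, Module.End.mul_apply, cf_nprod_nprod, cf_nprod_nprod]
  have hm' : ∀ i j w, c.cm i (c'.cm j w) = c'.cm j (c.cm i w) := fun i j w =>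
    LinearMap.congr_fun (hm i j) w
  have hp' : ∀ i j w, c.cp i (c'.cp j w) = c'.cp j (c.cp i w) := fun i j w =>
    LinearMap.congr_fun (hp i j) w
  rw [c.finsum_cm_cf_cp_comm c', ← c'.finsum_cm_cf_cp_comm c]
  have h1 : ∑ᶠ i : ℕ, ∑ᶠ j : ℕ, c.cm i (c'.cm j (cf A (n - c.sm - c'.sm - i - j) w)) =
      ∑ᶠ i : ℕ, ∑ᶠ j : ℕ, c'.cm i (c.cm j (cf A (n - c'.sm - c.sm - i - j) w)) := by
    have e : ∀ i j : ℕ, n - c'.sm - c.sm - i - j = n - c.sm - c'.sm - j - i := fun i j => by ring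
    simp only [e, hm']
    refine VanishesFar.finsum_comm ?_
    obtain ⟨N, hN⟩ := eventually_atBot.1 (cf_eventually A w)
    refine ⟨(n - c.sm - c'.sm - N).toNat, fun i j hij => ?_⟩
    have h0 : cf A (n - c.sm - c'.sm - i - j) w = 0 :=
      hN _ (by have := Int.self_le_toNat (n - c.sm - c'.sm - N); omega)
    simp only [h0, map_zero]
  have h2 : ∑ᶠ i : ℕ, ∑ᶠ j : ℕ, cf A (n + c.sp + c'.sp + i + j) (c'.cp j (c.cp i w)) =
      ∑ᶠ i : ℕ, ∑ᶠ j : ℕ, cf A (n + c'.sp + c.sp + i + j) (c.cp j (c'.cp i w)) := by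
    have e : ∀ i j : ℕ, n + c'.sp + c.sp + i + j = n + c.sp + c'.sp + j + i := fun i j => by ring
    simp only [e, hp']
    refine VanishesFar.finsum_comm (vanishesFar_of_eventually ?_ fun i => ?_)
    · filter_upwards [c.eventually_cp w] with i hi j
      rw [hi, map_zero, map_zero]
    · filter_upwards [c'.eventually_cp (c.cp i w)] with j hj
      rw [hj, map_zero]
  rw [h1, h2]
  abel

end SplitField

/-- The linear map from polynomials to fields that sends `1` to the identity field and
multiplication by `X_i` to the normally ordered product with `c_i(x)`. -/
def fieldMap {σ : Type*} (c : σ → SplitField W)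
    (hm : ∀ a b i j, (c a).cm i * (c b).cm j = (c b).cm j * (c a).cm i)
    (hp : ∀ a b i j, (c a).cp i * (c b).cp j = (c b).cp j * (c a).cp i) :
    MvPolynomial σ ℂ →ₗ[ℂ] VertexOperator ℂ W :=
  LinearMap.applyₗ (idField W) ∘ₗ (commEval (fun a => (c a).nprod) fun a b =>
    (c a).nprod_comm (c b) (hm a b) (hp a b)).toLinearMap

section

variable {σ : Type*} (c : σ → SplitField W)
  (hm : ∀ a b i j, (c a).cm i * (c b).cm j = (c b).cm j * (c a).cm i)
  (hp : ∀ a b i j, (c a).cp i * (c b).cp j = (c b).cp j * (c a).cp i)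

theorem fieldMap_one : fieldMap c hm hp 1 = idField W := by
  simp [fieldMap]

theorem fieldMap_C (s : ℂ) : fieldMap c hm hp (MvPolynomial.C s) = s • idField W := by
  rw [← fieldMap_one c hm hp, ← map_smul, MvPolynomial.smul_eq_C_mul, mul_one]

theorem fieldMap_X_mul (a : σ) (u : MvPolynomial σ ℂ) :
    fieldMap c hm hp (MvPolynomial.X a * u) = (c a).nprod (fieldMap c hm hp u) := by
  simp [fieldMap]

end

end Fields

end QHeis

namespace QHeis

open VertexOperator (ncoeff)

/-! ### Commutators with fields -/

section Commutators

variable {W : Type*} [AddCommGroup W] [Module ℂ W]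

/-- The field `[L, A(x)]` for an operator `L`. -/
def adField (L : Module.End ℂ W) : Module.End ℂ (VertexOperator ℂ W) where
  toFun A := mkField (fun n => L * cf A n - cf A n * L) fun w => by
    filter_upwards [cf_eventually A w, cf_eventually A (L w)] with n h1 h2
    simp [h1, h2]
  map_add' A B := by
    refine cf_ext fun n w => ?_
    change L (cf (A + B) n w) - cf (A + B) n (L w) =
      (L (cf A n w) - cf A n (L w)) + (L (cf B n w) - cf B n (L w))
    simp only [map_add, Pi.add_apply, LinearMap.add_apply]
    abel
  map_smul' s A := by
    refine cf_ext fun n w => ?_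
    change L (cf (s • A) n w) - cf (s • A) n (L w) = s • (L (cf A n w) - cf A n (L w))
    simp only [map_smul, Pi.smul_apply, LinearMap.smul_apply, smul_sub]

theorem cf_adField (L : Module.End ℂ W) (A : VertexOperator ℂ W) (n : ℤ) (w : W) :
    cf (adField L A) n w = L (cf A n w) - cf A n (L w) := rfl

/-- The field `x^e A(x)`. -/
def shiftField (e : ℤ) : Module.End ℂ (VertexOperator ℂ W) where
  toFun A := mkField (fun n => cf A (n - e)) fun w => by
    obtain ⟨N, hN⟩ := eventually_atBot.1 (cf_eventually A w)
    exact eventually_atBot.2 ⟨N + e, fun n hn => hN _ (by omega)⟩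
  map_add' A B := by
    refine cf_ext fun n w => ?_
    simp
  map_smul' s A := by
    refine cf_ext fun n w => ?_
    simp

theorem cf_shiftField (e : ℤ) (A : VertexOperator ℂ W) (n : ℤ) (w : W) :
    cf (shiftField e A) n w = cf A (n - e) w := rfl

theorem SplitField.nprod_shiftField (c : SplitField W) (e : ℤ) (A : VertexOperator ℂ W) :
    c.nprod (shiftField e A) = shiftField e (c.nprod A) := by
  refine cf_ext fun n w => ?_
  rw [c.cf_nprod, cf_shiftField, c.cf_nprod]
  simp only [cf_shiftField]
  congr 1 <;> refine finsum_congr fun i => ?_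
  · rw [show n - c.sm - i - e = n - e - c.sm - i by ring]
  · rw [show n + c.sp + i - e = n - e + c.sp + i by ring]

/-- If the commutators of `L` with the coefficients of `c(x)` are scalars, then `[L, ·]` is a
derivation of the normally ordered product with `c(x)` up to these scalars. -/
theorem SplitField.cf_adField_nprod (c : SplitField W) (L : Module.End ℂ W) (a b : ℕ → ℂ)
    (ha : ∀ i w, L (c.cm i w) - c.cm i (L w) = a i • w)
    (hb : ∀ i w, L (c.cp i w) - c.cp i (L w) = b i • w) (A : VertexOperator ℂ W) (n : ℤ) (w : W) :
    cf (adField L (c.nprod A)) n w = ∑ᶠ i : ℕ, a i • cf A (n - c.sm - i) w +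
      ∑ᶠ i : ℕ, cf A (n + c.sp + i) (b i • w) + cf (c.nprod (adField L A)) n w := by
  have ha' : ∀ i w, L (c.cm i w) = a i • w + c.cm i (L w) := fun i w => by rw [← ha]; abel
  have hb' : ∀ i w, c.cp i (L w) = L (c.cp i w) - b i • w := fun i w => by rw [← hb]; abel
  have e1 := c.eventually_cm_cf A n w
  have e2 := c.eventually_cf_cp A n w
  have e3 := c.eventually_cm_cf A n (L w)
  have e4 := c.eventually_cf_cp A n (L w)
  have e5 := c.eventually_cm_cf (adField L A) n w
  have e6 := c.eventually_cf_cp (adField L A) n w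
  have e7 : ∀ᶠ i : ℕ in atTop, a i • cf A (n - c.sm - i) w = 0 := by
    filter_upwards [cf_sub_eventually A (n - c.sm) w] with i hi
    rw [hi, smul_zero]
  have e8 : ∀ᶠ i : ℕ in atTop, cf A (n + c.sp + i) (b i • w) = 0 := by
    filter_upwards [c.eventually_cp w, c.eventually_cp (L w)] with i h1 h2
    rw [← hb, h1, h2, map_zero, sub_zero, map_zero]
  rw [cf_adField, c.cf_nprod, c.cf_nprod, c.cf_nprod, map_add, map_finsum_eventually L e1,
    map_finsum_eventually L e2]
  have h1 : ∑ᶠ i : ℕ, L (c.cm i (cf A (n - c.sm - i) w)) =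
      ∑ᶠ i : ℕ, a i • cf A (n - c.sm - i) w + ∑ᶠ i : ℕ, c.cm i (cf (adField L A) (n - c.sm - i) w)
        + ∑ᶠ i : ℕ, c.cm i (cf A (n - c.sm - i) (L w)) := by
    rw [← finsum_add_eventually e7 e5, ← finsum_add_eventually _ e3]
    · refine finsum_congr fun i => ?_
      rw [ha', cf_adField, map_sub]
      abel
    · filter_upwards [e7, e5] with i h1 h2
      rw [h1, h2, add_zero]
  have h2 : ∑ᶠ i : ℕ, L (cf A (n + c.sp + i) (c.cp i w)) =
      ∑ᶠ i : ℕ, cf A (n + c.sp + i) (b i • w) +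
        ∑ᶠ i : ℕ, cf (adField L A) (n + c.sp + i) (c.cp i w)
        + ∑ᶠ i : ℕ, cf A (n + c.sp + i) (c.cp i (L w)) := by
    rw [← finsum_add_eventually e8 e6, ← finsum_add_eventually _ e4]
    · refine finsum_congr fun i => ?_
      rw [hb', cf_adField, map_sub]
      abel
    · filter_upwards [e8, e6] with i h1 h2
      rw [h1, h2, add_zero]
  rw [h1, h2]
  abel

variable {σ ι : Type*} (c : σ → SplitField W)
  (hm : ∀ a b i j, (c a).cm i * (c b).cm j = (c b).cm j * (c a).cm i)
  (hp : ∀ a b i j, (c a).cp i * (c b).cp j = (c b).cp j * (c a).cp i)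

/-- The commutator of `L` with the fields of polynomials, when it acts on the generating fields
through a locally finite family of derivations. -/
theorem adField_fieldMap (L : Module.End ℂ W)
    (d : ι → Derivation ℂ (MvPolynomial σ ℂ) (MvPolynomial σ ℂ)) (χ : ι → σ → ℂ) (e : ι → ℤ)
    (hd : ∀ j a, d j (MvPolynomial.X a) = MvPolynomial.C (χ j a))
    (hL : ∀ a, ∀ᶠ I : Finset ι in atTop, ∀ A : VertexOperator ℂ W, adField L ((c a).nprod A) =
      ∑ j ∈ I, χ j a • shiftField (e j) A + (c a).nprod (adField L A))
    (v : MvPolynomial σ ℂ) : ∀ᶠ I : Finset ι in atTop, adField L (fieldMap c hm hp v) =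
      ∑ j ∈ I, shiftField (e j) (fieldMap c hm hp (d j v)) := by
  induction v using MvPolynomial.induction_on with
  | C s =>
    refine Eventually.of_forall fun I => ?_
    rw [fieldMap_C, Finset.sum_eq_zero]
    · refine cf_ext fun n w => ?_
      rw [map_smul, map_smul, Pi.smul_apply, LinearMap.smul_apply, cf_adField, cf_idField,
        cf_idField]
      split_ifs <;> simp
    · intro j _
      rw [MvPolynomial.derivation_C, map_zero, map_zero]
  | add u v hu hv =>
    filter_upwards [hu, hv] with I h1 h2
    simp only [map_add, h1, h2, Finset.sum_add_distrib]
  | mul_X u a hu =>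
    filter_upwards [hu, hL a] with I h1 h2
    rw [mul_comm, fieldMap_X_mul, h2, h1, map_sum, ← Finset.sum_add_distrib]
    refine Finset.sum_congr rfl fun j _ => ?_
    rw [Derivation.leibniz, hd, smul_eq_mul, smul_eq_mul, map_add, map_add, fieldMap_X_mul,
      mul_comm u, ← MvPolynomial.smul_eq_C_mul, map_smul, map_smul, (c a).nprod_shiftField]
    abel

end Commutators

/-! ### The Fock space -/

/-- The Fock space: polynomials in the variables `X_{r,k}`, which stand for
`β^{(r)}_{-k-1}`. -/
abbrev Fock := MvPolynomial (ℤ × ℕ) ℂ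

namespace Fock

open MvPolynomial (X C)

/-- Multiplication by a variable. -/
def cre (r : ℤ) (k : ℕ) : Module.End ℂ Fock := LinearMap.mulLeft ℂ (X (r, k))

theorem cre_apply (r : ℤ) (k : ℕ) (v : Fock) : cre r k v = X (r, k) * v := rfl

variable (κ : ℤ → ℤ → ℂ)

/-- The derivation with `X_{s,k} ↦ κ(r,s)` and `X_{s,j} ↦ 0` for `j ≠ k`. -/
def annD (r : ℤ) (k : ℕ) : Derivation ℂ Fock Fock :=
  MvPolynomial.mkDerivation ℂ fun s => C (if s.2 = k then κ r s.1 else 0)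

/-- The operator of `β^{(r)}_k`, `k ≥ 0`, on the Fock space. -/
def ann (r : ℤ) (k : ℕ) : Module.End ℂ Fock := (annD κ r k).toLinearMap

theorem ann_apply (r : ℤ) (k : ℕ) (v : Fock) : ann κ r k v = annD κ r k v := rfl

theorem annD_X (r : ℤ) (k : ℕ) (s : ℤ × ℕ) :
    annD κ r k (X s) = C (if s.2 = k then κ r s.1 else 0) :=
  MvPolynomial.mkDerivation_X _ _ _

theorem ann_one (r : ℤ) (k : ℕ) : ann κ r k 1 = 0 := (annD κ r k).map_one_eq_zero

theorem ann_cre (r s : ℤ) (k j : ℕ) (v : Fock) : ann κ r k (cre s j v) =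
    (if j = k then κ r s else 0) • v + cre s j (ann κ r k v) := by
  rw [cre_apply, ann_apply, Derivation.leibniz, annD_X, smul_eq_mul, smul_eq_mul, mul_comm v,
    ← MvPolynomial.smul_eq_C_mul, add_comm]
  rfl

theorem ann_eventually (r : ℤ) (v : Fock) : ∀ᶠ k in atTop, ann κ r k v = 0 := by
  induction v using MvPolynomial.induction_on with
  | C s => exact Eventually.of_forall fun k => MvPolynomial.derivation_C _ _
  | add u v hu hv =>
    filter_upwards [hu, hv] with k h1 h2
    rw [map_add, h1, h2, add_zero]
  | mul_X u a hu =>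
    filter_upwards [hu, eventually_gt_atTop a.2] with k h1 h2
    rw [mul_comm, ← cre_apply, ann_cre, h1, if_neg (by omega), zero_smul, map_zero, add_zero]

/-- The commutator is a derivation that kills every variable, since each derivation sends variables
to constants and constants to zero. -/
theorem derivation_comm {σ : Type*} (D D' : Derivation ℂ (MvPolynomial σ ℂ) (MvPolynomial σ ℂ))
    (χ χ' : σ → ℂ) (h : ∀ a, D (X a) = C (χ a)) (h' : ∀ a, D' (X a) = C (χ' a))
    (v : MvPolynomial σ ℂ) : D (D' v) = D' (D v) := by
  have : ⁅D, D'⁆ = 0 := by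
    refine MvPolynomial.derivation_ext fun a => ?_
    rw [Derivation.commutator_apply, h, h', MvPolynomial.derivation_C, MvPolynomial.derivation_C,
      sub_zero, Derivation.zero_apply]
  have h0 := Derivation.congr_fun this v
  rwa [Derivation.commutator_apply, Derivation.zero_apply, sub_eq_zero] at h0

theorem ann_comm (r s : ℤ) (k j : ℕ) (v : Fock) :
    ann κ r k (ann κ s j v) = ann κ s j (ann κ r k v) :=
  derivation_comm _ _ _ _ (annD_X κ r k) (annD_X κ s j) v

/-- The field `(1/k!) ∂^k β^{(r)}(x)` on the Fock space. -/
def genField (a : ℤ × ℕ) : SplitField Fock where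
  cm i := ((i + a.2).choose a.2 : ℂ) • cre a.1 (i + a.2)
  cp i := ((-1) ^ a.2 * ((i + a.2).choose a.2 : ℂ)) • ann κ a.1 i
  sm := 0
  sp := a.2 + 1
  eventually_cp w := by
    filter_upwards [ann_eventually κ a.1 w] with i hi
    rw [LinearMap.smul_apply, hi, smul_zero]

theorem genField_cm_comm (a b : ℤ × ℕ) (i j : ℕ) :
    (genField κ a).cm i * (genField κ b).cm j = (genField κ b).cm j * (genField κ a).cm i := by
  refine LinearMap.ext fun w => ?_
  simp only [genField, Module.End.mul_apply, LinearMap.smul_apply, map_smul, cre_apply]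
  rw [smul_comm, mul_left_comm]

theorem genField_cp_comm (a b : ℤ × ℕ) (i j : ℕ) :
    (genField κ a).cp i * (genField κ b).cp j = (genField κ b).cp j * (genField κ a).cp i := by
  refine LinearMap.ext fun w => ?_
  simp only [genField, Module.End.mul_apply, LinearMap.smul_apply, map_smul]
  rw [smul_comm, ann_comm]

/-- The state-field map of the Fock space. -/
def Y : Fock →ₗ[ℂ] VertexOperator ℂ Fock :=
  fieldMap (genField κ) (genField_cm_comm κ) (genField_cp_comm κ)

/-- The modes `v_n` of the fields `Y(v, x) = ∑_n v_n x^{-n-1}`. -/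
def mode : Fock →ₗ[ℂ] ℤ → Module.End ℂ Fock := ncoeff ∘ₗ Y κ

theorem mode_eq_cf (v : Fock) (n : ℤ) : mode κ v n = cf (Y κ v) (-n - 1) := rfl

theorem cf_eq_mode (v : Fock) (n : ℤ) : cf (Y κ v) n = mode κ v (-n - 1) := cf_eq_ncoeff _ _

theorem mode_one (n : ℤ) (w : Fock) : mode κ 1 n w = if n = -1 then w else 0 := by
  rw [mode_eq_cf, Y, fieldMap_one, cf_idField]
  simp only [show -n - 1 = 0 ↔ n = -1 by omega]

theorem mode_eventually (u w : Fock) : ∀ᶠ n in atTop, mode κ u n w = 0 := by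
  obtain ⟨N, hN⟩ := eventually_atBot.1 (cf_eventually (Y κ u) w)
  exact eventually_atTop.2 ⟨-N, fun n hn => by rw [mode_eq_cf]; exact hN _ (by omega)⟩

theorem tendsto_add_natCast (n : ℤ) : Tendsto (fun i : ℕ => n + (i : ℤ)) atTop atTop :=
  tendsto_atTop_add_const_left _ _ tendsto_natCast_atTop_atTop

theorem mode_add_eventually (u : Fock) (n : ℤ) (w : Fock) :
    ∀ᶠ i : ℕ in atTop, mode κ u (n + i) w = 0 :=
  (tendsto_add_natCast n).eventually (mode_eventually κ u w)

theorem mode_X_mul (r : ℤ) (k : ℕ) (u : Fock) (n : ℤ) (w : Fock) :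
    mode κ (X (r, k) * u) n w =
      ∑ᶠ i : ℕ, ((i + k).choose k : ℤ) • cre r (i + k) (mode κ u (n + i) w) +
      ∑ᶠ i : ℕ, ((-1) ^ k * ((i + k).choose k : ℤ)) • mode κ u (n - k - 1 - i) (ann κ r i w) := by
  rw [mode_eq_cf, Y, fieldMap_X_mul, SplitField.cf_nprod]
  change ∑ᶠ i : ℕ, (((i + k).choose k : ℂ) • cre r (i + k)) (cf (Y κ u) (-n - 1 - 0 - i) w) +
    ∑ᶠ i : ℕ, cf (Y κ u) (-n - 1 + (k + 1) + i)
      ((((-1) ^ k * ((i + k).choose k : ℂ)) • ann κ r i) w) = _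
  simp only [cf_eq_mode, LinearMap.smul_apply, map_smul]
  congr 1 <;> refine finsum_congr fun i => ?_
  · rw [← Int.cast_smul_eq_zsmul ℂ, show -(-n - 1 - 0 - i) - 1 = n + i by ring]
    push_cast
    rfl
  · rw [← Int.cast_smul_eq_zsmul ℂ, show -(-n - 1 + (k + 1) + i) - 1 = n - k - 1 - i by ring]
    push_cast
    rfl

theorem mode_zero_left (n : ℤ) (w : Fock) : mode κ 0 n w = 0 := by
  rw [map_zero]; rfl

/-- The two claims are proved together: annihilation operators kill `1`, and the vanishing of the
nonnegative modes of `u` leaves only the first creation term for `X_a * u`. -/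
theorem mode_creation (v : Fock) : mode κ v (-1) 1 = v ∧ ∀ n : ℤ, 0 ≤ n → mode κ v n 1 = 0 := by
  induction v using MvPolynomial.induction_on with
  | C s =>
    have : (C s : Fock) = s • 1 := by rw [MvPolynomial.smul_eq_C_mul, mul_one]
    rw [this, map_smul]
    refine ⟨?_, fun n hn => ?_⟩
    · rw [Pi.smul_apply, LinearMap.smul_apply, mode_one, if_pos rfl]
    · rw [Pi.smul_apply, LinearMap.smul_apply, mode_one, if_neg (by omega), smul_zero]
  | add u v hu hv =>
    refine ⟨?_, fun n hn => ?_⟩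
    · rw [map_add, Pi.add_apply, LinearMap.add_apply, hu.1, hv.1]
    · rw [map_add, Pi.add_apply, LinearMap.add_apply, hu.2 n hn, hv.2 n hn, add_zero]
  | mul_X u a hu =>
    obtain ⟨r, k⟩ := a
    rw [mul_comm]
    have h0 : ∀ n : ℤ, mode κ (X (r, k) * u) n 1 =
        ∑ᶠ i : ℕ, ((i + k).choose k : ℤ) • cre r (i + k) (mode κ u (n + i) 1) := by
      intro n
      rw [mode_X_mul, add_eq_left]
      refine finsum_eq_zero_of_forall_eq_zero fun i => ?_
      rw [ann_one, map_zero, smul_zero]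
    refine ⟨?_, fun n hn => ?_⟩
    · rw [h0, finsum_eq_single _ 0]
      · simp [hu.1, cre_apply]
      · intro i hi
        rw [hu.2 _ (by omega), map_zero, smul_zero]
    · rw [h0]
      refine finsum_eq_zero_of_forall_eq_zero fun i => ?_
      rw [hu.2 _ (by omega), map_zero, smul_zero]

end Fock

end QHeis

namespace QHeis

open VertexOperator (ncoeff)

/-! ### Commutators of the oscillators with the fields of the Fock space -/

namespace Fock

open MvPolynomial (X C)

variable (κ : ℤ → ℤ → ℂ)

theorem finsum_single_ite {M : Type*} [AddCommGroup M] [Module ℂ M] (f : ℕ → M) (m k : ℕ) (s : ℂ) :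
    ∑ᶠ i : ℕ, (((i + k).choose k : ℂ) * (if i + k = m then s else 0)) • f i =
      ((m.choose k : ℂ) * s) • f (m - k) := by
  by_cases h : k ≤ m
  · rw [finsum_eq_single _ (m - k), Nat.sub_add_cancel h, if_pos rfl]
    intro i hi
    rw [if_neg (by omega), mul_zero, zero_smul]
  · rw [Nat.choose_eq_zero_of_lt (by omega), Nat.cast_zero, zero_mul, zero_smul]
    refine finsum_eq_zero_of_forall_eq_zero fun i => ?_
    rw [if_neg (by omega), mul_zero, zero_smul]

/-- Pass from finite sums over large sets to a locally finite sum. -/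
theorem eq_finsum_of_eventually {M : Type*} [AddCommGroup M] {x : M} {f : ℕ → M}
    (h : ∀ᶠ I : Finset ℕ in atTop, x = ∑ j ∈ I, f j) (hf : ∀ᶠ j in atTop, f j = 0) :
    x = ∑ᶠ j, f j := by
  have h1 := tendsto_finset_range.eventually h
  obtain ⟨n, hn, hn'⟩ := (h1.and (eventually_forall_ge_atTop.2 hf)).exists
  rw [hn, finsum_eq_sum_range hn']

/-- The commutator formula `[β_m, v_n] = ∑_j C(m,j) (β_j v)_{m+n-j}`. It is an instance of
`adField_fieldMap`: on the generating field of `X_{s,k}` only the derivation with `j = k` acts. -/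
theorem ann_mode (r : ℤ) (m : ℕ) (v : Fock) (n : ℤ) (w : Fock) :
    ann κ r m (mode κ v n w) = mode κ v n (ann κ r m w) +
      ∑ᶠ j : ℕ, (m.choose j : ℤ) • mode κ (ann κ r j v) (m + n - j) w := by
  rw [← sub_eq_iff_eq_add']
  refine eq_finsum_of_eventually ?_ ((ann_eventually κ r v).mono fun j hj => by
    rw [hj, mode_zero_left, smul_zero])
  have := adField_fieldMap (genField κ) (genField_cm_comm κ) (genField_cp_comm κ) (ann κ r m)
    (fun j : ℕ => (m.choose j : ℂ) • annD κ r j)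
    (fun j a => (m.choose j : ℂ) * if a.2 = j then κ r a.1 else 0) (fun j => (m - j : ℤ)) ?_ ?_ v
  · filter_upwards [this] with I hI
    have h1 := congrArg (fun A => cf A (-n - 1) w) hI
    simp only [map_sum, Finset.sum_apply, LinearMap.sum_apply] at h1
    refine h1.trans (Finset.sum_congr rfl fun j _ => ?_)
    rw [cf_shiftField, mode_eq_cf, Derivation.smul_apply, map_smul, map_smul, Pi.smul_apply,
      LinearMap.smul_apply, ← Int.cast_smul_eq_zsmul ℂ,
      show -n - 1 - (m - j : ℤ) = -(m + n - j) - 1 by ring]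
    push_cast
    rfl
  · intro j a
    rw [Derivation.smul_apply, annD_X, MvPolynomial.smul_eq_C_mul, ← map_mul]
  · rintro ⟨s, k⟩
    -- Only the index `j = k` contributes for the variable `X_{s,k}`, so any finite set containing
    -- `k` is large enough.
    filter_upwards [eventually_ge_atTop {k}] with I hI A
    refine cf_ext fun n w => ?_
    rw [SplitField.cf_adField_nprod _ _
      (fun i => ((i + k).choose k : ℂ) * if i + k = m then κ r s else 0) (fun _ => 0),
      map_add, Pi.add_apply, LinearMap.add_apply]
    · congr 1
      rw [Finset.sum_eq_single k, if_pos rfl, map_smul, Pi.smul_apply, LinearMap.smul_apply,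
        cf_shiftField]
      · simp only [zero_smul, map_zero, finsum_zero, add_zero]
        rw [finsum_single_ite (fun i : ℕ => cf A (n - (genField κ (s, k)).sm - i) w) m k (κ r s)]
        by_cases h : k ≤ m
        · congr 3
          refine congrArg (cf A) ?_
          change n - 0 - (m - k : ℕ) = n - (m - k : ℤ)
          omega
        · rw [Nat.choose_eq_zero_of_lt (by omega), Nat.cast_zero, zero_mul, zero_smul, zero_smul]
      · intro j _ hj
        rw [if_neg (Ne.symm hj), mul_zero, zero_smul]
      · intro h
        exact absurd (Finset.singleton_subset_iff.1 hI) h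
    · intro i w
      simp only [genField, LinearMap.smul_apply, map_smul]
      rw [ann_cre, smul_add, add_sub_cancel_right, smul_smul]
    · intro i w
      simp only [genField, LinearMap.smul_apply, map_smul]
      rw [ann_comm, sub_self, zero_smul]

/-- The same commutator formula for the mode `β_{-h-1}`, with `C(-h-1, j)` written out. The creation
operator now meets annihilation operators, hence the commutators `-κ s r`, which skew symmetry turns
into `κ r s`. -/
theorem cre_mode (hκ : ∀ r s, κ r s = -κ s r) (r : ℤ) (h : ℕ) (v : Fock) (n : ℤ) (w : Fock) :
    cre r h (mode κ v n w) = mode κ v n (cre r h w) +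
      ∑ᶠ j : ℕ, ((-1) ^ j * ((j + h).choose h : ℤ)) •
        mode κ (ann κ r j v) (n - h - 1 - j) w := by
  rw [← sub_eq_iff_eq_add']
  refine eq_finsum_of_eventually ?_ ((ann_eventually κ r v).mono fun j hj => by
    rw [hj, mode_zero_left, smul_zero])
  have := adField_fieldMap (genField κ) (genField_cm_comm κ) (genField_cp_comm κ) (cre r h)
    (fun j : ℕ => ((-1) ^ j * ((j + h).choose h : ℂ)) • annD κ r j)
    (fun j a => ((-1) ^ j * ((j + h).choose h : ℂ)) * if a.2 = j then κ r a.1 else 0)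
    (fun j => (-h - 1 - j : ℤ)) ?_ ?_ v
  · filter_upwards [this] with I hI
    have h1 := congrArg (fun A => cf A (-n - 1) w) hI
    simp only [map_sum, Finset.sum_apply, LinearMap.sum_apply] at h1
    refine h1.trans (Finset.sum_congr rfl fun j _ => ?_)
    rw [cf_shiftField, mode_eq_cf, Derivation.smul_apply, map_smul, map_smul, Pi.smul_apply,
      LinearMap.smul_apply, ← Int.cast_smul_eq_zsmul ℂ,
      show -n - 1 - (-h - 1 - j : ℤ) = -(n - h - 1 - j) - 1 by ring]
    push_cast
    rfl
  · intro j a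
    rw [Derivation.smul_apply, annD_X, MvPolynomial.smul_eq_C_mul, ← map_mul]
  · rintro ⟨s, k⟩
    filter_upwards [eventually_ge_atTop {k}] with I hI A
    refine cf_ext fun n w => ?_
    rw [SplitField.cf_adField_nprod _ _ (fun _ => 0)
      (fun i => ((-1) ^ k * ((i + k).choose k : ℂ)) * if i = h then κ r s else 0),
      map_add, Pi.add_apply, LinearMap.add_apply]
    · congr 1
      rw [Finset.sum_eq_single k, if_pos rfl, map_smul, Pi.smul_apply, LinearMap.smul_apply,
        cf_shiftField, finsum_eq_zero_of_forall_eq_zero fun i => by rw [zero_smul],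
        zero_add, finsum_eq_single _ h, if_pos rfl, map_smul]
      · rw [add_comm h k, Nat.choose_symm_add]
        congr 3
        refine congrArg (cf A) ?_
        change n + ((k : ℤ) + 1) + h = n - (-h - 1 - k)
        ring
      · intro i hi
        rw [if_neg hi, mul_zero, zero_smul, map_zero]
      · intro j _ hj
        rw [if_neg (Ne.symm hj), mul_zero, zero_smul]
      · intro h
        exact absurd (Finset.singleton_subset_iff.1 hI) h
    · intro i w
      simp only [genField, LinearMap.smul_apply, map_smul, cre_apply]
      rw [mul_left_comm, sub_self, zero_smul]
    · intro i w
      simp only [genField, LinearMap.smul_apply, map_smul]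
      rw [ann_cre, smul_add, sub_add_cancel_right, smul_smul, ← neg_smul]
      congr 1
      by_cases hi : i = h
      · rw [if_pos hi, if_pos hi.symm, hκ r s]; ring
      · rw [if_neg hi, if_neg (Ne.symm hi)]; ring

end Fock

end QHeis

namespace QHeis

open VertexOperator (ncoeff)

/-! ### Closure properties of doubly indexed families that vanish outside a square -/

section Finsum

variable {M : Type*} [AddCommGroup M]

theorem VanishesFar.add {f g : ℕ → ℕ → M} (hf : VanishesFar f) (hg : VanishesFar g) :
    VanishesFar fun i j => f i j + g i j := by
  obtain ⟨a, ha⟩ := hf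
  obtain ⟨b, hb⟩ := hg
  refine ⟨a + b, fun i j hij => ?_⟩
  simp only [ha i j (by omega), hb i j (by omega), add_zero]

theorem VanishesFar.sum {ι : Type*} {s : Finset ι} {f : ι → ℕ → ℕ → M}
    (h : ∀ k ∈ s, VanishesFar (f k)) : VanishesFar fun i j => ∑ k ∈ s, f k i j := by
  classical
  induction s using Finset.induction_on with
  | empty => exact ⟨0, fun _ _ _ => Finset.sum_empty⟩
  | insert a s ha ih =>
    simp only [Finset.sum_insert ha]
    exact (h a (Finset.mem_insert_self a s)).add
      (ih fun k hk => h k (Finset.mem_insert_of_mem hk))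

theorem VanishesFar.finsum_add {f g : ℕ → ℕ → M} (hf : VanishesFar f) (hg : VanishesFar g) :
    ∑ᶠ i, ∑ᶠ j, (f i j + g i j) = ∑ᶠ i, ∑ᶠ j, f i j + ∑ᶠ i, ∑ᶠ j, g i j := by
  rw [← finsum_add_eventually hf.finsum_left hg.finsum_left]
  exact finsum_congr fun i => finsum_add_eventually (hf.right i) (hg.right i)

theorem VanishesFar.finsum_sum {ι : Type*} {s : Finset ι} {f : ι → ℕ → ℕ → M}
    (h : ∀ k ∈ s, VanishesFar (f k)) :
    ∑ᶠ i, ∑ᶠ j, ∑ k ∈ s, f k i j = ∑ k ∈ s, ∑ᶠ i, ∑ᶠ j, f k i j := by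
  classical
  induction s using Finset.induction_on with
  | empty => simp
  | insert a s ha ih =>
    simp only [Finset.sum_insert ha]
    rw [VanishesFar.finsum_add (h a (Finset.mem_insert_self a s))
      (VanishesFar.sum fun k hk => h k (Finset.mem_insert_of_mem hk)),
      ih fun k hk => h k (Finset.mem_insert_of_mem hk)]

theorem vanishesFar_of_add {f : ℕ → ℕ → M} {g : ℕ → M} (hg : ∀ᶠ i in atTop, g i = 0)
    (h : ∀ i j, g (i + j) = 0 → f i j = 0) : VanishesFar f := by
  obtain ⟨n, hn⟩ := eventually_atTop.1 hg
  exact ⟨n, fun i j hij => h i j (hn _ (by omega))⟩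

end Finsum

namespace Fock

open MvPolynomial (X C)

variable (κ : ℤ → ℤ → ℂ)

/-- The summands of the modes of `Y(X_{r,k} u, x)`. -/
def modeTerm (r : ℤ) (k : ℕ) (u : Fock) (n : ℤ) (w : Fock) (i : ℕ) : Fock :=
  ((i + k).choose k : ℤ) • cre r (i + k) (mode κ u (n + i) w) +
    ((-1) ^ k * ((i + k).choose k : ℤ)) • mode κ u (n - k - 1 - i) (ann κ r i w)

theorem cre_mode_eventually (r : ℤ) (k : ℕ) (u : Fock) (n : ℤ) (w : Fock) :
    ∀ᶠ i : ℕ in atTop, ((i + k).choose k : ℤ) • cre r (i + k) (mode κ u (n + i) w) = 0 := by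
  filter_upwards [mode_add_eventually κ u n w] with i hi
  rw [hi, map_zero, smul_zero]

theorem mode_ann_eventually (r : ℤ) (k : ℕ) (u : Fock) (n : ℤ) (w : Fock) :
    ∀ᶠ i : ℕ in atTop,
      ((-1) ^ k * ((i + k).choose k : ℤ)) • mode κ u (n - k - 1 - i) (ann κ r i w) = 0 := by
  filter_upwards [ann_eventually κ r w] with i hi
  rw [hi, map_zero, smul_zero]

theorem modeTerm_eventually (r : ℤ) (k : ℕ) (u : Fock) (n : ℤ) (w : Fock) :
    ∀ᶠ i : ℕ in atTop, modeTerm κ r k u n w i = 0 := by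
  filter_upwards [cre_mode_eventually κ r k u n w, mode_ann_eventually κ r k u n w] with i h1 h2
  rw [modeTerm, h1, h2, add_zero]

theorem mode_X_mul_eq_finsum (r : ℤ) (k : ℕ) (u : Fock) (n : ℤ) (w : Fock) :
    mode κ (X (r, k) * u) n w = ∑ᶠ i : ℕ, modeTerm κ r k u n w i := by
  rw [mode_X_mul, ← finsum_add_eventually (cre_mode_eventually κ r k u n w)
    (mode_ann_eventually κ r k u n w)]
  rfl

/-! ### The three sides of the Borcherds identity -/

/-- `∑_p (-1)^p C(l,p) u_{m+l-p} v_{n+p} w`. -/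
def compSum (u v : Fock) (l m n : ℤ) (w : Fock) : Fock :=
  ∑ᶠ p : ℕ, ((-1) ^ p * Ring.choose l p) • mode κ u (m + l - p) (mode κ v (n + p) w)

/-- `∑_p (-1)^p C(l,p) v_{n+l-p} u_{m+p} w`. -/
def revSum (u v : Fock) (l m n : ℤ) (w : Fock) : Fock :=
  ∑ᶠ p : ℕ, ((-1) ^ p * Ring.choose l p) • mode κ v (n + l - p) (mode κ u (m + p) w)

/-- `∑_p C(m,p) (u_{l+p} v)_{m+n-p} w`. -/
def iterSum (u v : Fock) (l m n : ℤ) (w : Fock) : Fock :=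
  ∑ᶠ p : ℕ, Ring.choose m p • mode κ (mode κ u (l + p) v) (m + n - p) w

theorem compSum_eventually (u v : Fock) (l m n : ℤ) (w : Fock) : ∀ᶠ p : ℕ in atTop,
    ((-1) ^ p * Ring.choose l p) • mode κ u (m + l - p) (mode κ v (n + p) w) = 0 := by
  filter_upwards [mode_add_eventually κ v n w] with p hp
  rw [hp, map_zero, smul_zero]

theorem revSum_eventually (u v : Fock) (l m n : ℤ) (w : Fock) : ∀ᶠ p : ℕ in atTop,
    ((-1) ^ p * Ring.choose l p) • mode κ v (n + l - p) (mode κ u (m + p) w) = 0 := by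
  filter_upwards [mode_add_eventually κ u m w] with p hp
  rw [hp, map_zero, smul_zero]

theorem iterSum_eventually (u v : Fock) (l m n : ℤ) (w : Fock) : ∀ᶠ p : ℕ in atTop,
    Ring.choose m p • mode κ (mode κ u (l + p) v) (m + n - p) w = 0 := by
  filter_upwards [mode_add_eventually κ u l v] with p hp
  rw [hp, mode_zero_left, smul_zero]

/-- Expand the field of `X_{r,k} u`. Creation operators already stand on the left; annihilation
operators are moved to the right through the modes of `v` by `ann_mode`, and the commutators produce
the terms with `ann κ r j v`. -/
theorem compSum_X_mul (r : ℤ) (k : ℕ) (u v : Fock) (l m n : ℤ) (w : Fock) :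
    compSum κ (X (r, k) * u) v l m n w =
      ∑ᶠ i : ℕ, ((i + k).choose k : ℤ) • cre r (i + k) (compSum κ u v l (m + i) n w) +
      (∑ᶠ i : ℕ, ((-1) ^ k * ((i + k).choose k : ℤ)) •
        compSum κ u v l (m - k - 1 - i) n (ann κ r i w) +
      ∑ᶠ j : ℕ, ((-1) ^ k * ((j + k).choose k : ℤ)) •
        compSum κ u (ann κ r j v) (l - k - 1 - j) m n w) := by
  -- Truncating the commutator sum at `J` leaves a finite sum, which can be exchanged with the two
  -- locally finite ones.
  obtain ⟨J, hJ⟩ := eventually_atTop.1 (ann_eventually κ r v)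
  let A : ℕ → ℕ → Fock := fun p i => ((-1) ^ p * Ring.choose l p) •
    ((i + k).choose k : ℤ) • cre r (i + k) (mode κ u (m + l - p + i) (mode κ v (n + p) w))
  let B : ℕ → ℕ → Fock := fun p i => ((-1) ^ p * Ring.choose l p) •
    ((-1) ^ k * ((i + k).choose k : ℤ)) •
      mode κ u (m + l - p - k - 1 - i) (mode κ v (n + p) (ann κ r i w))
  let G : ℕ → ℕ → ℕ → Fock := fun j p i => ((-1) ^ p * Ring.choose l p) •
    ((-1) ^ k * ((i + k).choose k : ℤ)) • (i.choose j : ℤ) •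
      mode κ u (m + l - p - k - 1 - i) (mode κ (ann κ r j v) (n - j + (p + i : ℕ)) w)
  have hA : VanishesFar A := by
    refine vanishesFar_of_eventually ?_ fun p => ?_
    · filter_upwards [mode_add_eventually κ v n w] with p hp i
      simp only [A, hp, map_zero, smul_zero]
    · filter_upwards [mode_add_eventually κ u (m + l - p) (mode κ v (n + p) w)] with i hi
      simp only [A, hi, map_zero, smul_zero]
  have hB : VanishesFar B := by
    refine VanishesFar.swap (vanishesFar_of_eventually ?_ fun i => ?_)
    · filter_upwards [ann_eventually κ r w] with i hi p
      simp only [hi, map_zero, smul_zero]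
    · filter_upwards [mode_add_eventually κ v n (ann κ r i w)] with p hp
      simp only [hp, map_zero, smul_zero]
  have hG : ∀ j, VanishesFar (G j) := fun j =>
    vanishesFar_of_add (mode_add_eventually κ (ann κ r j v) (n - j) w) fun p i h => by
      simp only [G, h, map_zero, smul_zero]
  have key : ∀ p : ℕ, ((-1) ^ p * Ring.choose l p) •
      mode κ (X (r, k) * u) (m + l - p) (mode κ v (n + p) w) =
        ∑ᶠ i, (A p i + (B p i + ∑ j ∈ range J, G j p i)) := by
    intro p
    rw [mode_X_mul_eq_finsum, smul_finsum_eventually _ (modeTerm_eventually κ r k u _ _)]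
    refine finsum_congr fun i => ?_
    rw [modeTerm, ann_mode, finsum_eq_sum_range (n := J) fun j hj => by
      rw [hJ j hj, mode_zero_left, smul_zero], map_add, map_sum, smul_add, smul_add, smul_add]
    congr 2
    rw [Finset.smul_sum, Finset.smul_sum]
    refine Finset.sum_congr rfl fun j _ => ?_
    rw [map_zsmul, show (i : ℤ) + (n + p) - j = n - j + (p + i : ℕ) by push_cast; ring]
  rw [compSum, finsum_congr key, hA.finsum_add (hB.add (VanishesFar.sum fun j _ => hG j)),
    hB.finsum_add (VanishesFar.sum fun j _ => hG j), VanishesFar.finsum_sum fun j _ => hG j,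
    hA.finsum_comm, hB.finsum_comm]
  congr 1
  · refine finsum_congr fun i => ?_
    have he := compSum_eventually κ u v l (m + i) n w
    rw [compSum, map_finsum_eventually (cre r (i + k)) he,
      smul_finsum_eventually _ (he.mono fun p hp => by rw [hp, map_zero])]
    refine finsum_congr fun p => ?_
    simp only [A]
    rw [map_zsmul, smul_comm, show m + l - p + i = m + i + l - p by ring]
  congr 1
  · refine finsum_congr fun i => ?_
    rw [compSum, smul_finsum_eventually _ (compSum_eventually κ u v l _ n _)]
    refine finsum_congr fun p => ?_
    simp only [B]
    rw [smul_comm, show m + l - p - k - 1 - i = m - k - 1 - i + l - p by ring]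
  · rw [finsum_eq_sum_range (n := J)]
    · refine Finset.sum_congr rfl fun j _ => ?_
      rw [compSum, smul_finsum_eventually _ (compSum_eventually κ u _ _ m n w)]
      simp only [smul_smul]
      rw [← finsum_antidiagonal_smul (c := fun p i => (-1) ^ k * ((j + k).choose k : ℤ) *
        ((-1) ^ p * Ring.choose l p * ((i + (k + j : ℕ)).choose (k + j : ℕ) : ℤ)))
        (f := fun p : ℕ => mode κ u (m + (l - k - 1 - j) - p)
          (mode κ (ann κ r j v) (n + p) w))]
      · refine finsum_congr fun p => ?_
        -- The factor `C(i, j)` vanishes for `i < j`. After the shift, the mode indices depend only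
        -- on `p + i`, and the coefficients are collected along antidiagonals.
        rw [finsum_shift j fun i hi => ?_]
        · refine finsum_congr fun i => ?_
          simp only [G]
          rw [smul_smul, smul_smul, show m + l - p - k - 1 - (i + j : ℕ) =
            m + (l - k - 1 - j) - (p + i : ℕ) by push_cast; ring,
            show n - j + (p + (i + j) : ℕ) = n + (p + i : ℕ) by push_cast; ring]
          congr 1
          have := choose_mul_choose_add i k j
          rw [show k + i + j = i + j + k by ring, add_comm k j, Nat.choose_symm_add] at this
          have h2 : (((i + j).choose j : ℤ) * ((i + j + k).choose k : ℤ)) =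
            ((j + k).choose k : ℤ) * ((i + (j + k)).choose (j + k) : ℤ) := by exact_mod_cast this
          rw [add_comm k j]
          linear_combination ((-1) ^ p * Ring.choose l p * (-1) ^ k) * h2
        · simp only [G]
          rw [Nat.choose_eq_zero_of_lt hi, Nat.cast_zero, zero_smul, smul_zero, smul_zero]
      · filter_upwards [mode_add_eventually κ (ann κ r j v) n w] with p hp
        rw [hp, map_zero]
      · intro p
        rw [← Finset.mul_sum, sum_choose_mul_choose]
        push_cast
        rw [show l - (k + j : ℤ) - 1 = l - k - 1 - j by ring]
    · intro j hj
      rw [hJ j hj, compSum, finsum_eq_zero_of_forall_eq_zero, smul_zero]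
      intro p
      rw [mode_zero_left, map_zero, smul_zero]

/-- Here the annihilation operators act first and are in place, while the creation operators must be
moved to the left through the modes of `v` by `cre_mode`. This accounts for the sign `(-1)^(j+1)` in
place of `(-1)^k`. -/
theorem revSum_X_mul (hκ : ∀ r s, κ r s = -κ s r) (r : ℤ) (k : ℕ) (u v : Fock) (l m n : ℤ)
    (w : Fock) : revSum κ (X (r, k) * u) v l m n w =
      ∑ᶠ i : ℕ, ((i + k).choose k : ℤ) • cre r (i + k) (revSum κ u v l (m + i) n w) +
      (∑ᶠ i : ℕ, ((-1) ^ k * ((i + k).choose k : ℤ)) •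
        revSum κ u v l (m - k - 1 - i) n (ann κ r i w) +
      ∑ᶠ j : ℕ, ((-1) ^ (j + 1) * ((j + k).choose k : ℤ)) •
        revSum κ u (ann κ r j v) (l - k - 1 - j) m n w) := by
  obtain ⟨J, hJ⟩ := eventually_atTop.1 (ann_eventually κ r v)
  let A : ℕ → ℕ → Fock := fun p i => ((-1) ^ p * Ring.choose l p) •
    ((i + k).choose k : ℤ) • cre r (i + k) (mode κ v (n + l - p) (mode κ u (m + (p + i : ℕ)) w))
  let B : ℕ → ℕ → Fock := fun p i => ((-1) ^ p * Ring.choose l p) •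
    ((-1) ^ k * ((i + k).choose k : ℤ)) •
      mode κ v (n + l - p) (mode κ u (m + p - k - 1 - i) (ann κ r i w))
  let G : ℕ → ℕ → ℕ → Fock := fun j p i => ((-1) ^ p * Ring.choose l p) •
    ((i + k).choose k : ℤ) • (-((-1) ^ j * ((j + (i + k)).choose (i + k) : ℤ))) •
      mode κ (ann κ r j v) (n + l - p - (i + k : ℕ) - 1 - j) (mode κ u (m + (p + i : ℕ)) w)
  have hA : VanishesFar A := vanishesFar_of_add (mode_add_eventually κ u m w) fun p i h => by
    simp only [A, h, map_zero, smul_zero]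
  have hB : VanishesFar B := by
    refine VanishesFar.swap (vanishesFar_of_eventually ?_ fun i => ?_)
    · filter_upwards [ann_eventually κ r w] with i hi p
      simp only [hi, map_zero, smul_zero]
    · filter_upwards [mode_add_eventually κ u (m - k - 1 - i) (ann κ r i w)] with p hp
      simp only [show m + p - k - 1 - i = m - k - 1 - i + p by ring, hp, map_zero, smul_zero]
  have hG : ∀ j, VanishesFar (G j) := fun j =>
    vanishesFar_of_add (mode_add_eventually κ u m w) fun p i h => by
      simp only [G, h, map_zero, smul_zero]
  have key : ∀ p : ℕ, ((-1) ^ p * Ring.choose l p) •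
      mode κ v (n + l - p) (mode κ (X (r, k) * u) (m + p) w) =
        ∑ᶠ i, (A p i + (B p i + ∑ j ∈ range J, G j p i)) := by
    intro p
    rw [mode_X_mul_eq_finsum, map_finsum_eventually _ (modeTerm_eventually κ r k u _ _),
      smul_finsum_eventually _ ((modeTerm_eventually κ r k u (m + p) w).mono fun i hi => by
        rw [hi, map_zero])]
    refine finsum_congr fun i => ?_
    have h1 := cre_mode κ hκ r (i + k) v (n + l - p) (mode κ u (m + (p + i : ℕ)) w)
    rw [finsum_eq_sum_range (n := J) fun j hj => by
      rw [hJ j hj, mode_zero_left, smul_zero], ← sub_eq_iff_eq_add] at h1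
    rw [modeTerm, map_add, map_zsmul, map_zsmul,
      show m + p + (i : ℤ) = m + (p + i : ℕ) by push_cast; ring, ← h1, smul_add, smul_sub,
      smul_sub, sub_eq_add_neg, add_assoc]
    congr 1
    rw [add_comm]
    congr 1
    rw [Finset.smul_sum, Finset.smul_sum, ← Finset.sum_neg_distrib]
    refine Finset.sum_congr rfl fun j _ => ?_
    simp only [G, neg_smul, smul_neg]
  rw [revSum, finsum_congr key, hA.finsum_add (hB.add (VanishesFar.sum fun j _ => hG j)),
    hB.finsum_add (VanishesFar.sum fun j _ => hG j), VanishesFar.finsum_sum fun j _ => hG j,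
    hA.finsum_comm, hB.finsum_comm]
  congr 1
  · refine finsum_congr fun i => ?_
    have he := revSum_eventually κ u v l (m + i) n w
    rw [revSum, map_finsum_eventually (cre r (i + k)) he,
      smul_finsum_eventually _ (he.mono fun p hp => by rw [hp, map_zero])]
    refine finsum_congr fun p => ?_
    simp only [A]
    rw [map_zsmul, smul_comm, show m + i + p = m + (p + i : ℕ) by push_cast; ring]
  congr 1
  · refine finsum_congr fun i => ?_
    rw [revSum, smul_finsum_eventually _ (revSum_eventually κ u v l _ n _)]
    refine finsum_congr fun p => ?_
    simp only [B]
    rw [smul_comm, show m + p - k - 1 - i = m - k - 1 - i + p by ring]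
  · rw [finsum_eq_sum_range (n := J)]
    · refine Finset.sum_congr rfl fun j _ => ?_
      rw [revSum, smul_finsum_eventually _ (revSum_eventually κ u _ _ m n w)]
      simp only [smul_smul]
      rw [← finsum_antidiagonal_smul (c := fun p i => (-1) ^ (j + 1) * ((j + k).choose k : ℤ) *
        ((-1) ^ p * Ring.choose l p * ((i + (j + k : ℕ)).choose (j + k : ℕ) : ℤ)))
        (f := fun p : ℕ => mode κ (ann κ r j v) (n + (l - k - 1 - j) - p)
          (mode κ u (m + p) w))]
      · refine finsum_congr fun p => finsum_congr fun i => ?_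
        simp only [G]
        rw [smul_smul, smul_smul, show n + l - p - (i + k : ℕ) - 1 - j =
            n + (l - k - 1 - j) - (p + i : ℕ) by push_cast; ring]
        congr 1
        have := choose_mul_choose_add i j k
        rw [show j + i + k = j + (i + k) by ring, Nat.choose_symm_add] at this
        have h2 : ((i + k).choose k : ℤ) * ((j + (i + k)).choose (i + k) : ℤ) =
          ((j + k).choose k : ℤ) * ((i + (j + k)).choose (j + k) : ℤ) := by exact_mod_cast this
        linear_combination ((-1) ^ p * Ring.choose l p * (-1) ^ (j + 1)) * h2
      · filter_upwards [mode_add_eventually κ u m w] with p hp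
        rw [hp, map_zero]
      · intro p
        rw [← Finset.mul_sum, sum_choose_mul_choose]
        push_cast
        rw [show l - (j + k : ℤ) - 1 = l - k - 1 - j by ring]
    · intro j hj
      rw [hJ j hj, revSum, finsum_eq_zero_of_forall_eq_zero, smul_zero]
      intro p
      rw [mode_zero_left, smul_zero]

end Fock

end QHeis

/-! ### Binomial identities and recursions for the iterate side of the Borcherds identity -/

namespace QHeis

open VertexOperator (ncoeff)

theorem sum_choose_mul_neg_one_pow (l : ℤ) (k p : ℕ) :
    ∑ x ∈ antidiagonal p, Ring.choose l x.1 * ((-1) ^ x.2 * ((x.2 + k).choose k : ℤ)) =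
      Ring.choose (l - k - 1) p := by
  have h : l - k - 1 = l + -(k + 1 : ℤ) := by ring
  rw [h, Ring.add_choose_eq _ (Commute.all _ _)]
  exact Finset.sum_congr rfl fun x _ => by rw [choose_add_neg]

/-- The Borcherds identity for `u = 1`, coefficient by coefficient: only the mode `-1` of the
identity field is nonzero, so each sum has at most one term. The proof runs through the signs of `l`
and `m`. -/
theorem choose_vacuum (l m : ℤ) :
    (if l < 0 then Ring.choose m (-1 - l).toNat else 0) =
      (if 0 ≤ m + l + 1 then (-1) ^ (m + l + 1).toNat * Ring.choose l (m + l + 1).toNat else 0) -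
        (l.negOnePow : ℤ) *
          if m < 0 then (-1) ^ (-1 - m).toNat * Ring.choose l (-1 - m).toNat else 0 := by
  have sq : ∀ a : ℕ, ((-1 : ℤ) ^ a) * (-1) ^ a = 1 := fun a => by rw [← mul_pow]; simp
  have hneg : ∀ a : ℕ, (Int.negSucc a) = -(a + 1 : ℤ) := fun a => by rw [Int.negSucc_eq]
  rcases l with L | a <;> rcases m with M | b
  · rw [if_neg (by simp), if_pos (by simp; omega), if_neg (by simp)]
    simp only [Int.ofNat_eq_natCast, show ((M : ℤ) + L + 1).toNat = M + L + 1 by omega,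
      Ring.choose_natCast]
    rw [Nat.choose_eq_zero_of_lt (by omega)]
    simp
  · rw [if_neg (by simp), if_pos (by omega : Int.negSucc b < 0), hneg]
    simp only [Int.ofNat_eq_natCast, show (-1 - -((b : ℤ) + 1)).toNat = b by omega,
      Ring.choose_natCast]
    split_ifs with h
    · obtain ⟨c, rfl⟩ : ∃ c, L = b + c := ⟨L - b, by omega⟩
      rw [show (-((b : ℤ) + 1) + (b + c : ℕ) + 1).toNat = c by omega,
        Int.coe_negOnePow_natCast, Nat.choose_symm_add, pow_add]
      linear_combination ((-1 : ℤ) ^ c * ((b + c).choose c : ℤ)) * sq b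
    · rw [Nat.choose_eq_zero_of_lt (by omega)]
      simp
  · rw [if_pos (by omega : Int.negSucc a < 0), if_neg (by simp : ¬ (Int.ofNat M < 0)), hneg]
    simp only [Int.ofNat_eq_natCast, show (-1 - -((a : ℤ) + 1)).toNat = a by omega,
      Ring.choose_natCast]
    split_ifs with h
    · obtain ⟨c, rfl⟩ : ∃ c, M = c + a := ⟨M - a, by omega⟩
      rw [show (((c + a : ℕ) : ℤ) + -((a : ℤ) + 1) + 1).toNat = c by omega, choose_add_neg]
      linear_combination (-((c + a).choose a : ℤ)) * sq c
    · rw [Nat.choose_eq_zero_of_lt (by omega)]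
      simp
  · rw [if_pos (by omega : Int.negSucc a < 0), if_pos (by omega : Int.negSucc b < 0),
      if_neg (by omega), hneg, hneg]
    simp only [show (-1 - -((a : ℤ) + 1)).toNat = a by omega,
      show (-1 - -((b : ℤ) + 1)).toNat = b by omega]
    rw [choose_add_neg, choose_add_neg, Int.negOnePow_neg, Int.negOnePow_succ, add_comm b a,
      Nat.choose_symm_add]
    simp only [Units.val_neg, Int.coe_negOnePow_natCast]
    linear_combination (-(-1 : ℤ) ^ a * ((a + b).choose b : ℤ)) * sq b

theorem VanishesFar.antidiagonal {M : Type*} [AddCommGroup M] {f : ℕ → ℕ → M}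
    (h : VanishesFar f) : ∀ᶠ p in atTop, ∑ x ∈ antidiagonal p, f x.1 x.2 = 0 := by
  obtain ⟨n, hn⟩ := h
  refine eventually_atTop.2 ⟨2 * n, fun p hp => Finset.sum_eq_zero fun x hx => hn _ _ ?_⟩
  rw [HasAntidiagonal.mem_antidiagonal] at hx
  omega

namespace Fock

open MvPolynomial (X C)

variable (κ : ℤ → ℤ → ℂ)

/-- The map `v ↦ v_n w`. -/
def modeAt (n : ℤ) (w : Fock) : Fock →ₗ[ℂ] Fock :=
  LinearMap.applyₗ w ∘ₗ LinearMap.proj n ∘ₗ mode κ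

theorem modeAt_apply (n : ℤ) (w v : Fock) : modeAt κ n w v = mode κ v n w := rfl

/-- The contribution of the creation operators to `∑_p C(m,p) ((X_{r,k} u)_{l+p} v)_{m+n-p} w`. -/
theorem iterSum_creation (r : ℤ) (k : ℕ) (u v : Fock) (l m n : ℤ) (w : Fock) :
    ∑ᶠ p : ℕ, ∑ᶠ i : ℕ, Ring.choose m p • ((i + k).choose k : ℤ) •
      ∑ᶠ h : ℕ, ((h + (i + k)).choose (i + k) : ℤ) •
        cre r (h + (i + k)) (mode κ (mode κ u (l + (p + i : ℕ)) v) (m + n - p + h) w) =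
    ∑ᶠ i : ℕ, ((i + k).choose k : ℤ) • cre r (i + k) (iterSum κ u v l (m + i) n w) := by
  obtain ⟨Q, hQ⟩ := eventually_atTop.1 (mode_add_eventually κ u l v)
  let g : ℕ → ℕ → ℕ → Fock := fun p i h => Ring.choose m p • ((i + k).choose k : ℤ) •
      ((h + (i + k)).choose (i + k) : ℤ) •
        cre r (h + (i + k)) (mode κ (mode κ u (l + (p + i : ℕ)) v) (m + n - p + h) w)
  have hev : ∀ p i : ℕ, ∀ᶠ h : ℕ in atTop, ((h + (i + k)).choose (i + k) : ℤ) •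
      cre r (h + (i + k)) (mode κ (mode κ u (l + (p + i : ℕ)) v) (m + n - p + h) w) = 0 := by
    intro p i
    filter_upwards [mode_add_eventually κ (mode κ u (l + (p + i : ℕ)) v) (m + n - p) w] with h hh
    rw [hh, map_zero, smul_zero]
  have hg : ∀ p, VanishesFar (g p) := fun p => by
    refine vanishesFar_of_eventually (eventually_atTop.2 ⟨Q, fun i hi h => ?_⟩) fun i => ?_
    · simp only [g]
      rw [hQ _ (by omega), mode_zero_left, map_zero, smul_zero, smul_zero, smul_zero]
    · filter_upwards [hev p i] with h hh
      simp only [g]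
      rw [hh, smul_zero, smul_zero]
  have h1 : ∀ p : ℕ, ∑ᶠ i : ℕ, Ring.choose m p • ((i + k).choose k : ℤ) •
      ∑ᶠ h : ℕ, ((h + (i + k)).choose (i + k) : ℤ) •
        cre r (h + (i + k)) (mode κ (mode κ u (l + (p + i : ℕ)) v) (m + n - p + h) w) =
      ∑ᶠ I : ℕ, ∑ x ∈ antidiagonal I, g p x.1 x.2 := by
    intro p
    rw [← (hg p).finsum_antidiagonal]
    refine finsum_congr fun i => ?_
    rw [smul_finsum_eventually _ (hev p i), smul_finsum_eventually _
      ((hev p i).mono fun h hh => by rw [hh, smul_zero])]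
  have hfar : VanishesFar fun p I : ℕ => ∑ x ∈ antidiagonal I, g p x.1 x.2 := by
    refine vanishesFar_of_eventually (eventually_atTop.2 ⟨Q, fun p hp I => ?_⟩)
      fun p => (hg p).antidiagonal
    refine Finset.sum_eq_zero fun x _ => ?_
    simp only [g]
    rw [hQ _ (by omega), mode_zero_left, map_zero, smul_zero, smul_zero, smul_zero]
  rw [finsum_congr h1, hfar.finsum_comm]
  refine finsum_congr fun I => ?_
  let f : ℕ → Fock := fun P => ((I + k).choose k : ℤ) •
    cre r (I + k) (mode κ (mode κ u (l + P) v) (m + I + n - P) w)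
  have hf : ∀ᶠ P in atTop, f P = 0 := by
    refine eventually_atTop.2 ⟨Q, fun P hP => ?_⟩
    simp only [f]
    rw [hQ _ hP, mode_zero_left, map_zero, smul_zero]
  -- For fixed `I = i + h` the creation operator is fixed, and the remaining sum over `p + i` is the
  -- Vandermonde convolution of `C(m, p)` with `C(I, i)`.
  have h2 : ∀ p : ℕ, ∑ x ∈ antidiagonal I, g p x.1 x.2 =
      ∑ᶠ i : ℕ, (Ring.choose m p * (I.choose i : ℤ)) • f (p + i) := by
    intro p
    rw [finsum_eq_sum_range (n := I + 1) fun i hi => by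
      rw [Nat.choose_eq_zero_of_lt (by omega), Nat.cast_zero, mul_zero, zero_smul],
      Finset.Nat.sum_antidiagonal_eq_sum_range_succ (g p)]
    refine Finset.sum_congr rfl fun i hi => ?_
    have hi' : i ≤ I := by simpa [Nat.lt_succ_iff] using hi
    simp only [g, f]
    rw [smul_smul, smul_smul, smul_smul, show I - i + (i + k) = I + k by omega,
      show m + n - p + (I - i : ℕ) = m + I + n - (p + i : ℕ) by push_cast [hi']; ring]
    congr 1
    have := Nat.add_choose_mul_factorial_mul_factorial i k
    have e : ((i + k).choose k : ℤ) * ((I + k).choose (i + k) : ℤ) =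
        (I.choose i : ℤ) * ((I + k).choose k : ℤ) := by
      have h3 := Nat.choose_mul (n := I + k) (k := i + k) (s := k) (by omega)
      rw [Nat.add_sub_cancel, Nat.add_sub_cancel] at h3
      have h4 : (((I + k).choose (i + k) * (i + k).choose k : ℕ) : ℤ) =
        (((I + k).choose k * I.choose i : ℕ) : ℤ) := by rw [h3]
      push_cast at h4
      linear_combination h4
    linear_combination Ring.choose m p * e
  rw [finsum_congr h2, finsum_antidiagonal_smul _ f hf (fun P => Ring.choose (m + I) P)]
  · have he := iterSum_eventually κ u v l (m + I) n w
    rw [iterSum, map_finsum_eventually (cre r (I + k)) he,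
      smul_finsum_eventually _ (he.mono fun p hp => by rw [hp, map_zero])]
    refine finsum_congr fun P => ?_
    simp only [f]
    rw [map_zsmul, smul_comm]
  · intro P
    rw [Ring.add_choose_eq _ (Commute.all _ _)]
    refine Finset.sum_congr rfl fun x _ => ?_
    rw [Ring.choose_natCast]

/-- The contribution of the annihilation operators to
`∑_p C(m,p) ((X_{r,k} u)_{l+p} v)_{m+n-p} w`. -/
theorem iterSum_annihilation (r : ℤ) (k : ℕ) (u v : Fock) (l m n : ℤ) (w : Fock) :
    ∑ᶠ p : ℕ, ∑ᶠ i : ℕ, Ring.choose m p • ((i + k).choose k : ℤ) •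
      ∑ᶠ h : ℕ, ((-1) ^ (i + k) * ((h + (i + k)).choose (i + k) : ℤ)) •
        mode κ (mode κ u (l + (p + i : ℕ)) v) (m + n - p - (i + k : ℕ) - 1 - h) (ann κ r h w) =
    ∑ᶠ i : ℕ, ((-1) ^ k * ((i + k).choose k : ℤ)) •
      iterSum κ u v l (m - k - 1 - i) n (ann κ r i w) := by
  obtain ⟨Q, hQ⟩ := eventually_atTop.1 (mode_add_eventually κ u l v)
  obtain ⟨H, hH⟩ := eventually_atTop.1 (ann_eventually κ r w)
  let f : ℕ → ℕ → Fock := fun h P =>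
    mode κ (mode κ u (l + P) v) ((m - k - 1 - h) + n - P) (ann κ r h w)
  let c : ℕ → ℕ → ℕ → ℤ := fun h p i => Ring.choose m p * ((i + k).choose k : ℤ) *
    ((-1) ^ (i + k) * ((h + (i + k)).choose (i + k) : ℤ))
  have hf : ∀ h, ∀ᶠ P in atTop, f h P = 0 := fun h => by
    refine eventually_atTop.2 ⟨Q, fun P hP => ?_⟩
    simp only [f]
    rw [hQ _ hP, mode_zero_left]
  have h1 : ∀ p i : ℕ, Ring.choose m p • ((i + k).choose k : ℤ) •
      ∑ᶠ h : ℕ, ((-1) ^ (i + k) * ((h + (i + k)).choose (i + k) : ℤ)) •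
        mode κ (mode κ u (l + (p + i : ℕ)) v) (m + n - p - (i + k : ℕ) - 1 - h) (ann κ r h w) =
      ∑ h ∈ range H, c h p i • f h (p + i) := by
    intro p i
    rw [finsum_eq_sum_range (n := H) fun h hh => by rw [hH h hh, map_zero, smul_zero],
      Finset.smul_sum, Finset.smul_sum]
    refine Finset.sum_congr rfl fun h _ => ?_
    simp only [f, c]
    rw [smul_smul, smul_smul, mul_assoc, show m + n - p - (i + k : ℕ) - 1 - h =
      m - k - 1 - h + n - (p + i : ℕ) by push_cast; ring]
  rw [finsum_congr fun p => finsum_congr fun i => h1 p i, VanishesFar.finsum_sum,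
    finsum_eq_sum_range (n := H)]
  · refine Finset.sum_congr rfl fun h _ => ?_
    rw [finsum_antidiagonal_smul (c h) (f h) (hf h) (fun P => ((-1) ^ k * ((h + k).choose k : ℤ)) *
      Ring.choose (m - k - 1 - h) P), iterSum,
      smul_finsum_eventually _ (iterSum_eventually κ u v l _ n _)]
    · exact finsum_congr fun P => by rw [smul_smul]
    · intro P
      -- The sum over `p + i = P` convolves `C(m, p)` with `C(-h-k-1, i)`, which lowers `m` to `m -
      -- k - 1 - h`.
      have h3 := sum_choose_mul_neg_one_pow m (h + k) P
      rw [show m - (h + k : ℕ) - 1 = m - k - 1 - h by push_cast; ring] at h3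
      rw [← h3, Finset.mul_sum]
      refine Finset.sum_congr rfl fun x _ => ?_
      have h4 := choose_mul_choose_add x.2 h k
      rw [show h + x.2 + k = h + (x.2 + k) by ring, Nat.choose_symm_add] at h4
      have h5 : ((x.2 + k).choose k : ℤ) * ((h + (x.2 + k)).choose (x.2 + k) : ℤ) =
        ((h + k).choose k : ℤ) * ((x.2 + (h + k)).choose (h + k) : ℤ) := by exact_mod_cast h4
      simp only [c]
      rw [pow_add]
      linear_combination (-(Ring.choose m x.1 * (-1) ^ x.2 * (-1) ^ k)) * h5
  · intro h hh
    rw [hH h hh, iterSum, finsum_eq_zero_of_forall_eq_zero, smul_zero]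
    intro p
    rw [map_zero, smul_zero]
  · intro h _
    exact vanishesFar_of_add (hf h) fun p i hpi => by rw [hpi, smul_zero]

/-- The inner mode of `X_{r,k} u` on `v` splits into creation and annihilation terms. A creation
term `X_{r,i+k} * _` is itself a state whose modes split again, giving the first two sums; the
annihilation terms give the third. -/
theorem iterSum_X_mul (r : ℤ) (k : ℕ) (u v : Fock) (l m n : ℤ) (w : Fock) :
    iterSum κ (X (r, k) * u) v l m n w =
      ∑ᶠ i : ℕ, ((i + k).choose k : ℤ) • cre r (i + k) (iterSum κ u v l (m + i) n w) +
      (∑ᶠ i : ℕ, ((-1) ^ k * ((i + k).choose k : ℤ)) •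
        iterSum κ u v l (m - k - 1 - i) n (ann κ r i w) +
      ∑ᶠ j : ℕ, ((-1) ^ k * ((j + k).choose k : ℤ)) •
        iterSum κ u (ann κ r j v) (l - k - 1 - j) m n w) := by
  let A : ℕ → ℕ → Fock := fun p i => Ring.choose m p • ((i + k).choose k : ℤ) •
    ∑ᶠ h : ℕ, ((h + (i + k)).choose (i + k) : ℤ) •
      cre r (h + (i + k)) (mode κ (mode κ u (l + (p + i : ℕ)) v) (m + n - p + h) w)
  let B : ℕ → ℕ → Fock := fun p i => Ring.choose m p • ((i + k).choose k : ℤ) •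
    ∑ᶠ h : ℕ, ((-1) ^ (i + k) * ((h + (i + k)).choose (i + k) : ℤ)) •
      mode κ (mode κ u (l + (p + i : ℕ)) v) (m + n - p - (i + k : ℕ) - 1 - h) (ann κ r h w)
  let D : ℕ → ℕ → Fock := fun p i => Ring.choose m p • ((-1) ^ k * ((i + k).choose k : ℤ)) •
    mode κ (mode κ u (l - k - 1 - i + p) (ann κ r i v)) (m + n - p) w
  have hA : VanishesFar A := vanishesFar_of_add (mode_add_eventually κ u l v) fun p i h => by
    simp only [A, h, map_zero, Pi.zero_apply, LinearMap.zero_apply, smul_zero, finsum_zero]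
  have hB : VanishesFar B := vanishesFar_of_add (mode_add_eventually κ u l v) fun p i h => by
    simp only [B, h, map_zero, Pi.zero_apply, LinearMap.zero_apply, smul_zero, finsum_zero]
  have hD : VanishesFar D := by
    refine VanishesFar.swap (vanishesFar_of_eventually ?_ fun i => ?_)
    · filter_upwards [ann_eventually κ r v] with i hi p
      simp only [hi, map_zero, Pi.zero_apply, LinearMap.zero_apply, smul_zero]
    · filter_upwards [mode_add_eventually κ u (l - k - 1 - i) (ann κ r i v)] with p hp
      simp only [hp, map_zero, Pi.zero_apply, LinearMap.zero_apply, smul_zero]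
  have key : ∀ p : ℕ, Ring.choose m p • mode κ (mode κ (X (r, k) * u) (l + p) v) (m + n - p) w =
      ∑ᶠ i, (A p i + (B p i + D p i)) := by
    intro p
    rw [mode_X_mul_eq_finsum, ← modeAt_apply,
      map_finsum_eventually (modeAt κ (m + n - p) w) (modeTerm_eventually κ r k u _ _),
      smul_finsum_eventually _ ((modeTerm_eventually κ r k u (l + p) v).mono fun i hi => by
        rw [hi, map_zero])]
    refine finsum_congr fun i => ?_
    rw [modeTerm, map_add, map_zsmul, map_zsmul, modeAt_apply, modeAt_apply, smul_add, cre_apply,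
      mode_X_mul, smul_add, smul_add, add_assoc, show l + p + (i : ℤ) = l + (p + i : ℕ) by
      push_cast; ring, show l + p - k - 1 - i = l - k - 1 - i + p by ring]
  rw [iterSum, finsum_congr key, hA.finsum_add (hB.add hD), hB.finsum_add hD, hD.finsum_comm,
    iterSum_creation, iterSum_annihilation]
  congr 2
  refine finsum_congr fun i => ?_
  rw [iterSum, smul_finsum_eventually _ (iterSum_eventually κ u _ _ m n w)]
  refine finsum_congr fun p => ?_
  simp only [D]
  rw [smul_comm]

/-! ### The Borcherds identity -/

theorem finsum_sub_smul_eventually {M : Type*} [AddCommGroup M] {f g : ℕ → M} (c : ℤ)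
    (hf : ∀ᶠ i in atTop, f i = 0) (hg : ∀ᶠ i in atTop, g i = 0) :
    ∑ᶠ i, (f i - c • g i) = ∑ᶠ i, f i - c • ∑ᶠ i, g i := by
  rw [smul_finsum_eventually c hg, finsum_sub_eventually hf]
  filter_upwards [hg] with i hi
  rw [hi, smul_zero]

theorem compSum_shift_eventually (u v : Fock) (l m n : ℤ) (w : Fock) :
    ∀ᶠ i : ℕ in atTop, compSum κ u v l (m + i) n w = 0 := by
  obtain ⟨P, hP⟩ := eventually_atTop.1 (mode_add_eventually κ v n w)
  have : ∀ᶠ i : ℕ in atTop, ∀ p ∈ range P,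
      mode κ u (m + l - p + i) (mode κ v (n + p) w) = 0 :=
    (Filter.eventually_all_finset _).2 fun p _ => mode_add_eventually κ u _ _
  filter_upwards [this] with i hi
  refine finsum_eq_zero_of_forall_eq_zero fun p => ?_
  by_cases hp : p < P
  · rw [show m + i + l - p = m + l - p + i by ring, hi p (Finset.mem_range.2 hp), smul_zero]
  · rw [hP p (by omega), map_zero, smul_zero]

theorem revSum_shift_eventually (u v : Fock) (l m n : ℤ) (w : Fock) :
    ∀ᶠ i : ℕ in atTop, revSum κ u v l (m + i) n w = 0 := by
  obtain ⟨P, hP⟩ := eventually_atTop.1 (mode_add_eventually κ u m w)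
  refine eventually_atTop.2 ⟨P, fun i hi => finsum_eq_zero_of_forall_eq_zero fun p => ?_⟩
  have := hP (i + p) (by omega)
  rw [show m + i + (p : ℤ) = m + (i + p : ℕ) by push_cast; ring, this, map_zero, smul_zero]

/-- All three sums are multiples of the one vector `v_{n+m+l+1} w`, with the coefficients compared
in `choose_vacuum`. -/
theorem iterSum_one (v : Fock) (l m n : ℤ) (w : Fock) :
    iterSum κ 1 v l m n w =
      compSum κ 1 v l m n w - (l.negOnePow : ℤ) • revSum κ 1 v l m n w := by
  have key : ∀ (l : ℤ) (N : ℤ), ∑ᶠ p : ℕ, Ring.choose m p • mode κ (mode κ 1 (l + p) v) (N - p) w =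
      if l < 0 then Ring.choose m (-1 - l).toNat • mode κ v (N - (-1 - l)) w else 0 := by
    intro l N
    split_ifs with h
    · rw [finsum_eq_single _ (-1 - l).toNat]
      · rw [mode_one, if_pos (by omega), show (((-1 - l).toNat : ℕ) : ℤ) = -1 - l by omega]
      · intro p hp
        rw [mode_one, if_neg (by omega), mode_zero_left, smul_zero]
    · refine finsum_eq_zero_of_forall_eq_zero fun p => ?_
      rw [mode_one, if_neg (by omega), mode_zero_left, smul_zero]
  have h2 : compSum κ 1 v l m n w = if 0 ≤ m + l + 1 then
      ((-1) ^ (m + l + 1).toNat * Ring.choose l (m + l + 1).toNat) •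
        mode κ v (n + m + l + 1) w else 0 := by
    rw [compSum]
    split_ifs with h
    · rw [finsum_eq_single _ (m + l + 1).toNat]
      · rw [mode_one, if_pos (by omega),
          show n + ((m + l + 1).toNat : ℤ) = n + m + l + 1 by omega]
      · intro p hp
        rw [mode_one, if_neg (by omega), smul_zero]
    · refine finsum_eq_zero_of_forall_eq_zero fun p => ?_
      rw [mode_one, if_neg (by omega), smul_zero]
  have h3 : revSum κ 1 v l m n w = if m < 0 then
      ((-1) ^ (-1 - m).toNat * Ring.choose l (-1 - m).toNat) •
        mode κ v (n + m + l + 1) w else 0 := by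
    rw [revSum]
    split_ifs with h
    · rw [finsum_eq_single _ (-1 - m).toNat]
      · rw [mode_one, if_pos (by omega),
          show n + l - ((-1 - m).toNat : ℤ) = n + m + l + 1 by omega]
      · intro p hp
        rw [mode_one, if_neg (by omega), map_zero, smul_zero]
    · refine finsum_eq_zero_of_forall_eq_zero fun p => ?_
      rw [mode_one, if_neg (by omega), map_zero, smul_zero]
  rw [iterSum, key, h2, h3, show m + n - (-1 - l) = n + m + l + 1 by ring]
  have h4 := congrArg (fun c : ℤ => c • mode κ v (n + m + l + 1) w) (choose_vacuum l m)
  simp only [sub_smul, mul_smul, ite_smul, zero_smul] at h4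
  rw [h4]
  simp only [mul_smul]

/-- The Borcherds identity on the Fock space. -/
theorem iterSum_eq (hκ : ∀ r s, κ r s = -κ s r) (u v : Fock) (l m n : ℤ) (w : Fock) :
    iterSum κ u v l m n w =
      compSum κ u v l m n w - (l.negOnePow : ℤ) • revSum κ u v l m n w := by
  induction u using MvPolynomial.induction_on generalizing v l m n w with
  | C s =>
    have e : (C s : Fock) = s • 1 := by rw [MvPolynomial.smul_eq_C_mul, mul_one]
    have h1 : iterSum κ (s • 1) v l m n w = s • iterSum κ 1 v l m n w := by
      rw [iterSum, iterSum, smul_finsum_eventually _ (iterSum_eventually κ 1 v l m n w)]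
      refine finsum_congr fun p => ?_
      rw [smul_comm s]
      simp only [map_smul, Pi.smul_apply, LinearMap.smul_apply]
    have h2 : compSum κ (s • 1) v l m n w = s • compSum κ 1 v l m n w := by
      rw [compSum, compSum, smul_finsum_eventually _ (compSum_eventually κ 1 v l m n w)]
      refine finsum_congr fun p => ?_
      rw [smul_comm s]
      simp only [map_smul, Pi.smul_apply, LinearMap.smul_apply]
    have h3 : revSum κ (s • 1) v l m n w = s • revSum κ 1 v l m n w := by
      rw [revSum, revSum, smul_finsum_eventually _ (revSum_eventually κ 1 v l m n w)]
      refine finsum_congr fun p => ?_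
      rw [smul_comm s]
      simp only [map_smul, Pi.smul_apply, LinearMap.smul_apply]
    rw [e, h1, h2, h3, iterSum_one, smul_sub, smul_comm s]
  | add u u' hu hu' =>
    have h1 : iterSum κ (u + u') v l m n w = iterSum κ u v l m n w + iterSum κ u' v l m n w := by
      rw [iterSum, iterSum, iterSum, ← finsum_add_eventually (iterSum_eventually κ u v l m n w)
        (iterSum_eventually κ u' v l m n w)]
      refine finsum_congr fun p => ?_
      simp only [map_add, Pi.add_apply, LinearMap.add_apply, smul_add]
    have h2 : compSum κ (u + u') v l m n w = compSum κ u v l m n w + compSum κ u' v l m n w := by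
      rw [compSum, compSum, compSum, ← finsum_add_eventually (compSum_eventually κ u v l m n w)
        (compSum_eventually κ u' v l m n w)]
      refine finsum_congr fun p => ?_
      simp only [map_add, Pi.add_apply, LinearMap.add_apply, smul_add]
    have h3 : revSum κ (u + u') v l m n w = revSum κ u v l m n w + revSum κ u' v l m n w := by
      rw [revSum, revSum, revSum, ← finsum_add_eventually (revSum_eventually κ u v l m n w)
        (revSum_eventually κ u' v l m n w)]
      refine finsum_congr fun p => ?_
      simp only [map_add, Pi.add_apply, LinearMap.add_apply, smul_add]
    rw [h1, h2, h3, hu, hu', smul_add]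
    abel
  | mul_X u a hu =>
    obtain ⟨r, k⟩ := a
    rw [mul_comm, iterSum_X_mul, compSum_X_mul, revSum_X_mul κ hκ]
    have e1 : ∀ᶠ i : ℕ in atTop,
        ((i + k).choose k : ℤ) • cre r (i + k) (compSum κ u v l (m + i) n w) = 0 := by
      filter_upwards [compSum_shift_eventually κ u v l m n w] with i hi
      rw [hi, map_zero, smul_zero]
    have e2 : ∀ᶠ i : ℕ in atTop,
        ((i + k).choose k : ℤ) • cre r (i + k) (revSum κ u v l (m + i) n w) = 0 := by
      filter_upwards [revSum_shift_eventually κ u v l m n w] with i hi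
      rw [hi, map_zero, smul_zero]
    have e3 : ∀ᶠ i : ℕ in atTop, ((-1) ^ k * ((i + k).choose k : ℤ)) •
        compSum κ u v l (m - k - 1 - i) n (ann κ r i w) = 0 := by
      filter_upwards [ann_eventually κ r w] with i hi
      rw [hi, compSum, finsum_eq_zero_of_forall_eq_zero, smul_zero]
      intro p
      rw [map_zero, map_zero, smul_zero]
    have e4 : ∀ᶠ i : ℕ in atTop, ((-1) ^ k * ((i + k).choose k : ℤ)) •
        revSum κ u v l (m - k - 1 - i) n (ann κ r i w) = 0 := by
      filter_upwards [ann_eventually κ r w] with i hi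
      rw [hi, revSum, finsum_eq_zero_of_forall_eq_zero, smul_zero]
      intro p
      rw [map_zero, map_zero, smul_zero]
    have e5 : ∀ᶠ j : ℕ in atTop, ((-1) ^ k * ((j + k).choose k : ℤ)) •
        compSum κ u (ann κ r j v) (l - k - 1 - j) m n w = 0 := by
      filter_upwards [ann_eventually κ r v] with i hi
      rw [hi, compSum, finsum_eq_zero_of_forall_eq_zero, smul_zero]
      intro p
      rw [mode_zero_left, map_zero, smul_zero]
    have e6 : ∀ᶠ j : ℕ in atTop, ((-1) ^ (j + 1) * ((j + k).choose k : ℤ)) •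
        revSum κ u (ann κ r j v) (l - k - 1 - j) m n w = 0 := by
      filter_upwards [ann_eventually κ r v] with i hi
      rw [hi, revSum, finsum_eq_zero_of_forall_eq_zero, smul_zero]
      intro p
      rw [mode_zero_left, smul_zero]
    have f1 : ∀ i : ℕ, ((i + k).choose k : ℤ) • cre r (i + k) (iterSum κ u v l (m + i) n w) =
        ((i + k).choose k : ℤ) • cre r (i + k) (compSum κ u v l (m + i) n w) -
        (l.negOnePow : ℤ) • ((i + k).choose k : ℤ) •
          cre r (i + k) (revSum κ u v l (m + i) n w) := fun i => by
      rw [hu, map_sub, map_zsmul, smul_sub, smul_comm]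
    have f2 : ∀ i : ℕ, ((-1) ^ k * ((i + k).choose k : ℤ)) •
        iterSum κ u v l (m - k - 1 - i) n (ann κ r i w) = ((-1) ^ k * ((i + k).choose k : ℤ)) •
        compSum κ u v l (m - k - 1 - i) n (ann κ r i w) -
        (l.negOnePow : ℤ) • ((-1) ^ k * ((i + k).choose k : ℤ)) •
        revSum κ u v l (m - k - 1 - i) n (ann κ r i w) := fun i => by
      rw [hu, smul_sub, smul_comm (_ * _ : ℤ)]
    -- The sign `(-1)^(l-k-1-j)` from the induction hypothesis, times `(-1)^k`, is `(-1)^l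
    -- (-1)^(j+1)`: the different signs in the recursions for `compSum` and `revSum` are exactly
    -- compensated.
    have f3 : ∀ j : ℕ, ((-1) ^ k * ((j + k).choose k : ℤ)) •
        iterSum κ u (ann κ r j v) (l - k - 1 - j) m n w = ((-1) ^ k * ((j + k).choose k : ℤ)) •
        compSum κ u (ann κ r j v) (l - k - 1 - j) m n w -
        (l.negOnePow : ℤ) • ((-1) ^ (j + 1) * ((j + k).choose k : ℤ)) •
        revSum κ u (ann κ r j v) (l - k - 1 - j) m n w := fun j => by
      rw [hu, smul_sub, smul_smul, smul_smul]
      congr 2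
      rw [Int.negOnePow_sub, Int.negOnePow_sub, Int.negOnePow_sub, Int.negOnePow_one]
      simp only [Units.val_mul, Units.val_neg, Units.val_one, Int.coe_negOnePow_natCast]
      have : ((-1 : ℤ) ^ k) * (-1) ^ k = 1 := by rw [← mul_pow]; simp
      linear_combination (-(l.negOnePow : ℤ) * (-1) ^ j * ((j + k).choose k : ℤ)) * this
    rw [finsum_congr f1, finsum_congr f2, finsum_congr f3, finsum_sub_smul_eventually _ e1 e2,
      finsum_sub_smul_eventually _ e3 e4, finsum_sub_smul_eventually _ e5 e6, smul_add, smul_add]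
    abel

end Fock

end QHeis

namespace QHeis

open VertexOperator (ncoeff)

/-! ### The vertex algebra structure on the Fock space -/

namespace Fock

open MvPolynomial (X C)

variable (κ : ℤ → ℤ → ℂ)

theorem borcherds (hκ : ∀ r s, κ r s = -κ s r) (u v w : Fock) (l m n : ℤ) :
    ∑ᶠ i : ℕ, Ring.choose m i • mode κ (mode κ u (l + i) v) (m + n - i) w =
      ∑ᶠ i : ℕ, ((-1) ^ i * Ring.choose l i) •
        (mode κ u (m + l - i) (mode κ v (n + i) w)
          - Int.negOnePow l • mode κ v (n + l - i) (mode κ u (m + i) w)) := by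
  have h := iterSum_eq κ hκ u v l m n w
  rw [iterSum, compSum, revSum, ← finsum_sub_smul_eventually _
    (compSum_eventually κ u v l m n w) (revSum_eventually κ u v l m n w)] at h
  rw [h]
  refine finsum_congr fun i => ?_
  rw [smul_sub, smul_comm (l.negOnePow : ℤ)]
  rfl

/-- The Fock space as a vertex algebra. -/
def vertexAlgebra (hκ : ∀ r s, κ r s = -κ s r) : VertexAlgebra Fock where
  Y := Y κ
  vac := 1
  vacuum n v := mode_one κ n v
  creation v := (mode_creation κ v).1
  creation_regular v n hn := (mode_creation κ v).2 n hn
  borcherds u v w l m n := borcherds κ hκ u v w l m n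

/-- The operator of `β^{(r)}_n` on the Fock space. -/
def osc (r : ℤ) (n : ℤ) : Module.End ℂ Fock :=
  if 0 ≤ n then ann κ r n.toNat else cre r (-n - 1).toNat

theorem osc_natCast (r : ℤ) (n : ℕ) : osc κ r n = ann κ r n := by
  rw [osc, if_pos (by omega), Int.toNat_natCast]

theorem osc_negSucc (r : ℤ) (n : ℕ) : osc κ r (-n - 1) = cre r n := by
  rw [osc, if_neg (by omega), show (-(-(n : ℤ) - 1) - 1).toNat = n by omega]

theorem mode_X (r : ℤ) (n : ℤ) (v : Fock) : mode κ (X (r, 0)) n v = osc κ r n v := by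
  have h := mode_X_mul κ r 0 1 n v
  rw [mul_one] at h
  rw [h]
  simp only [add_zero, Nat.choose_zero_right, pow_zero, Nat.cast_one, mul_one, one_smul,
    mode_one, Nat.cast_zero, sub_zero]
  rcases le_or_gt 0 n with hn | hn
  · rw [finsum_eq_zero_of_forall_eq_zero, finsum_eq_single _ n.toNat, if_pos (by omega), zero_add,
      osc, if_pos hn]
    · intro i hi
      rw [if_neg (by omega)]
    · intro i
      rw [if_neg (by omega), map_zero]
  · rw [finsum_eq_single _ (-n - 1).toNat, if_pos (by omega), finsum_eq_zero_of_forall_eq_zero,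
      add_zero, osc, if_neg (by omega)]
    · intro i
      rw [if_neg (by omega)]
    · intro i hi
      rw [if_neg (by omega), map_zero]

theorem osc_osc (hκ : ∀ r s, κ r s = -κ s r) (r s : ℤ) (m n : ℤ) (v : Fock) :
    osc κ r m (osc κ s n v) = osc κ s n (osc κ r m v) +
      (if m + n + 1 = 0 then κ r s else 0) • v := by
  rcases m with m | m <;> rcases n with n | n
  · simp only [Int.ofNat_eq_natCast, osc_natCast]
    rw [ann_comm, if_neg (by omega), zero_smul, add_zero]
  · rw [show Int.negSucc n = -n - 1 by omega]
    simp only [Int.ofNat_eq_natCast, osc_natCast, osc_negSucc]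
    rw [ann_cre, add_comm]
    simp only [show (m : ℤ) + (-n - 1) + 1 = 0 ↔ n = m by omega]
  · rw [show Int.negSucc m = -m - 1 by omega]
    simp only [Int.ofNat_eq_natCast, osc_natCast, osc_negSucc]
    rw [ann_cre]
    simp only [show -(m : ℤ) - 1 + n + 1 = 0 ↔ m = n by omega]
    split_ifs
    · rw [hκ r s, neg_smul]; abel
    · simp
  · rw [show Int.negSucc m = -m - 1 by omega, show Int.negSucc n = -n - 1 by omega]
    simp only [osc_negSucc, cre_apply]
    rw [if_neg (by omega), zero_smul, add_zero, mul_left_comm]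

end Fock

/-! ### Transport of vertex algebra structures -/

section Transport

variable {V V' : Type*} [AddCommGroup V] [Module ℂ V] [AddCommGroup V'] [Module ℂ V']

/-- Conjugation of fields by a linear equivalence. -/
def conjField (e : V ≃ₗ[ℂ] V') : VertexOperator ℂ V →ₗ[ℂ] VertexOperator ℂ V' where
  toFun A := mkField (fun n => e.toLinearMap ∘ₗ cf A n ∘ₗ e.symm.toLinearMap) fun w => by
    filter_upwards [cf_eventually A (e.symm w)] with n hn
    simp [hn]
  map_add' A B := by
    refine cf_ext fun n w => ?_
    change e (cf (A + B) n (e.symm w)) = e (cf A n (e.symm w)) + e (cf B n (e.symm w))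
    rw [map_add, Pi.add_apply, LinearMap.add_apply, map_add]
  map_smul' s A := by
    refine cf_ext fun n w => ?_
    change e (cf (s • A) n (e.symm w)) = s • e (cf A n (e.symm w))
    rw [map_smul, Pi.smul_apply, LinearMap.smul_apply, map_smul]

theorem ncoeff_conjField (e : V ≃ₗ[ℂ] V') (A : VertexOperator ℂ V) (n : ℤ) (w : V') :
    ncoeff (conjField e A) n w = e (ncoeff A n (e.symm w)) := rfl

theorem finsum_map_equiv (e : V ≃ₗ[ℂ] V') (f : ℕ → V) : ∑ᶠ i, e (f i) = e (∑ᶠ i, f i) :=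
  (e.toAddEquiv.map_finsum f).symm

/-- Transport of a vertex algebra structure along a linear equivalence. -/
def VertexAlgebra.transport (𝒱 : VertexAlgebra V) (e : V ≃ₗ[ℂ] V') : VertexAlgebra V' where
  Y := conjField e ∘ₗ 𝒱.Y ∘ₗ e.symm.toLinearMap
  vac := e 𝒱.vac
  vacuum n v := by
    simp only [LinearMap.comp_apply, LinearEquiv.coe_coe, ncoeff_conjField, e.symm_apply_apply,
      𝒱.vacuum]
    split_ifs <;> simp
  creation v := by
    simp only [LinearMap.comp_apply, LinearEquiv.coe_coe, ncoeff_conjField, e.symm_apply_apply,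
      𝒱.creation, e.apply_symm_apply]
  creation_regular v n hn := by
    simp only [LinearMap.comp_apply, LinearEquiv.coe_coe, ncoeff_conjField, e.symm_apply_apply,
      𝒱.creation_regular _ n hn, map_zero]
  borcherds u v w l m n := by
    have h := congrArg e (𝒱.borcherds (e.symm u) (e.symm v) (e.symm w) l m n)
    rw [← finsum_map_equiv, ← finsum_map_equiv] at h
    simp only [LinearMap.comp_apply, LinearEquiv.coe_coe, ncoeff_conjField, e.symm_apply_apply]
    refine Eq.trans (finsum_congr fun i => ?_) (h.trans (finsum_congr fun i => ?_))
    · rw [map_zsmul]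
    · rw [map_zsmul, map_sub, Units.smul_def, Units.smul_def, map_zsmul]

theorem VertexAlgebra.transport_ncoeff (𝒱 : VertexAlgebra V) (e : V ≃ₗ[ℂ] V') (u v : V') (n : ℤ) :
    ncoeff ((𝒱.transport e).Y u) n v = e (ncoeff (𝒱.Y (e.symm u)) n (e.symm v)) := rfl

end Transport

end QHeis

namespace QHeis

open VertexOperator (ncoeff)

/-! ### The Fock space as a model of the vacuum module -/

/-- The commutators of the oscillators, for level `ℓ`. -/
def kap (q ℓ : ℂ) (r s : ℤ) : ℂ := ℓ * formB q (Finsupp.single r 1) (Finsupp.single s 1)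

theorem kap_skew (q ℓ : ℂ) (r s : ℤ) : kap q ℓ r s = -kap q ℓ s r := by
  rw [kap, kap, ← (formB_isAlt q).neg_eq]
  ring

attribute [local instance 100] LieRing.ofAssociativeRing

namespace Fock

open MvPolynomial (X C)

variable (q ℓ : ℂ)

/-- The operator of `b_n` on the Fock space, for `b ∈ B`. -/
def oscB (n : ℤ) : (ℤ →₀ ℂ) →ₗ[ℂ] Module.End ℂ Fock :=
  Finsupp.linearCombination ℂ fun r => osc (kap q ℓ) r n

theorem oscB_single (n r : ℤ) : oscB q ℓ n (Finsupp.single r 1) = osc (kap q ℓ) r n := by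
  rw [oscB, Finsupp.linearCombination_single, one_smul]

/-- The operators of the elements of `B ⊗ ℂ[t, t⁻¹]` on the Fock space. -/
def oscLB : LB →ₗ[ℂ] Module.End ℂ Fock :=
  TensorProduct.lift ((Finsupp.linearCombination ℂ (oscB q ℓ) ∘ₗ
    (AddMonoidAlgebra.coeffLinearEquiv ℂ).toLinearMap : ℂ[T;T⁻¹] →ₗ[ℂ] _).flip)

theorem oscLB_T (b : ℤ →₀ ℂ) (n : ℤ) :
    oscLB q ℓ (b ⊗ₜ LaurentPolynomial.T n) = oscB q ℓ n b := by
  rw [oscLB, TensorProduct.lift.tmul]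
  change Finsupp.linearCombination ℂ (oscB q ℓ) (Finsupp.single n 1) b = _
  rw [Finsupp.linearCombination_single, one_smul]

theorem LB_induction {P : LB → Prop} (h0 : P 0) (hadd : ∀ x y, P x → P y → P (x + y))
    (hsmul : ∀ (s : ℂ) x, P x → P (s • x))
    (h : ∀ r n : ℤ, P (Finsupp.single r 1 ⊗ₜ LaurentPolynomial.T n)) (x : LB) : P x := by
  induction x using TensorProduct.induction_on with
  | zero => exact h0
  | add x y hx hy => exact hadd x y hx hy
  | tmul b f =>
    induction f using LaurentPolynomial.induction_on' with
    | add f g hf hg =>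
      rw [TensorProduct.tmul_add]
      exact hadd _ _ hf hg
    | C_mul_T n a =>
      have e : (LaurentPolynomial.C a * LaurentPolynomial.T n : ℂ[T;T⁻¹]) =
          a • LaurentPolynomial.T n := by
        rw [LaurentPolynomial.smul_eq_C_mul]
      rw [e, TensorProduct.tmul_smul]
      refine hsmul a _ ?_
      induction b using Finsupp.induction_linear with
      | zero => rw [TensorProduct.zero_tmul]; exact h0
      | add b b' hb hb' => rw [TensorProduct.add_tmul]; exact hadd _ _ hb hb'
      | single r s =>
        rw [show (Finsupp.single r s : ℤ →₀ ℂ) = s • Finsupp.single r 1 by simp,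
          ← TensorProduct.smul_tmul']
        exact hsmul s _ (h r n)

/-- Both sides are bilinear, so the commutators `osc_osc` of basis elements suffice. This is what
makes `rep` a representation. -/
theorem oscLB_comm (x y : LB) (v : Fock) : oscLB q ℓ x (oscLB q ℓ y v) -
    oscLB q ℓ y (oscLB q ℓ x v) = (affForm q x y * ℓ) • v := by
  induction x using LB_induction with
  | h0 => simp
  | hadd x x' hx hx' =>
    simp only [map_add, LinearMap.add_apply, add_mul, add_smul, ← hx, ← hx']
    abel
  | hsmul s x hx =>
    simp only [map_smul, LinearMap.smul_apply, smul_eq_mul, mul_assoc, mul_smul s, ← smul_sub, hx]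
  | h r m =>
    induction y using LB_induction with
    | h0 => simp
    | hadd x x' hx hx' =>
      simp only [map_add, LinearMap.add_apply, add_mul, add_smul, ← hx, ← hx']
      abel
    | hsmul s x hx =>
      simp only [map_smul, LinearMap.smul_apply, smul_eq_mul, mul_assoc, mul_smul s, ← smul_sub, hx]
    | h s n =>
      rw [oscLB_T, oscLB_T, oscB_single, oscB_single, affForm_T,
        osc_osc (kap q ℓ) (kap_skew q ℓ), add_sub_cancel_left]
      split_ifs
      · rw [kap, mul_comm]
      · simp

/-- The representation of the affine Heisenberg Lie algebra on the Fock space. -/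
def rep : BHat q →ₗ⁅ℂ⁆ Module.End ℂ Fock where
  toFun x := oscLB q ℓ x.vec + (x.cen * ℓ) • 1
  map_add' x y := by
    simp only [Heisenberg.vec_add, Heisenberg.cen_add, map_add, add_mul, add_smul]
    abel
  map_smul' s x := by
    simp only [Heisenberg.vec_smul, Heisenberg.cen_smul, map_smul, mul_assoc, mul_smul s, smul_add,
      RingHom.id_apply]
  map_lie' {x y} := by
    refine LinearMap.ext fun v => ?_
    simp only [Heisenberg.vec_lie, Heisenberg.cen_lie, map_zero, zero_add, LieRing.of_associative_ring_bracket,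
      LinearMap.smul_apply, LinearMap.sub_apply, Module.End.mul_apply, LinearMap.add_apply,
      Module.End.one_apply, map_add, map_smul, smul_add]
    rw [← oscLB_comm]
    simp only [smul_smul, mul_comm (y.cen * ℓ)]
    abel

/-- The action of the enveloping algebra on the Fock space. -/
def repU : UB q →ₐ[ℂ] Module.End ℂ Fock := UniversalEnvelopingAlgebra.lift ℂ (rep q ℓ)

theorem repU_bMode (n : ℤ) (b : ℤ →₀ ℂ) :
    repU q ℓ (UniversalEnvelopingAlgebra.ι ℂ (bMode q n b)) = oscB q ℓ n b := by
  rw [repU, UniversalEnvelopingAlgebra.lift_ι_apply]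
  change oscLB q ℓ (b ⊗ₜ LaurentPolynomial.T n) + ((0 : ℂ) * ℓ) • 1 = _
  rw [oscLB_T, zero_mul, zero_smul, add_zero]

theorem repU_c : repU q ℓ (UniversalEnvelopingAlgebra.ι ℂ
    (Heisenberg.c (A := LB) (affForm_isAlt q))) = ℓ • 1 := by
  rw [repU, UniversalEnvelopingAlgebra.lift_ι_apply]
  change oscLB q ℓ 0 + ((1 : ℂ) * ℓ) • 1 = _
  rw [map_zero, one_mul, zero_add]

/-- The polynomial `1` satisfies the defining relations of the vacuum vector, so the orbit map `a ↦
a · 1` factors through the vacuum module. -/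
theorem repU_mem {x : UB q} (hx : x ∈ vacIdeal q ℓ) : repU q ℓ x 1 = 0 := by
  induction hx using Submodule.span_induction with
  | mem x hx =>
    rcases hx with ⟨b, n, hn, rfl⟩ | hx
    · rw [repU_bMode]
      obtain ⟨k, rfl⟩ := Int.eq_ofNat_of_zero_le hn
      induction b using Finsupp.induction_linear with
      | zero => simp
      | add b b' hb hb' => rw [map_add, LinearMap.add_apply, hb, hb', add_zero]
      | single r s =>
        rw [show (Finsupp.single r s : ℤ →₀ ℂ) = s • Finsupp.single r 1 by simp, map_smul,
          oscB_single, osc_natCast, LinearMap.smul_apply, ann_one, smul_zero]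
    · obtain rfl := hx
      rw [map_sub, repU_c, AlgHom.commutes, LinearMap.sub_apply, Module.algebraMap_end_apply]
      simp
  | zero => simp
  | add x y _ _ hx hy => rw [map_add, LinearMap.add_apply, hx, hy, add_zero]
  | smul a x _ hx => rw [smul_eq_mul, map_mul, Module.End.mul_apply, hx, map_zero]

/-- The map from the vacuum module to the Fock space. -/
def ofVB : VB q ℓ →ₗ[ℂ] Fock :=
  ((vacIdeal q ℓ).restrictScalars ℂ).liftQ (LinearMap.applyₗ 1 ∘ₗ (repU q ℓ).toLinearMap)
    fun _ hx => repU_mem q ℓ hx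

theorem ofVB_mkQ (a : UB q) : ofVB q ℓ ((vacIdeal q ℓ).mkQ a) = repU q ℓ a 1 := rfl

theorem ofVB_smul (a : UB q) (v : VB q ℓ) : ofVB q ℓ (a • v) = repU q ℓ a (ofVB q ℓ v) := by
  obtain ⟨x, rfl⟩ := (vacIdeal q ℓ).mkQ_surjective v
  rw [← map_smul, ofVB_mkQ, ofVB_mkQ, smul_eq_mul, map_mul, Module.End.mul_apply]

theorem bMode_smul_comm (m n : ℤ) (a b : ℤ →₀ ℂ) (h : m + n + 1 ≠ 0) (v : VB q ℓ) :
    UniversalEnvelopingAlgebra.ι ℂ (bMode q m a) • UniversalEnvelopingAlgebra.ι ℂ (bMode q n b) • v =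
    UniversalEnvelopingAlgebra.ι ℂ (bMode q n b) • UniversalEnvelopingAlgebra.ι ℂ (bMode q m a) • v := by
  have h1 := congrArg (UniversalEnvelopingAlgebra.ι ℂ) (lie_bMode q m n a b)
  rw [if_neg h, zero_smul, map_zero, LieHom.map_lie, LieRing.of_associative_ring_bracket,
    sub_eq_zero] at h1
  rw [← mul_smul, h1, mul_smul]

theorem bMode_smul_bMode (m n : ℤ) (a b : ℤ →₀ ℂ) (v : VB q ℓ) :
    UniversalEnvelopingAlgebra.ι ℂ (bMode q m a) • UniversalEnvelopingAlgebra.ι ℂ (bMode q n b) • v =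
    UniversalEnvelopingAlgebra.ι ℂ (bMode q n b) • UniversalEnvelopingAlgebra.ι ℂ (bMode q m a) • v +
    (if m + n + 1 = 0 then formB q a b else 0) •
      UniversalEnvelopingAlgebra.ι ℂ (Heisenberg.c (A := LB) (affForm_isAlt q)) • v := by
  have h1 := congrArg (UniversalEnvelopingAlgebra.ι ℂ) (lie_bMode q m n a b)
  rw [LieHom.map_lie, LieRing.of_associative_ring_bracket, sub_eq_iff_eq_add', map_smul] at h1
  rw [← mul_smul, h1, add_smul, mul_smul, smul_assoc]

/-- The map from the Fock space to the vacuum module. -/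
def toVB : Fock →ₗ[ℂ] VB q ℓ :=
  LinearMap.applyₗ (vacVec q ℓ) ∘ₗ (commEval (fun a : ℤ × ℕ => Algebra.lsmul ℂ ℂ (VB q ℓ)
    (UniversalEnvelopingAlgebra.ι ℂ (bMode q (-a.2 - 1) (Finsupp.single a.1 1))))
    fun a b => LinearMap.ext fun v => bMode_smul_comm q ℓ _ _ _ _ (by omega) v).toLinearMap

theorem toVB_one : toVB q ℓ 1 = vacVec q ℓ := by
  simp [toVB]

theorem toVB_X_mul (r : ℤ) (k : ℕ) (u : Fock) : toVB q ℓ (X (r, k) * u) =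
    UniversalEnvelopingAlgebra.ι ℂ (bMode q (-k - 1) (Finsupp.single r 1)) • toVB q ℓ u := by
  simp [toVB]

theorem c_smul_mkQ_one : UniversalEnvelopingAlgebra.ι ℂ
    (Heisenberg.c (A := LB) (affForm_isAlt q)) • vacVec q ℓ = ℓ • vacVec q ℓ := by
  rw [← sub_eq_zero, ← algebraMap_smul (UB q) ℓ (vacVec q ℓ), ← sub_smul, vacVec, ← map_smul,
    smul_eq_mul, mul_one, Submodule.mkQ_apply, Submodule.Quotient.mk_eq_zero]
  exact Submodule.subset_span (Or.inr rfl)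

theorem bMode_smul_vacVec (b : ℤ →₀ ℂ) (n : ℤ) (hn : 0 ≤ n) :
    UniversalEnvelopingAlgebra.ι ℂ (bMode q n b) • vacVec q ℓ = 0 := by
  rw [vacVec, ← map_smul, smul_eq_mul, mul_one, Submodule.mkQ_apply,
    Submodule.Quotient.mk_eq_zero]
  exact Submodule.subset_span (Or.inl ⟨b, n, hn, rfl⟩)

/-- The element `c` is central, so its eigenvalue on the vacuum vector spreads to everything the
creation operators produce. -/
theorem c_smul_toVB (u : Fock) : UniversalEnvelopingAlgebra.ι ℂ
    (Heisenberg.c (A := LB) (affForm_isAlt q)) • toVB q ℓ u = ℓ • toVB q ℓ u := by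
  induction u using MvPolynomial.induction_on with
  | C s =>
    rw [show (C s : Fock) = s • 1 by rw [MvPolynomial.smul_eq_C_mul, mul_one], map_smul, toVB_one,
      smul_comm, c_smul_mkQ_one, smul_comm]
  | add u v hu hv => rw [map_add, smul_add, hu, hv, smul_add]
  | mul_X u a hu =>
    have h1 : ⁅Heisenberg.c (A := LB) (affForm_isAlt q),
        bMode q (-a.2 - 1) (Finsupp.single a.1 1)⁆ = 0 := by
      ext <;> simp [Heisenberg.c]
    have h2 := congrArg (UniversalEnvelopingAlgebra.ι ℂ) h1
    rw [map_zero, LieHom.map_lie, LieRing.of_associative_ring_bracket, sub_eq_zero] at h2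
    rw [mul_comm, toVB_X_mul, ← mul_smul, h2, mul_smul, hu, smul_comm]

/-- Creation operators agree by construction. For `n ≥ 0`, both sides kill the vacuum and have the
same commutators with creation operators, since `c` acts as `ℓ` on the image. -/
theorem toVB_osc (r n : ℤ) (u : Fock) : toVB q ℓ (osc (kap q ℓ) r n u) =
    UniversalEnvelopingAlgebra.ι ℂ (bMode q n (Finsupp.single r 1)) • toVB q ℓ u := by
  rcases n with n | n
  · simp only [Int.ofNat_eq_natCast, osc_natCast]
    induction u using MvPolynomial.induction_on with
    | C s =>
      rw [show (C s : Fock) = s • 1 by rw [MvPolynomial.smul_eq_C_mul, mul_one], map_smul,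
        ann_one, smul_zero, map_zero, map_smul, toVB_one, smul_comm,
        bMode_smul_vacVec q ℓ _ _ (by omega), smul_zero]
    | add u v hu hv => rw [map_add, map_add, hu, hv, map_add, smul_add]
    | mul_X u a hu =>
      obtain ⟨s, k⟩ := a
      rw [mul_comm, ← cre_apply, ann_cre, map_add, map_smul, cre_apply, cre_apply, toVB_X_mul,
        toVB_X_mul, hu, bMode_smul_bMode q ℓ (n : ℤ) (-k - 1) (Finsupp.single r 1)
          (Finsupp.single s 1) (toVB q ℓ u), c_smul_toVB, add_comm]
      congr 1
      rw [smul_smul]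
      refine congrArg (fun s : ℂ => s • toVB q ℓ u) ?_
      simp only [show (n : ℤ) + (-k - 1) + 1 = 0 ↔ k = n by omega, kap]
      split_ifs <;> ring
  · rw [show Int.negSucc n = -n - 1 by omega, osc_negSucc, cre_apply, toVB_X_mul]

theorem toVB_oscB (n : ℤ) (b : ℤ →₀ ℂ) (u : Fock) : toVB q ℓ (oscB q ℓ n b u) =
    UniversalEnvelopingAlgebra.ι ℂ (bMode q n b) • toVB q ℓ u := by
  induction b using Finsupp.induction_linear with
  | zero => simp
  | add b b' hb hb' => simp only [map_add, LinearMap.add_apply, hb, hb', add_smul]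
  | single r s =>
    rw [show (Finsupp.single r s : ℤ →₀ ℂ) = s • Finsupp.single r 1 by simp, map_smul, map_smul,
      map_smul, LinearMap.smul_apply, map_smul, oscB_single, toVB_osc, smul_assoc]

theorem toVB_rep (x : BHat q) (u : Fock) : toVB q ℓ (rep q ℓ x u) =
    UniversalEnvelopingAlgebra.ι ℂ x • toVB q ℓ u := by
  have hx : x = Heisenberg.of (A := LB) (affForm_isAlt q) x.vec +
      x.cen • Heisenberg.c (A := LB) (affForm_isAlt q) := by
    ext <;> simp [Heisenberg.of, Heisenberg.c]
  have h1 : ∀ y : LB, toVB q ℓ (oscLB q ℓ y u) =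
      UniversalEnvelopingAlgebra.ι ℂ (Heisenberg.of (A := LB) (affForm_isAlt q) y) •
        toVB q ℓ u := by
    intro y
    induction y using LB_induction with
    | h0 => simp
    | hadd y z hy hz => simp only [map_add, LinearMap.add_apply, hy, hz, add_smul]
    | hsmul s y hy => rw [map_smul, LinearMap.smul_apply, map_smul, hy, map_smul, map_smul,
        smul_assoc]
    | h r n => rw [oscLB_T, toVB_oscB]; rfl
  change toVB q ℓ ((oscLB q ℓ x.vec + (x.cen * ℓ) • 1) u) = _
  conv_rhs => rw [hx]
  rw [LinearMap.add_apply, map_add, h1, map_add, add_smul, map_smul, smul_assoc, c_smul_toVB,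
    LinearMap.smul_apply, map_smul, mul_smul, Module.End.one_apply]

theorem toVB_repU (a : UB q) (u : Fock) : toVB q ℓ (repU q ℓ a u) = a • toVB q ℓ u := by
  -- The elements `a` with the intertwining property form a subalgebra containing the image of the
  -- Lie algebra. By the universal property, the inclusion of this subalgebra has a section on the
  -- whole enveloping algebra.
  let S : Subalgebra ℂ (UB q) :=
    { carrier := {a | ∀ u : Fock, toVB q ℓ (repU q ℓ a u) = a • toVB q ℓ u}
      mul_mem' := fun {a b} ha hb u => by
        rw [map_mul, Module.End.mul_apply, ha, hb, mul_smul]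
      add_mem' := fun {a b} ha hb u => by
        rw [map_add, LinearMap.add_apply, map_add, ha, hb, add_smul]
      algebraMap_mem' := fun s u => by
        rw [AlgHom.commutes, Module.algebraMap_end_apply, map_smul, algebraMap_smul] }
  let j : BHat q →ₗ⁅ℂ⁆ S :=
    { toFun := fun x => ⟨UniversalEnvelopingAlgebra.ι ℂ x, fun u => by
        rw [repU, UniversalEnvelopingAlgebra.lift_ι_apply, toVB_rep]⟩
      map_add' := fun x y => Subtype.ext (map_add _ x y)
      map_smul' := fun s x => Subtype.ext (map_smul _ s x)
      map_lie' := fun {x y} => Subtype.ext (LieHom.map_lie _ x y) }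
  have h : S.val.comp (UniversalEnvelopingAlgebra.lift ℂ j : UB q →ₐ[ℂ] S) = AlgHom.id ℂ (UB q) := by
    refine UniversalEnvelopingAlgebra.hom_ext (R := ℂ) (L := BHat q) ?_
    ext x
    simp [j]
  have h2 := (UniversalEnvelopingAlgebra.lift ℂ j a : S).2 u
  rwa [show ((UniversalEnvelopingAlgebra.lift ℂ j a : S) : UB q) = a from
    DFunLike.congr_fun h a] at h2

/-- The Fock space and the vacuum module are isomorphic. -/
def equivVB : Fock ≃ₗ[ℂ] VB q ℓ :=
  LinearEquiv.ofLinearMap (toVB q ℓ) (ofVB q ℓ)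
    (LinearMap.ext fun v => by
      obtain ⟨a, rfl⟩ := (vacIdeal q ℓ).mkQ_surjective v
      rw [LinearMap.comp_apply, ofVB_mkQ, toVB_repU, toVB_one, vacVec, ← map_smul, smul_eq_mul,
        mul_one, LinearMap.id_apply])
    (LinearMap.ext fun u => by
      rw [LinearMap.comp_apply, LinearMap.id_apply]
      induction u using MvPolynomial.induction_on with
      | C s =>
        rw [show (C s : Fock) = s • 1 by rw [MvPolynomial.smul_eq_C_mul, mul_one], map_smul,
          map_smul, toVB_one, vacVec, ofVB_mkQ, map_one (repU q ℓ)]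
        rfl
      | add u v hu hv => rw [map_add, map_add, hu, hv]
      | mul_X u a hu =>
        obtain ⟨r, k⟩ := a
        rw [mul_comm, toVB_X_mul, ofVB_smul, repU_bMode, oscB_single, hu, osc_negSucc, cre_apply])

theorem equivVB_apply (u : Fock) : equivVB q ℓ u = toVB q ℓ u := rfl

end Fock

end QHeis

namespace QHeis

open VertexOperator (ncoeff)

attribute [local instance 100] LieRing.ofAssociativeRing

/-! ### The Heisenberg vertex algebra -/

open MvPolynomial (X C)

variable (q ℓ : ℂ)

/-- The vertex algebra structure on the vacuum module. -/
def heisVA : VertexAlgebra (VB q ℓ) :=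
  (Fock.vertexAlgebra (kap q ℓ) (kap_skew q ℓ)).transport (Fock.equivVB q ℓ)

theorem Fock.equivVB_symm_ofB (b : ℤ →₀ ℂ) :
    (Fock.equivVB q ℓ).symm (ofB q ℓ b) = Fock.oscB q ℓ (-1) b 1 := by
  rw [LinearEquiv.symm_apply_eq, Fock.equivVB_apply, Fock.toVB_oscB, Fock.toVB_one, ofB]

theorem Fock.mode_oscB (b : ℤ →₀ ℂ) (n : ℤ) (v : Fock) :
    Fock.mode (kap q ℓ) (Fock.oscB q ℓ (-1) b 1) n v = Fock.oscB q ℓ n b v := by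
  induction b using Finsupp.induction_linear with
  | zero => simp
  | add b b' hb hb' =>
    rw [map_add, LinearMap.add_apply, map_add, Pi.add_apply, LinearMap.add_apply, hb, hb', map_add,
      LinearMap.add_apply]
  | single r s =>
    have h : Fock.osc (kap q ℓ) r (-1) 1 = X (r, 0) := by
      have := Fock.osc_negSucc (kap q ℓ) r 0
      rw [Nat.cast_zero, neg_zero, zero_sub] at this
      rw [this, Fock.cre_apply, mul_one]
    rw [show (Finsupp.single r s : ℤ →₀ ℂ) = s • Finsupp.single r 1 by simp, map_smul, map_smul,
      LinearMap.smul_apply, map_smul, Pi.smul_apply, LinearMap.smul_apply, Fock.oscB_single,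
      Fock.oscB_single, h, Fock.mode_X, LinearMap.smul_apply]

theorem isHeisenbergVA_heisVA : IsHeisenbergVA (heisVA q ℓ) where
  vac_eq := Fock.toVB_one q ℓ
  Y_ofB b n v := by
    rw [heisVA, VertexAlgebra.transport_ncoeff, Fock.equivVB_symm_ofB]
    change Fock.toVB q ℓ (Fock.mode (kap q ℓ) _ n _) = _
    rw [Fock.mode_oscB, Fock.toVB_oscB]
    exact congrArg _ ((Fock.equivVB q ℓ).apply_symm_apply v)

variable {q ℓ}

/-- The Borcherds identity with its parameter `m` equal to `0`, where the left side has a single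
term. -/
theorem VertexAlgebra.ncoeff_ncoeff {V : Type*} [AddCommGroup V] [Module ℂ V] (𝒱 : VertexAlgebra V)
    (u v w : V) (l n : ℤ) : ncoeff (𝒱.Y (ncoeff (𝒱.Y u) l v)) n w =
      ∑ᶠ i : ℕ, ((-1) ^ i * Ring.choose l i) •
        (ncoeff (𝒱.Y u) (l - i) (ncoeff (𝒱.Y v) (n + i) w)
          - Int.negOnePow l • ncoeff (𝒱.Y v) (n + l - i) (ncoeff (𝒱.Y u) i w)) := by
  have h := 𝒱.borcherds u v w l 0 n
  rw [finsum_eq_single _ 0] at h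
  · simpa using h
  · intro i hi
    obtain ⟨j, rfl⟩ := Nat.exists_eq_succ_of_ne_zero hi
    simp [Ring.choose_zero_succ]

theorem Fock.toVB_surjective : Function.Surjective (Fock.toVB q ℓ) := (Fock.equivVB q ℓ).surjective

/-- Polynomial induction transferred along the isomorphism with the Fock space: creation operators
generate the module from the vacuum. -/
theorem VB_induction {P : VB q ℓ → Prop} (h1 : P (vacVec q ℓ))
    (hadd : ∀ u v, P u → P v → P (u + v)) (hsmul : ∀ (s : ℂ) u, P u → P (s • u))
    (h : ∀ (r : ℤ) (k : ℕ) u, P u → P (UniversalEnvelopingAlgebra.ι ℂ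
      (bMode q (-k - 1) (Finsupp.single r 1)) • u)) (u : VB q ℓ) : P u := by
  obtain ⟨u, rfl⟩ := Fock.toVB_surjective u
  induction u using MvPolynomial.induction_on with
  | C s =>
    rw [show (C s : Fock) = s • 1 by rw [MvPolynomial.smul_eq_C_mul, mul_one], map_smul,
      Fock.toVB_one]
    exact hsmul s _ h1
  | add u v hu hv => rw [map_add]; exact hadd _ _ hu hv
  | mul_X u a hu =>
    obtain ⟨r, k⟩ := a
    rw [mul_comm, Fock.toVB_X_mul]
    exact h r k _ hu

/-- A creation operator is a mode of the field of some `b ∈ B`, so `ncoeff_ncoeff` expresses the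
modes of `b_{-k-1} u` through prescribed operators and the modes of `u`. -/
theorem IsHeisenbergVA.ext {𝒱 𝒱' : VertexAlgebra (VB q ℓ)} (h : IsHeisenbergVA 𝒱)
    (h' : IsHeisenbergVA 𝒱') : 𝒱 = 𝒱' := by
  have key : ∀ u n v, ncoeff (𝒱.Y u) n v = ncoeff (𝒱'.Y u) n v := by
    intro u
    induction u using VB_induction with
    | h1 =>
      intro n v
      conv_lhs => rw [← h.vac_eq, 𝒱.vacuum]
      rw [← h'.vac_eq, 𝒱'.vacuum]
    | hadd u v hu hv =>
      intro n w
      rw [map_add, map_add, map_add, map_add, Pi.add_apply, Pi.add_apply, LinearMap.add_apply,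
        LinearMap.add_apply, hu, hv]
    | hsmul s u hu =>
      intro n w
      rw [map_smul, map_smul, map_smul, map_smul, Pi.smul_apply, Pi.smul_apply,
        LinearMap.smul_apply, LinearMap.smul_apply, hu]
    | h r k u hu =>
      intro n w
      rw [← h.Y_ofB, VertexAlgebra.ncoeff_ncoeff, h.Y_ofB, ← h'.Y_ofB,
        VertexAlgebra.ncoeff_ncoeff]
      simp only [h.Y_ofB, h'.Y_ofB, hu]
  refine VertexAlgebra.ext ?_ (h.vac_eq.trans h'.vac_eq.symm)
  refine LinearMap.ext fun u => cf_ext fun n v => ?_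
  rw [cf_eq_ncoeff, cf_eq_ncoeff, key]

/-! ### The automorphisms `ρ_m` -/

theorem shiftB_zero (b : ℤ →₀ ℂ) : shiftB 0 b = b := by
  simp only [shiftB, add_zero]
  exact Finsupp.mapDomain_id

theorem shiftB_shiftB (m n : ℤ) (b : ℤ →₀ ℂ) : shiftB m (shiftB n b) = shiftB (n + m) b := by
  simp only [shiftB, Finsupp.lmapDomain_apply, ← Finsupp.mapDomain_comp]
  congr 1
  funext r
  simp [add_assoc]

theorem ρ_bMode_smul (m n : ℤ) (b : ℤ →₀ ℂ) (v : VB q ℓ) :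
    ρ q ℓ m (UniversalEnvelopingAlgebra.ι ℂ (bMode q n b) • v) =
      UniversalEnvelopingAlgebra.ι ℂ (bMode q n (shiftB m b)) • ρ q ℓ m v := by
  rw [ρ_smul, shiftUB_ι, shiftBHat_bMode]

theorem ρ_ρ_neg (m : ℤ) (v : VB q ℓ) : ρ q ℓ m (ρ q ℓ (-m) v) = v := by
  induction v using VB_induction with
  | h1 => rw [ρ_vacVec, ρ_vacVec]
  | hadd u v hu hv => rw [map_add, map_add, hu, hv]
  | hsmul s u hu => rw [map_smul, map_smul, hu]
  | h r k u hu => rw [ρ_bMode_smul, ρ_bMode_smul, hu, shiftB_shiftB, neg_add_cancel, shiftB_zero]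

/-- The map `ρ_m` as a linear equivalence. -/
def ρEquiv (q ℓ : ℂ) (m : ℤ) : VB q ℓ ≃ₗ[ℂ] VB q ℓ :=
  LinearEquiv.ofLinearMap (ρ q ℓ m) (ρ q ℓ (-m)) (LinearMap.ext (ρ_ρ_neg m))
    (LinearMap.ext fun v => by simpa using ρ_ρ_neg (-m) v)

theorem IsHeisenbergVA.isAutomorphism {𝒱 : VertexAlgebra (VB q ℓ)} (h : IsHeisenbergVA 𝒱) (m : ℤ) :
    𝒱.IsAutomorphism (ρ q ℓ m) := by
  -- The structure transported along `ρ_m` again has the prescribed vacuum and generating fields. By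
  -- uniqueness it is the original one, which says that `ρ_m` is an automorphism.
  have h' : IsHeisenbergVA (𝒱.transport (ρEquiv q ℓ m)) :=
    { vac_eq := by
        change ρ q ℓ m 𝒱.vac = _
        rw [h.vac_eq, ρ_vacVec]
      Y_ofB := fun b n v => by
        rw [VertexAlgebra.transport_ncoeff]
        change ρ q ℓ m (ncoeff (𝒱.Y (ρ q ℓ (-m) (ofB q ℓ b))) n (ρ q ℓ (-m) v)) = _
        rw [ofB, ρ_bMode_smul, ρ_vacVec, ← ofB, h.Y_ofB, ρ_bMode_smul, ρ_ρ_neg, shiftB_shiftB,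
          neg_add_cancel, shiftB_zero] }
  have e := h'.ext h
  refine ⟨(ρEquiv q ℓ m).bijective, by rw [h.vac_eq, ρ_vacVec], fun u v n => ?_⟩
  have h2 := VertexAlgebra.transport_ncoeff 𝒱 (ρEquiv q ℓ m) (ρ q ℓ m u) (ρ q ℓ m v) n
  rw [e] at h2
  change _ = ρ q ℓ m (ncoeff (𝒱.Y ((ρEquiv q ℓ m).symm (ρEquiv q ℓ m u))) n
    ((ρEquiv q ℓ m).symm (ρEquiv q ℓ m v))) at h2
  rw [LinearEquiv.symm_apply_apply, LinearEquiv.symm_apply_apply] at h2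
  exact h2.symm

end QHeis

namespace QHeis

open VertexOperator (ncoeff)

/-! ### Laurent series with coefficients in a vector space -/

/-- The space `V((z))`. -/
abbrev HM (V : Type*) [AddCommGroup V] [Module ℂ V] := HahnModule ℤ ℂ V

section

variable {V V' : Type*} [AddCommGroup V] [Module ℂ V] [AddCommGroup V'] [Module ℂ V']

/-- The coefficients of a Laurent series. -/
def hc : HM V →ₗ[ℂ] ℤ → V where
  toFun x := ((HahnModule.of ℂ).symm x).coeff
  map_add' _ _ := rfl
  map_smul' _ _ := rfl

theorem hc_ext {x y : HM V} (h : ∀ n, hc x n = hc y n) : x = y :=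
  HahnModule.ext _ _ (funext h)

theorem hc_add (x y : HM V) (n : ℤ) : hc (x + y) n = hc x n + hc y n := rfl

theorem hc_base_smul (s : ℂ) (x : HM V) (n : ℤ) : hc (s • x) n = s • hc x n := rfl

theorem hc_apply_eq_cf {W : Type*} [AddCommGroup W] [Module ℂ W] (A : VertexOperator ℂ W) (w : W)
    (n : ℤ) : hc (A w) n = cf A n w := rfl

theorem isPWO_of_eventually {V : Type*} [AddCommGroup V] {f : ℤ → V} (hf : ∀ᶠ n in atBot, f n = 0) :
    (Function.support f).IsPWO := by
  obtain ⟨N, hN⟩ := eventually_atBot.mp hf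
  have h : BddBelow (Function.support f) := ⟨N, fun n hn => by
    by_contra hlt
    exact hn (hN n (by omega))⟩
  exact h.isWF.isPWO

theorem hc_eventually (x : HM V) : ∀ᶠ n in atBot, hc x n = 0 := by
  refine eventually_atBot.mpr ⟨((HahnModule.of ℂ).symm x).order - 1, fun n hn => ?_⟩
  exact HahnSeries.coeff_eq_zero_of_lt_order (by omega)

/-- The Laurent series with given coefficients. -/
def mkH (f : ℤ → V) (hf : ∀ᶠ n in atBot, f n = 0) : HM V :=
  HahnModule.of ℂ ⟨f, isPWO_of_eventually hf⟩

theorem hc_mkH (f : ℤ → V) (hf : ∀ᶠ n in atBot, f n = 0) (n : ℤ) : hc (mkH f hf) n = f n := rfl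

theorem hc_sub_eventually (x : HM V) (n : ℤ) : ∀ᶠ i : ℕ in atTop, hc x (n - i) = 0 :=
  (tendsto_sub_natCast n).eventually (hc_eventually x)

/-- Rewrites the product of Hahn series as a sum over `ℕ`, starting at a lower bound `-a` of the
exponents of `s`, so that the lemmas on locally finite sums apply. -/
theorem hc_smul (s : LaurentSeries ℂ) (a : ℤ) (hs : ∀ e < -a, s.coeff e = 0) (x : HM V) (n : ℤ) :
    hc (s • x) n = ∑ᶠ i : ℕ, s.coeff (i - a) • hc x (n + a - i) := by
  change ((HahnModule.of ℂ).symm (s • x)).coeff n = _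
  rw [HahnModule.coeff_smul]
  set S := VAddAntidiagonal n (Set.VAddAntidiagonal.finite_of_isPWO s.isPWO_support
    ((HahnModule.of ℂ).symm x).isPWO_support n) with hS
  have hmem : ∀ p ∈ S, -a ≤ p.1 ∧ p.1 + p.2 = n := by
    intro p hp
    rw [hS, mem_vaddAntidiagonal] at hp
    refine ⟨?_, by simpa [vadd_eq_add] using hp.2.2⟩
    by_contra hlt
    exact hp.1 (hs p.1 (by omega))
  rw [finsum_eq_sum_of_support_subset (s := S.image fun p => (p.1 + a).toNat), sum_image]
  · refine sum_congr rfl fun p hp => ?_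
    obtain ⟨h1, h2⟩ := hmem p hp
    rw [show (((p.1 + a).toNat : ℤ) - a) = p.1 by omega,
      show n + a - ((p.1 + a).toNat : ℤ) = p.2 by omega]
    rfl
  · intro p hp p' hp' h
    obtain ⟨h1, h2⟩ := hmem p hp
    obtain ⟨h1', h2'⟩ := hmem p' hp'
    simp only at h
    exact Prod.ext (by omega) (by omega)
  · intro i hi
    rw [Function.mem_support] at hi
    rw [coe_image, Set.mem_image]
    refine ⟨(i - a, n + a - i), ?_, by simp⟩
    rw [mem_coe, hS, mem_vaddAntidiagonal]
    refine ⟨fun h => hi ?_, fun h => hi ?_, by simp [vadd_eq_add]⟩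
    · change s.coeff (i - a) = 0 at h
      rw [h, zero_smul]
    · change hc x (n + a - i) = 0 at h
      rw [h, smul_zero]

theorem hc_powerSeries_smul (p : PowerSeries ℂ) (x : HM V) (n : ℤ) :
    hc (HahnSeries.ofPowerSeries ℤ ℂ p • x) n = ∑ᶠ i : ℕ, PowerSeries.coeff i p • hc x (n - i) := by
  rw [hc_smul _ 0]
  · simp only [sub_zero, add_zero, HahnSeries.ofPowerSeries_apply_coeff]
  · intro e he
    rw [HahnSeries.ofPowerSeries_apply, HahnSeries.embDomain_of_notMem_range]
    rintro ⟨k, hk⟩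
    have : (k : ℤ) = e := hk
    omega

theorem hc_single_smul (e : ℤ) (s : ℂ) (x : HM V) (n : ℤ) :
    hc ((HahnSeries.single e s : LaurentSeries ℂ) • x) n = s • hc x (n - e) := by
  rw [hc_smul _ (-e), finsum_eq_single _ 0]
  · simp [sub_eq_add_neg]
  · intro i hi
    rw [HahnSeries.coeff_single_of_ne (by omega), zero_smul]
  · intro i hi
    exact HahnSeries.coeff_single_of_ne (by omega)

/-- The action of the operator-valued power series `∑ z^i D_i`. -/
def opSeries (D : ℕ → V →ₗ[ℂ] V') : HM V →ₗ[ℂ] HM V' where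
  toFun x := mkH (fun n => ∑ᶠ i : ℕ, D i (hc x (n - i))) (by
    obtain ⟨N, hN⟩ := eventually_atBot.mp (hc_eventually x)
    refine eventually_atBot.mpr ⟨N, fun n hn => ?_⟩
    refine finsum_eq_zero_of_forall_eq_zero fun i => ?_
    rw [hN _ (by omega), map_zero])
  map_add' x y := by
    refine hc_ext fun n => ?_
    rw [hc_add, hc_mkH, hc_mkH, hc_mkH, ← finsum_add_eventually]
    · simp only [hc_add, map_add]
    all_goals
      filter_upwards [hc_sub_eventually x n, hc_sub_eventually y n] with i h1 h2
      simp [h1, h2]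
  map_smul' s x := by
    refine hc_ext fun n => ?_
    rw [RingHom.id_apply, hc_base_smul, hc_mkH, hc_mkH, smul_finsum_eventually]
    · simp only [hc_base_smul, map_smul]
    · filter_upwards [hc_sub_eventually x n] with i h1
      rw [h1, map_zero]

theorem hc_opSeries (D : ℕ → V →ₗ[ℂ] V') (x : HM V) (n : ℤ) :
    hc (opSeries D x) n = ∑ᶠ i : ℕ, D i (hc x (n - i)) := rfl

theorem opSeries_eventually (D : ℕ → V →ₗ[ℂ] V') (x : HM V) (n : ℤ) :
    ∀ᶠ i : ℕ in atTop, D i (hc x (n - i)) = 0 := by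
  filter_upwards [hc_sub_eventually x n] with i h1
  rw [h1, map_zero]

theorem vanishesFar_hc {V' : Type*} [AddCommGroup V'] (x : HM V) (n : ℤ) (F : ℕ → ℕ → V → V')
    (hF : ∀ i j, F i j 0 = 0) : VanishesFar fun i j => F i j (hc x (n - i - j)) := by
  obtain ⟨N, hN⟩ := eventually_atBot.mp (hc_eventually x)
  refine ⟨(n - N).toNat, fun i j h => ?_⟩
  simp only [hN (n - i - j) (by omega), hF]

theorem opSeries_opSeries {V'' : Type*} [AddCommGroup V''] [Module ℂ V''] (D : ℕ → V' →ₗ[ℂ] V'')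
    (D' : ℕ → V →ₗ[ℂ] V') (x : HM V) : opSeries D (opSeries D' x) =
      opSeries (fun n => ∑ p ∈ antidiagonal n, D p.1 ∘ₗ D' p.2) x := by
  refine hc_ext fun n => ?_
  simp only [hc_opSeries]
  have h := vanishesFar_hc x n (fun i j v => D i (D' j v)) (by simp)
  rw [finsum_congr fun i => map_finsum_eventually (D i) (opSeries_eventually D' x (n - i)),
    h.finsum_antidiagonal]
  refine finsum_congr fun m => ?_
  rw [LinearMap.sum_apply]
  refine sum_congr rfl fun p hp => ?_
  rw [HasAntidiagonal.mem_antidiagonal] at hp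
  rw [← hp, LinearMap.comp_apply, Nat.cast_add, sub_sub]

/-- An operator-valued power series is linear over scalar Laurent series. Rational coefficients can
therefore be pulled through all the operations used below. -/
theorem opSeries_smul (D : ℕ → V →ₗ[ℂ] V') (s : LaurentSeries ℂ) (x : HM V) :
    opSeries D (s • x) = s • opSeries D x := by
  obtain ⟨a, ha⟩ : ∃ a : ℤ, ∀ e < -a, s.coeff e = 0 :=
    ⟨-s.order, fun e he => HahnSeries.coeff_eq_zero_of_lt_order (by omega)⟩
  refine hc_ext fun n => ?_
  rw [hc_smul s a ha, hc_opSeries]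
  simp only [hc_smul s a ha, hc_opSeries]
  have h := vanishesFar_hc x (n + a) (fun i j v => s.coeff (j - a) • D i v) (by simp)
  have e : ∀ i j : ℕ, n - (i : ℤ) + a - j = n + a - i - j := by intros; ring
  simp only [e]
  refine (finsum_congr fun i => ?_).trans (h.finsum_comm.trans (finsum_congr fun j => ?_))
  · rw [map_finsum_eventually (D i)]
    · simp only [map_smul]
    · filter_upwards [hc_sub_eventually x (n + a - i)] with j hj
      rw [hj, smul_zero]
  · rw [smul_finsum_eventually _ (opSeries_eventually D x _)]
    refine finsum_congr fun i => ?_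
    rw [sub_right_comm]

/-- The coefficientwise action of a linear map. -/
def hmap (L : V →ₗ[ℂ] V') : HM V →ₗ[ℂ] HM V' := opSeries fun i => if i = 0 then L else 0

theorem hc_hmap (L : V →ₗ[ℂ] V') (x : HM V) (n : ℤ) : hc (hmap L x) n = L (hc x n) := by
  rw [hmap, hc_opSeries, finsum_eq_single _ 0]
  · simp
  · intro i hi
    rw [if_neg hi, LinearMap.zero_apply]

theorem hmap_smul (L : V →ₗ[ℂ] V') (s : LaurentSeries ℂ) (x : HM V) :
    hmap L (s • x) = s • hmap L x := opSeries_smul _ s x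

/-- The shift of the coefficients by `e`. -/
def shiftH (e : ℤ) : HM V →ₗ[ℂ] HM V where
  toFun x := mkH (fun n => hc x (n - e))
    ((tendsto_atBot_add_const_right atBot (-e) tendsto_id).eventually (hc_eventually x))
  map_add' _ _ := rfl
  map_smul' _ _ := rfl

theorem hc_shiftH (e : ℤ) (x : HM V) (n : ℤ) : hc (shiftH e x) n = hc x (n - e) := rfl

end

end QHeis

namespace QHeis

open VertexOperator (ncoeff)

/-! ### Exponential series and the two expansions of rational functions -/

/-- The series `e^{m z}`. -/
def expS (m : ℤ) : PowerSeries ℂ := PowerSeries.mk (expCoeff m)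

theorem coeff_expS (m : ℤ) (n : ℕ) : PowerSeries.coeff n (expS m) = expCoeff m n :=
  PowerSeries.coeff_mk _ _

theorem expS_eq_rescale (m : ℤ) : expS m = PowerSeries.rescale (m : ℂ) (PowerSeries.exp ℂ) := by
  ext n
  rw [coeff_expS, PowerSeries.coeff_rescale, PowerSeries.coeff_exp, expCoeff]
  simp [div_eq_mul_inv]

theorem expS_add (a b : ℤ) : expS (a + b) = expS a * expS b := by
  rw [expS_eq_rescale, expS_eq_rescale, expS_eq_rescale, PowerSeries.exp_mul_exp_eq_exp_add]
  push_cast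
  rfl

theorem expS_zero : expS 0 = 1 := by
  ext n
  rw [coeff_expS, PowerSeries.coeff_one, expCoeff]
  rcases n with _ | n <;> simp

theorem sum_expCoeff (a b : ℤ) (n : ℕ) :
    ∑ p ∈ antidiagonal n, expCoeff a p.1 * expCoeff b p.2 = expCoeff (a + b) n := by
  simp only [← coeff_expS]
  rw [expS_add, PowerSeries.coeff_mul]

/-- The series `e^{m z}` as a Laurent series. -/
def expL (m : ℤ) : LaurentSeries ℂ := HahnSeries.ofPowerSeries ℤ ℂ (expS m)

theorem expL_add (a b : ℤ) : expL (a + b) = expL a * expL b := by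
  rw [expL, expS_add, map_mul]; rfl

theorem expL_zero : expL 0 = 1 := by
  rw [expL, expS_zero, map_one]

theorem expL_mul_neg (a : ℤ) : expL a * expL (-a) = 1 := by
  rw [← expL_add, add_neg_cancel, expL_zero]

theorem expL_ne_zero (a : ℤ) : expL a ≠ 0 := left_ne_zero_of_mul_eq_one (expL_mul_neg a)

theorem ofPowerSeries_coeff_of_neg (p : PowerSeries ℂ) {n : ℤ} (hn : n < 0) :
    (HahnSeries.ofPowerSeries ℤ ℂ p).coeff n = 0 := by
  rw [HahnSeries.ofPowerSeries_apply, HahnSeries.embDomain_of_notMem_range]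
  rintro ⟨k, hk⟩
  have : (k : ℤ) = n := hk
  omega

theorem expL_coeff (m : ℤ) (n : ℤ) :
    (expL m).coeff n = if 0 ≤ n then expCoeff m n.toNat else 0 := by
  split_ifs with hn
  · obtain ⟨k, rfl⟩ := Int.eq_ofNat_of_zero_le hn
    rw [expL, HahnSeries.ofPowerSeries_apply_coeff, coeff_expS]
    rfl
  · exact ofPowerSeries_coeff_of_neg _ (by omega)

/-! ### The Euler derivation and the reflection -/

/-- When the supports of `f'` and `g'` lie in those of `f` and `g`, the product can be summed over
the index set of `f * g`. This gives a common index set in the proofs that `euler` is a derivation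
and `reflect` is multiplicative. -/
theorem laurent_mul_coeff_congr {f g f' g' : LaurentSeries ℂ}
    (hf : ∀ n, f.coeff n = 0 → f'.coeff n = 0) (hg : ∀ n, g.coeff n = 0 → g'.coeff n = 0) (n : ℤ) :
    (f' * g').coeff n = ∑ ij ∈ Finset.antidiagonal f.isPWO_support g.isPWO_support n,
      f'.coeff ij.1 * g'.coeff ij.2 := by
  rw [HahnSeries.coeff_mul_left' f.isPWO_support (fun m hm h => hm (hf m h))]
  refine sum_subset (fun p hp => ?_) fun p hp hp' => ?_
  · rw [Finset.mem_antidiagonal] at hp ⊢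
    exact ⟨hp.1, fun h => hp.2.1 (hg _ h), hp.2.2⟩
  · rw [Finset.mem_antidiagonal] at hp hp'
    have : g'.coeff p.2 = 0 := by
      by_contra h
      exact hp' ⟨hp.1, h, hp.2.2⟩
    rw [this, mul_zero]

/-- The operator `z ∂_z`. -/
def euler : LaurentSeries ℂ →+ LaurentSeries ℂ where
  toFun f := ⟨fun n => n * f.coeff n, f.isPWO_support.mono fun n hn h => hn (by
    change (n : ℂ) * f.coeff n = 0
    rw [h, mul_zero])⟩
  map_zero' := by
    ext n
    exact mul_zero _
  map_add' f g := by
    ext n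
    exact mul_add _ _ _

theorem euler_coeff (f : LaurentSeries ℂ) (n : ℤ) : (euler f).coeff n = n * f.coeff n := rfl

theorem euler_mul (f g : LaurentSeries ℂ) : euler (f * g) = euler f * g + f * euler g := by
  ext n
  have h0 : ∀ f : LaurentSeries ℂ, ∀ n, f.coeff n = 0 → (euler f).coeff n = 0 := fun f n h => by
    rw [euler_coeff, h, mul_zero]
  rw [HahnSeries.coeff_add, euler_coeff, laurent_mul_coeff_congr (f := f) (g := g) (h0 f) (fun _ => id),
    laurent_mul_coeff_congr (f := f) (g := g) (fun _ => id) (h0 g), HahnSeries.coeff_mul,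
    ← sum_add_distrib, mul_sum]
  refine sum_congr rfl fun p hp => ?_
  rw [Finset.mem_antidiagonal] at hp
  rw [euler_coeff, euler_coeff, ← hp.2.2]
  push_cast
  ring

/-- The reflection `z ↦ -z`. -/
def reflect : LaurentSeries ℂ →+* LaurentSeries ℂ where
  toFun f := ⟨fun n => (-1) ^ n * f.coeff n, f.isPWO_support.mono fun n hn h => hn (by
    change (-1 : ℂ) ^ n * f.coeff n = 0
    rw [h, mul_zero])⟩
  map_zero' := by
    ext n
    exact mul_zero _
  map_add' f g := by
    ext n
    exact mul_add _ _ _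
  map_one' := by
    ext n
    change (-1 : ℂ) ^ n * (1 : LaurentSeries ℂ).coeff n = _
    rw [HahnSeries.coeff_one]
    split_ifs with h
    · rw [h, zpow_zero, one_mul]
    · rw [mul_zero]
  map_mul' f g := by
    ext n
    have h0 : ∀ f : LaurentSeries ℂ, ∀ n, f.coeff n = 0 → (-1 : ℂ) ^ n * f.coeff n = 0 := by
      intro f n h
      rw [h, mul_zero]
    refine Eq.trans ?_ (laurent_mul_coeff_congr (f := f) (g := g) (h0 f) (h0 g) n).symm
    change (-1 : ℂ) ^ n * (f * g).coeff n = _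
    rw [HahnSeries.coeff_mul, mul_sum]
    refine sum_congr rfl fun p hp => ?_
    rw [Finset.mem_antidiagonal] at hp
    change _ = (-1 : ℂ) ^ p.1 * f.coeff p.1 * ((-1 : ℂ) ^ p.2 * g.coeff p.2)
    rw [← hp.2.2, zpow_add₀ (by norm_num)]
    ring

theorem reflect_coeff (f : LaurentSeries ℂ) (n : ℤ) :
    (reflect f).coeff n = (-1) ^ n * f.coeff n := rfl

theorem reflect_expL (m : ℤ) : reflect (expL m) = expL (-m) := by
  ext n
  rw [reflect_coeff, expL_coeff, expL_coeff]
  split_ifs with hn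
  · obtain ⟨k, rfl⟩ := Int.eq_ofNat_of_zero_le hn
    simp only [expCoeff, Int.toNat_natCast]
    push_cast
    rw [zpow_natCast, neg_pow (m : ℂ)]
    ring
  · rw [mul_zero]

theorem reflect_C (s : ℂ) : reflect (HahnSeries.C s) = HahnSeries.C s := by
  ext n
  rw [reflect_coeff, HahnSeries.C_apply, HahnSeries.coeff_single]
  split_ifs with h
  · rw [h, zpow_zero, one_mul]
  · rw [mul_zero]

/-! ### Simultaneous rational expansions -/

/-- Evaluation of polynomials at a Laurent series. -/
def evalL (τ : LaurentSeries ℂ) : Polynomial ℂ →+* LaurentSeries ℂ :=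
  Polynomial.eval₂RingHom HahnSeries.C τ

theorem evalL_X (τ : LaurentSeries ℂ) : evalL τ Polynomial.X = τ := Polynomial.eval₂_X _ _

theorem evalL_C (τ : LaurentSeries ℂ) (s : ℂ) : evalL τ (Polynomial.C s) = HahnSeries.C s :=
  Polynomial.eval₂_C _ _

/-- The variable `t`. -/
abbrev tvar : LaurentSeries ℂ := HahnSeries.single 1 1

/-- The operator `-∂_z`. -/
def negDeriv : LaurentSeries ℂ →+ LaurentSeries ℂ :=
  (AddMonoidHom.mulLeft (HahnSeries.single (-1) (-1) : LaurentSeries ℂ)).comp euler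

theorem negDeriv_apply (f : LaurentSeries ℂ) :
    negDeriv f = HahnSeries.single (-1) (-1) * euler f := rfl

theorem negDeriv_coeff (f : LaurentSeries ℂ) (n : ℤ) :
    (negDeriv f).coeff n = -((n + 1) * f.coeff (n + 1)) := by
  rw [negDeriv_apply, HahnSeries.coeff_single_mul, euler_coeff, sub_neg_eq_add]
  push_cast
  ring

theorem negDeriv_mul (f g : LaurentSeries ℂ) :
    negDeriv (f * g) = negDeriv f * g + f * negDeriv g := by
  simp only [negDeriv_apply, euler_mul]
  ring

theorem euler_tvar : euler tvar = tvar := by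
  ext n
  rw [euler_coeff, HahnSeries.coeff_single]
  split_ifs with h
  · rw [h]; simp
  · rw [mul_zero]

theorem negDeriv_expL : negDeriv (expL (-1)) = expL (-1) := by
  ext n
  rw [negDeriv_coeff, expL_coeff, expL_coeff]
  rcases lt_trichotomy n (-1) with h | rfl | h
  · rw [if_neg (by omega), if_neg (by omega), mul_zero, neg_zero]
  · simp
  · obtain ⟨k, rfl⟩ := Int.eq_ofNat_of_zero_le (show 0 ≤ n by omega)
    rw [if_pos (by omega), if_pos (by omega), show ((k : ℤ) + 1).toNat = k + 1 by omega,
      Int.toNat_natCast, expCoeff, expCoeff, Nat.factorial_succ]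
    push_cast
    have h1 : ((k : ℂ) + 1) ≠ 0 := by exact_mod_cast Nat.succ_ne_zero k
    have h2 : (k.factorial : ℂ) ≠ 0 := by exact_mod_cast k.factorial_ne_zero
    field_simp
    ring

theorem euler_C (s : ℂ) : euler (HahnSeries.C s) = 0 := by
  ext n
  rw [euler_coeff, HahnSeries.C_apply, HahnSeries.coeff_single]
  split_ifs with h
  · rw [h]; simp
  · rw [mul_zero, HahnSeries.coeff_zero]

theorem negDeriv_C (s : ℂ) : negDeriv (HahnSeries.C s) = 0 := by
  rw [negDeriv_apply, euler_C, mul_zero]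

/-- A derivation fixing `τ` acts on polynomials in `τ` as `X ∂_X`. -/
theorem derivation_evalL (θ : LaurentSeries ℂ →+ LaurentSeries ℂ)
    (hθ : ∀ f g, θ (f * g) = θ f * g + f * θ g) (hC : ∀ s, θ (HahnSeries.C s) = 0)
    (τ : LaurentSeries ℂ) (hτ : θ τ = τ)
    (p : Polynomial ℂ) : θ (evalL τ p) = evalL τ (Polynomial.X * p.derivative) := by
  have hn : ∀ n : ℕ, θ (τ ^ n) = n * τ ^ n := by
    intro n
    induction n with
    | zero => simpa using hC 1
    | succ n ih =>
      rw [pow_succ, hθ, ih, hτ]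
      push_cast
      ring
  induction p using Polynomial.induction_on' with
  | add p p' hp hp' => simp only [map_add, hp, hp', mul_add]
  | monomial n a =>
    rw [← Polynomial.C_mul_X_pow_eq_monomial, map_mul, map_pow, evalL_C, evalL_X, hθ, hC, hn,
      Polynomial.derivative_C_mul_X_pow, map_mul, map_mul, map_pow, evalL_X, evalL_C, map_mul,
      map_natCast]
    rcases n with _ | n
    · simp
    · rw [Nat.add_sub_cancel]
      ring

/-- `a` and `b` are the expansions at `t` and `e^{-z}` of one rational function. -/
def IsRat (a b : LaurentSeries ℂ) : Prop := ∃ p P : Polynomial ℂ, p ≠ 0 ∧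
  evalL tvar p * a = evalL tvar P ∧ evalL (expL (-1)) p * b = evalL (expL (-1)) P

theorem IsRat.add {a b a' b' : LaurentSeries ℂ} (h : IsRat a b) (h' : IsRat a' b') :
    IsRat (a + a') (b + b') := by
  obtain ⟨p, P, hp, h1, h2⟩ := h
  obtain ⟨p', P', hp', h1', h2'⟩ := h'
  refine ⟨p * p', p' * P + p * P', mul_ne_zero hp hp', ?_, ?_⟩
  · simp only [map_add, map_mul, ← h1, ← h1']; ring
  · simp only [map_add, map_mul, ← h2, ← h2']; ring

theorem IsRat.C_mul {a b : LaurentSeries ℂ} (h : IsRat a b) (s : ℂ) :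
    IsRat (HahnSeries.C s * a) (HahnSeries.C s * b) := by
  obtain ⟨p, P, hp, h1, h2⟩ := h
  refine ⟨p, Polynomial.C s * P, hp, ?_, ?_⟩
  · rw [map_mul, evalL_C, ← h1, mul_left_comm]
  · rw [map_mul, evalL_C, ← h2, mul_left_comm]

/-- The derivations `t ∂_t` and `-∂_z` correspond under `t = e^{-z}`, and both act on polynomials in
the variable as `X ∂_X`. The new numerator and denominator are those of the quotient rule. -/
theorem IsRat.theta {a b : LaurentSeries ℂ} (h : IsRat a b) : IsRat (euler a) (negDeriv b) := by
  obtain ⟨p, P, hp, h1, h2⟩ := h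
  refine ⟨p * p, p * (Polynomial.X * P.derivative) - (Polynomial.X * p.derivative) * P,
    mul_ne_zero hp hp, ?_, ?_⟩
  · have := congrArg euler h1
    rw [euler_mul, derivation_evalL euler euler_mul euler_C _ euler_tvar,
      derivation_evalL euler euler_mul euler_C _ euler_tvar] at this
    rw [map_sub, map_mul _ p (_ * _), ← this, map_mul, map_mul _ (_ * _) P, ← h1]
    ring
  · have := congrArg negDeriv h2
    rw [negDeriv_mul, derivation_evalL negDeriv negDeriv_mul negDeriv_C _ negDeriv_expL,
      derivation_evalL negDeriv negDeriv_mul negDeriv_C _ negDeriv_expL] at this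
    rw [map_sub, map_mul _ p (_ * _), ← this, map_mul, map_mul _ (_ * _) P, ← h2]
    ring

theorem IsRat.iterate {a b : LaurentSeries ℂ} (h : IsRat a b) (n : ℕ) :
    IsRat (euler^[n] a) (negDeriv^[n] b) := by
  induction n with
  | zero => exact h
  | succ n ih =>
    rw [Function.iterate_succ_apply', Function.iterate_succ_apply']
    exact ih.theta

theorem iterate_euler_coeff (n : ℕ) (f : LaurentSeries ℂ) (m : ℤ) :
    (euler^[n] f).coeff m = m ^ n * f.coeff m := by
  induction n with
  | zero => simp
  | succ n ih =>
    rw [Function.iterate_succ_apply', euler_coeff, ih]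
    ring

/-- Read off from the Hasse derivative of order `n`, which is the `n`-th derivative divided by `n!`.
-/
theorem iterate_negDeriv_coeff (n : ℕ) (f : LaurentSeries ℂ) (m : ℤ) :
    (negDeriv^[n] f).coeff m = (-1) ^ n * n.factorial * (Ring.choose (m + n) n : ℤ) * f.coeff (m + n) := by
  have h : negDeriv^[n] f = HahnSeries.C ((-1 : ℂ) ^ n) * (LaurentSeries.derivative ℂ)^[n] f := by
    induction n with
    | zero => simp
    | succ n ih =>
      rw [Function.iterate_succ_apply', ih, Function.iterate_succ_apply', negDeriv_mul, negDeriv_C,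
        zero_mul, zero_add, pow_succ, map_mul, mul_assoc]
      congr 1
      ext m
      rw [negDeriv_coeff, LaurentSeries.derivative_apply, HahnSeries.C_mul_eq_smul,
        HahnSeries.coeff_smul, LaurentSeries.hasseDeriv_coeff]
      simp
  rw [h, LaurentSeries.derivative_iterate, HahnSeries.C_mul_eq_smul, HahnSeries.coeff_smul,
    HahnSeries.coeff_smul, LaurentSeries.hasseDeriv_coeff]
  simp only [smul_eq_mul, nsmul_eq_mul, zsmul_eq_mul]
  ring

/-- The expansion of `1/(1 - c t)`. -/
def geomT (c : ℂ) : LaurentSeries ℂ := HahnSeries.ofPowerSeries ℤ ℂ (PowerSeries.mk fun n => c ^ n)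

/-- The Laurent series `1/(1 - c e^{-z})`. -/
def geomZ (c : ℂ) : LaurentSeries ℂ := (1 - HahnSeries.C c * expL (-1))⁻¹

theorem one_sub_expL_ne_zero (c : ℂ) : (1 - HahnSeries.C c * expL (-1) : LaurentSeries ℂ) ≠ 0 := by
  intro h
  have h1 := congrArg (fun f : LaurentSeries ℂ => f.coeff 1) h
  have h0 := congrArg (fun f : LaurentSeries ℂ => f.coeff 0) h
  simp only [HahnSeries.coeff_sub, HahnSeries.C_mul_eq_smul, HahnSeries.coeff_smul, expL_coeff,
    HahnSeries.coeff_one, HahnSeries.coeff_zero] at h0 h1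
  simp [expCoeff] at h0 h1
  rw [h1] at h0
  simp at h0

theorem isRat_geom (c : ℂ) : IsRat (geomT c) (geomZ c) := by
  refine ⟨1 - Polynomial.C c * Polynomial.X, 1, fun h => ?_, ?_, ?_⟩
  · have := congrArg (Polynomial.eval 0) h
    simp at this
  · simp only [map_sub, map_mul, map_one, evalL_X, evalL_C]
    have h : (1 - PowerSeries.C c * PowerSeries.X) * (PowerSeries.mk fun n => c ^ n) = 1 := by
      rw [sub_mul, one_mul, mul_assoc]
      ext n
      rw [map_sub, PowerSeries.coeff_C_mul, PowerSeries.coeff_mk, PowerSeries.coeff_one]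
      rcases n with _ | n
      · simp
      · rw [PowerSeries.coeff_succ_X_mul, PowerSeries.coeff_mk]
        simp [pow_succ']
    have h2 := congrArg (HahnSeries.ofPowerSeries ℤ ℂ) h
    rw [map_mul, map_sub, map_mul, map_one, HahnSeries.ofPowerSeries_X,
      HahnSeries.ofPowerSeries_C] at h2
    exact h2
  · simp only [map_sub, map_mul, map_one, evalL_X, evalL_C]
    exact mul_inv_cancel₀ (one_sub_expL_ne_zero c)

/-- The constant term of `1 - c e^{-z}` is `1 - c`, so the series is a unit unless `c = 1`. -/
theorem geomZ_coeff (c : ℂ) : (∀ n < -1, (geomZ c).coeff n = 0) ∧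
    (geomZ c).coeff (-1) = if c = 1 then 1 else 0 := by
  set φ : PowerSeries ℂ := 1 - PowerSeries.C c * expS (-1) with hφ
  have e : (1 - HahnSeries.C c * expL (-1) : LaurentSeries ℂ) = HahnSeries.ofPowerSeries ℤ ℂ φ := by
    rw [hφ, map_sub, map_mul, map_one, HahnSeries.ofPowerSeries_C]
    rfl
  have hc : ∀ n, PowerSeries.coeff n φ = (if n = 0 then 1 else 0) - c * expCoeff (-1) n := by
    intro n
    rw [hφ, map_sub, PowerSeries.coeff_one, PowerSeries.coeff_C_mul, coeff_expS]
  split_ifs with h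
  -- For `c = 1`, one has `1 - e^{-z} = z u(z)` with `u(0) = 1`: a simple pole with residue `1`.
  · set u : PowerSeries ℂ := PowerSeries.mk fun n => PowerSeries.coeff (n + 1) φ with hu
    have h1 : φ = PowerSeries.X * u := by
      ext n
      rcases n with _ | n
      · rw [hc]
        simp [h, expCoeff]
      · rw [PowerSeries.coeff_succ_X_mul, hu, PowerSeries.coeff_mk]
    have h2 : PowerSeries.constantCoeff u = 1 := by
      rw [← PowerSeries.coeff_zero_eq_constantCoeff_apply, hu, PowerSeries.coeff_mk, hc]
      simp [h, expCoeff]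
    have h3 : geomZ c = HahnSeries.single (-1) 1 * HahnSeries.ofPowerSeries ℤ ℂ u⁻¹ := by
      refine inv_eq_of_mul_eq_one_right ?_
      rw [e, h1, map_mul, HahnSeries.ofPowerSeries_X, mul_mul_mul_comm,
        ← map_mul (HahnSeries.ofPowerSeries ℤ ℂ),
        PowerSeries.mul_inv_cancel _ (by rw [h2]; exact one_ne_zero),
        map_one (HahnSeries.ofPowerSeries ℤ ℂ), mul_one, HahnSeries.single_mul_single]
      simp
    have h4 : ∀ n, (geomZ c).coeff n = (HahnSeries.ofPowerSeries ℤ ℂ u⁻¹).coeff (n + 1) := by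
      intro n
      rw [h3, HahnSeries.coeff_single_mul, one_mul, sub_neg_eq_add]
    refine ⟨fun n hn => by rw [h4, ofPowerSeries_coeff_of_neg _ (by omega)], ?_⟩
    rw [h4, show (-1 + 1 : ℤ) = ((0 : ℕ) : ℤ) by simp, HahnSeries.ofPowerSeries_apply_coeff,
      PowerSeries.coeff_zero_eq_constantCoeff_apply, PowerSeries.constantCoeff_inv, h2, inv_one]
  · have h2 : PowerSeries.constantCoeff φ ≠ 0 := by
      rw [← PowerSeries.coeff_zero_eq_constantCoeff_apply, hc]
      simp only [expCoeff, if_true]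
      simpa [sub_eq_zero] using Ne.symm h
    have h3 : geomZ c = HahnSeries.ofPowerSeries ℤ ℂ φ⁻¹ := by
      refine inv_eq_of_mul_eq_one_right ?_
      rw [e, ← map_mul, PowerSeries.mul_inv_cancel _ h2, map_one]
    rw [h3]
    exact ⟨fun n hn => ofPowerSeries_coeff_of_neg _ (by omega),
      ofPowerSeries_coeff_of_neg _ (by omega)⟩

/-- The identity `1/(1 - y⁻¹) = 1 - 1/(1 - y)` at `y = c e^{-z}`. The summand `1` cancels in the
difference of two such series that forms a contraction. -/
theorem reflect_geomZ (c : ℂ) (hc : c ≠ 0) : reflect (geomZ c⁻¹) = 1 - geomZ c := by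
  have h1 := one_sub_expL_ne_zero c
  have h2 : (HahnSeries.C c⁻¹ : LaurentSeries ℂ) = (HahnSeries.C c)⁻¹ := map_inv₀ _ _
  have h3 : expL 1 = (expL (-1))⁻¹ := eq_inv_of_mul_eq_one_left (expL_mul_neg 1)
  have h4 : (HahnSeries.C c : LaurentSeries ℂ) ≠ 0 := (map_ne_zero _).2 hc
  have h5 := expL_ne_zero (-1)
  have h6 : (1 - (HahnSeries.C c)⁻¹ * (expL (-1))⁻¹ : LaurentSeries ℂ) =
      -(1 - HahnSeries.C c * expL (-1)) * ((HahnSeries.C c)⁻¹ * (expL (-1))⁻¹) := by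
    field_simp
    ring
  rw [geomZ, geomZ, map_inv₀, map_sub, map_one, map_mul, reflect_C, reflect_expL, neg_neg, h2, h3,
    h6]
  generalize (HahnSeries.C c : LaurentSeries ℂ) = x at *
  generalize expL (-1) = y at *
  field_simp
  ring

/-! ### The contractions of the generating fields -/

section Contraction

variable (q ℓ : ℂ)

/-- The contraction of `β(q^r x₁)` and `β(q^s x₂)`, expanded in `t = x₂ / x₁`. -/
def contrT (r s : ℤ) : LaurentSeries ℂ :=
  HahnSeries.C (ℓ * (q - q⁻¹)⁻¹) * (geomT (q ^ (s - r + 1)) - geomT (q ^ (s - r - 1)))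

/-- The same contraction, as a Laurent series in `z` for `x₁ = x₂ e^z`. -/
def contrZ (r s : ℤ) : LaurentSeries ℂ :=
  HahnSeries.C (ℓ * (q - q⁻¹)⁻¹) * (geomZ (q ^ (s - r + 1)) - geomZ (q ^ (s - r - 1)))

/-- The coefficient in front of the derivatives of the contraction. -/
def contrScalar (a b : ℤ × ℕ) : ℂ := (-1) ^ a.2 / (a.2.factorial * b.2.factorial)

/-- The contraction of the derivatives `(x₁ ∂)^k / k!` and `(x₂ ∂)^j / j!` of the fields. -/
def hT (a b : ℤ × ℕ) : LaurentSeries ℂ :=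
  HahnSeries.C (contrScalar a b) * euler^[a.2 + b.2] (contrT q ℓ a.1 b.1)

/-- The contraction of derivatives, as a Laurent series in `z`. -/
def hZ (a b : ℤ × ℕ) : LaurentSeries ℂ :=
  HahnSeries.C (contrScalar a b) * negDeriv^[a.2 + b.2] (contrZ q ℓ a.1 b.1)

theorem isRat_h (a b : ℤ × ℕ) : IsRat (hT q ℓ a b) (hZ q ℓ a b) := by
  have h := ((isRat_geom (q ^ (b.1 - a.1 + 1))).add
    ((isRat_geom (q ^ (b.1 - a.1 - 1))).C_mul (-1))).C_mul (ℓ * (q - q⁻¹)⁻¹)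
  rw [map_neg, map_one, neg_one_mul, neg_one_mul, ← sub_eq_add_neg, ← sub_eq_add_neg] at h
  exact (h.iterate _).C_mul _

/-- The right side is the commutator of the coefficient of `x₁^{-n}` in the field of `a` with the
coefficient of `x₂^n` in that of `b`, the bracket of `β_n` and `β_{-n}` contributing `[n]_q ℓ`. -/
theorem hT_coeff_natCast (hq : q ≠ 0) (a b : ℤ × ℕ) (n : ℕ) : (hT q ℓ a b).coeff n =
    ((-n) ^ a.2 / a.2.factorial) * (n ^ b.2 / b.2.factorial) *
      (q ^ ((b.1 - a.1) * n) * qInt q n * ℓ) := by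
  rw [hT, HahnSeries.C_mul_eq_smul, HahnSeries.coeff_smul, iterate_euler_coeff, contrT,
    HahnSeries.C_mul_eq_smul, HahnSeries.coeff_smul, HahnSeries.coeff_sub, geomT, geomT,
    HahnSeries.ofPowerSeries_apply_coeff, HahnSeries.ofPowerSeries_apply_coeff,
    PowerSeries.coeff_mk, PowerSeries.coeff_mk, contrScalar, qInt]
  rw [← zpow_natCast (q ^ _), ← zpow_natCast (q ^ _), ← zpow_mul, ← zpow_mul, add_mul, sub_mul _ (1 : ℤ), one_mul,
    zpow_add₀ hq, sub_eq_add_neg (_ * _) (n : ℤ), zpow_add₀ hq, neg_pow (n : ℂ)]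
  simp only [smul_eq_mul, Int.cast_natCast]
  ring

theorem hT_coeff_of_neg (a b : ℤ × ℕ) (n : ℤ) (hn : n < 0) : (hT q ℓ a b).coeff n = 0 := by
  rw [hT, HahnSeries.C_mul_eq_smul, HahnSeries.coeff_smul, iterate_euler_coeff, contrT,
    HahnSeries.C_mul_eq_smul, HahnSeries.coeff_smul, HahnSeries.coeff_sub, geomT, geomT,
    ofPowerSeries_coeff_of_neg _ hn, ofPowerSeries_coeff_of_neg _ hn]
  simp

theorem contrZ_coeff_of_lt (r s n : ℤ) (hn : n < -1) : (contrZ q ℓ r s).coeff n = 0 := by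
  rw [contrZ, HahnSeries.C_mul_eq_smul, HahnSeries.coeff_smul, HahnSeries.coeff_sub,
    (geomZ_coeff _).1 n hn, (geomZ_coeff _).1 n hn]
  simp

theorem zpow_eq_one_iff_of_not_root (hq : ∀ n : ℕ, 0 < n → q ^ n ≠ 1) (n : ℤ) :
    q ^ n = 1 ↔ n = 0 := by
  refine ⟨fun h => ?_, fun h => by rw [h, zpow_zero]⟩
  obtain ⟨k, rfl | rfl⟩ := n.eq_nat_or_neg
  · rw [zpow_natCast] at h
    by_contra hk
    exact hq k (by omega) h
  · rw [zpow_neg, zpow_natCast, inv_eq_one] at h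
    by_contra hk
    exact hq k (by omega) h

/-- The two geometric series have a pole only when `q^{s-r±1} = 1`, which for `q` not a root of
unity forces `r = s ± 1`. This ties the form on `B` to the bracket of the `β_n`. -/
theorem contrZ_coeff_neg_one (hq : ∀ n : ℕ, 0 < n → q ^ n ≠ 1) (r s : ℤ) :
    (contrZ q ℓ r s).coeff (-1) = kap q ℓ r s := by
  rw [contrZ, HahnSeries.C_mul_eq_smul, HahnSeries.coeff_smul, HahnSeries.coeff_sub,
    (geomZ_coeff _).2, (geomZ_coeff _).2, kap, formB_single]
  simp only [zpow_eq_one_iff_of_not_root q hq, smul_eq_mul, show s - r + 1 = 0 ↔ r = s + 1 by omega,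
    show s - r - 1 = 0 ↔ r = s - 1 by omega, mul_assoc]

/-- Exchanging `r` and `s` inverts and exchanges the two parameters, so the signs from
`reflect_geomZ` and from the difference cancel. -/
theorem reflect_contrZ (hq0 : q ≠ 0) (r s : ℤ) :
    reflect (contrZ q ℓ s r) = contrZ q ℓ r s := by
  rw [contrZ, contrZ, map_mul, reflect_C, map_sub,
    show q ^ (r - s + 1) = (q ^ (s - r - 1))⁻¹ by rw [← zpow_neg]; ring_nf,
    show q ^ (r - s - 1) = (q ^ (s - r + 1))⁻¹ by rw [← zpow_neg]; ring_nf,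
    reflect_geomZ _ (zpow_ne_zero _ hq0), reflect_geomZ _ (zpow_ne_zero _ hq0)]
  ring

theorem hZ_coeff (a b : ℤ × ℕ) (m : ℤ) : (hZ q ℓ a b).coeff m =
    (-1) ^ b.2 * ((a.2 + b.2).choose a.2 : ℂ) *
      (Ring.choose (m + (a.2 + b.2 : ℕ)) (a.2 + b.2) : ℤ) *
      (contrZ q ℓ a.1 b.1).coeff (m + (a.2 + b.2 : ℕ)) := by
  rw [hZ, HahnSeries.C_mul_eq_smul, HahnSeries.coeff_smul, iterate_negDeriv_coeff, contrScalar,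
    smul_eq_mul, Nat.cast_add_choose, pow_add]
  have h : ((-1 : ℂ) ^ a.2) * (-1) ^ a.2 = 1 := by rw [← mul_pow]; simp
  linear_combination ((-1 : ℂ) ^ b.2 * (a.2 + b.2).factorial / (a.2.factorial * b.2.factorial) *
    (Ring.choose (m + (a.2 + b.2 : ℕ)) (a.2 + b.2) : ℤ) *
      (contrZ q ℓ a.1 b.1).coeff (m + (a.2 + b.2 : ℕ))) * h

/-- The constant terms of the contractions. -/
def gconst (a b : ℤ × ℕ) : ℂ := (hZ q ℓ a b).coeff 0

theorem gconst_eq (a b : ℤ × ℕ) : gconst q ℓ a b =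
    (-1) ^ b.2 * ((a.2 + b.2).choose a.2 : ℂ) * (contrZ q ℓ a.1 b.1).coeff (a.2 + b.2 : ℕ) := by
  rw [gconst, hZ_coeff, zero_add, Ring.choose_natCast, Nat.choose_self]
  simp

/-- The sign `(-1)^(k+j)` of the reflection accounts for the different powers of `-1` on the two
sides. Symmetry is needed for the operators defining `Fock.wick` to commute. -/
theorem gconst_comm (hq0 : q ≠ 0) (a b : ℤ × ℕ) : gconst q ℓ a b = gconst q ℓ b a := by
  rw [gconst_eq, gconst_eq, ← reflect_contrZ q ℓ hq0 a.1 b.1, reflect_coeff, zpow_natCast,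
    add_comm b.2, Nat.choose_symm_add, pow_add]
  have h : ((-1 : ℂ) ^ b.2) * (-1) ^ b.2 = 1 := by rw [← mul_pow]; simp
  linear_combination ((-1 : ℂ) ^ a.2 * ((a.2 + b.2).choose b.2 : ℂ) *
    (contrZ q ℓ b.1 a.1).coeff (a.2 + b.2 : ℕ)) * h

/-- Raising `k` differentiates the contraction in `z`, up to normalization, so the Taylor
coefficients of the regular part are constant terms for higher `k`. -/
theorem hZ_coeff_natCast (r : ℤ) (k : ℕ) (b : ℤ × ℕ) (m : ℕ) : (hZ q ℓ (r, k) b).coeff m =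
    ((m + k).choose k : ℂ) * gconst q ℓ (r, m + k) b := by
  rw [hZ_coeff, gconst_eq, ← Nat.cast_add, Ring.choose_natCast]
  simp only
  have h : ((k + b.2).choose k : ℂ) * ((m + (k + b.2)).choose (k + b.2) : ℂ) =
      ((m + k).choose k : ℂ) * ((m + k + b.2).choose (m + k) : ℂ) := by
    have h1 := Nat.choose_mul (n := m + k + b.2) (k := m + k) (s := k) (by omega)
    have h2 := Nat.choose_mul (n := m + k + b.2) (k := k + b.2) (s := k) (by omega)
    have h3 : (m + k + b.2 - k).choose (m + k - k) = (m + k + b.2 - k).choose (k + b.2 - k) := by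
      rw [show m + k + b.2 - k = m + b.2 by omega, show m + k - k = m by omega,
        show k + b.2 - k = b.2 by omega, Nat.choose_symm_add]
    have h4 : (m + k + b.2).choose (k + b.2) * (k + b.2).choose k =
        (m + k + b.2).choose (m + k) * (m + k).choose k := by rw [h1, h2, h3]
    rw [← add_assoc]
    exact_mod_cast (by linarith)
  rw [← add_assoc]
  rw [← add_assoc] at h
  push_cast at h ⊢
  linear_combination ((-1) ^ b.2 * (contrZ q ℓ r b.1).coeff (m + k + b.2)) * h

/-- Derivatives of a simple pole give a single negative power. The other negative exponents come
from Taylor coefficients of order below that of the derivative, which it kills. -/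
theorem hZ_coeff_of_neg (hq : ∀ n : ℕ, 0 < n → q ^ n ≠ 1) (r : ℤ) (k : ℕ)
    (b : ℤ × ℕ) (m : ℤ) (hm : m < 0) : (hZ q ℓ (r, k) b).coeff m =
      if m = -(k + b.2 : ℕ) - 1 then (-1) ^ k * ((k + b.2).choose k : ℂ) * kap q ℓ r b.1 else 0 := by
  rw [hZ_coeff]
  simp only
  split_ifs with h
  · rw [h, show (-(k + b.2 : ℕ) - 1 + (k + b.2 : ℕ) : ℤ) = -1 by ring,
      contrZ_coeff_neg_one q ℓ hq, show (-1 : ℤ) = -((0 : ℕ) + 1 : ℤ) by simp,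
      choose_add_neg, pow_add]
    have h2 : ((-1 : ℂ) ^ b.2) * (-1) ^ b.2 = 1 := by rw [← mul_pow]; simp
    simp only [Nat.choose_zero_right, Nat.cast_one, mul_one]
    push_cast
    linear_combination ((-1 : ℂ) ^ k * ((k + b.2).choose k : ℂ) * kap q ℓ r b.1) * h2
  · by_cases h1 : m + (k + b.2 : ℕ) < -1
    · rw [contrZ_coeff_of_lt _ _ _ _ _ h1, mul_zero]
    · obtain ⟨p, hp⟩ := Int.eq_ofNat_of_zero_le (show 0 ≤ m + (k + b.2 : ℕ) by omega)
      rw [hp, Ring.choose_natCast, Nat.choose_eq_zero_of_lt (show p < k + b.2 by omega)]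
      simp

end Contraction

end QHeis

namespace QHeis

open VertexOperator (ncoeff)

open MvPolynomial (X C pderiv)

/-! ### Normally ordered products as operators on Laurent series -/

section

variable {W : Type*} [AddCommGroup W] [Module ℂ W]

/-- The action of the creation part of a split field on `W((x))`. -/
def SplitField.cmOp (c : SplitField W) : HM W →ₗ[ℂ] HM W := shiftH c.sm ∘ₗ opSeries c.cm

theorem SplitField.hc_cmOp (c : SplitField W) (x : HM W) (n : ℤ) :
    hc (c.cmOp x) n = ∑ᶠ i : ℕ, c.cm i (hc x (n - c.sm - i)) := rfl

theorem SplitField.nprod_apply_eventually (c : SplitField W) (A : VertexOperator ℂ W) (w : W) :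
    ∀ᶠ i : ℕ in atTop, shiftH (-c.sp - i) (A (c.cp i w)) = 0 := by
  filter_upwards [c.eventually_cp w] with i hi
  rw [hi, map_zero, map_zero]

theorem finsum_hc {V : Type*} [AddCommGroup V] [Module ℂ V] {f : ℕ → HM V}
    (hf : ∀ᶠ i in atTop, f i = 0) (n : ℤ) :
    hc (∑ᶠ i, f i) n = ∑ᶠ i, hc (f i) n :=
  map_finsum_eventually (LinearMap.proj n ∘ₗ hc) hf

/-- Separates the part acting on the series `A w` from the part acting on `w` before `A`. The
recursions for products and iterates are compared in this form. -/
theorem SplitField.nprod_apply (c : SplitField W) (A : VertexOperator ℂ W) (w : W) :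
    c.nprod A w = c.cmOp (A w) + ∑ᶠ i : ℕ, shiftH (-c.sp - i) (A (c.cp i w)) := by
  refine hc_ext fun n => ?_
  rw [hc_add, finsum_hc (c.nprod_apply_eventually A w), hc_apply_eq_cf, c.cf_nprod, c.hc_cmOp]
  simp only [hc_shiftH, hc_apply_eq_cf, sub_sub_eq_add_sub, sub_neg_eq_add]
  congr 1
  refine finsum_congr fun i => ?_
  rw [show n + c.sp + i = n + i + c.sp by ring]

end

/-! ### Contractions on the Fock space -/

section

variable {σ : Type*}

theorem pderiv_comm (b b' : σ) (v : MvPolynomial σ ℂ) :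
    pderiv b (pderiv b' v) = pderiv b' (pderiv b v) := by
  classical
  refine Fock.derivation_comm (pderiv b) (pderiv b') (fun a => if a = b then 1 else 0)
    (fun a => if a = b' then 1 else 0) (fun a => ?_) (fun a => ?_) v
  · rw [MvPolynomial.pderiv_X, Pi.single_apply]
    split_ifs <;> simp
  · rw [MvPolynomial.pderiv_X, Pi.single_apply]
    split_ifs <;> simp

/-- Every derivation with constant coefficients is a combination of partial derivatives. -/
theorem derivation_eq_sum_pderiv (D : Derivation ℂ (MvPolynomial σ ℂ) (MvPolynomial σ ℂ))
    (χ : σ → ℂ) (hD : ∀ a, D (X a) = C (χ a)) (v : MvPolynomial σ ℂ) (J : Finset σ)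
    (hJ : ∀ b ∉ J, pderiv b v = 0) : D v = ∑ b ∈ J, χ b • pderiv b v := by
  classical
  have h1 : ∀ᶠ I : Finset σ in atTop, D v = ∑ b ∈ I, χ b • pderiv b v := by
    clear hJ
    induction v using MvPolynomial.induction_on with
    | C s => refine Eventually.of_forall fun I => ?_; simp [MvPolynomial.derivation_C]
    | add u v hu hv =>
      filter_upwards [hu, hv] with I h1 h2
      simp only [map_add, h1, h2, smul_add, sum_add_distrib]
    | mul_X u a hu =>
      filter_upwards [hu, eventually_ge_atTop {a}] with I h1 h2
      have ha : a ∈ I := h2 (mem_singleton_self a)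
      simp only [Derivation.leibniz, smul_add, sum_add_distrib]
      rw [h1, hD, smul_sum]
      congr 1
      · rw [sum_eq_single_of_mem a ha]
        · rw [MvPolynomial.pderiv_X_self, smul_eq_mul, smul_eq_mul, mul_one, mul_comm,
            MvPolynomial.smul_eq_C_mul]
        · intro b _ hb
          rw [MvPolynomial.pderiv_X_of_ne hb.symm, smul_zero, smul_zero]
      · refine sum_congr rfl fun b _ => ?_
        rw [smul_comm]
  obtain ⟨I, hI, hJI⟩ := (h1.and (eventually_ge_atTop J)).exists
  rw [hI]
  refine (sum_subset hJI fun b _ hb => ?_).symm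
  rw [hJ b hb, smul_zero]

theorem pderiv_eq_zero_of_notMem (v : MvPolynomial σ ℂ) (b : σ) (hb : b ∉ v.vars) :
    pderiv b v = 0 := MvPolynomial.pderiv_eq_zero_of_notMem_vars hb

end

namespace Fock

variable (q ℓ : ℂ)

/-- The contraction with `X_a`. -/
def contr (a : ℤ × ℕ) : Derivation ℂ Fock Fock :=
  MvPolynomial.mkDerivation ℂ fun b => C (gconst q ℓ a b)

theorem contr_X (a b : ℤ × ℕ) : contr q ℓ a (X b) = C (gconst q ℓ a b) :=
  MvPolynomial.mkDerivation_X _ _ _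

/-- Contractions commute with each other, and the cross terms are `gconst q ℓ a b` and `gconst q ℓ b
a`. -/
theorem wick_comm (hq0 : q ≠ 0) (a b : ℤ × ℕ) :
    (cre a.1 a.2 + (contr q ℓ a).toLinearMap) * (cre b.1 b.2 + (contr q ℓ b).toLinearMap) =
    (cre b.1 b.2 + (contr q ℓ b).toLinearMap) * (cre a.1 a.2 + (contr q ℓ a).toLinearMap) := by
  refine LinearMap.ext fun u => ?_
  have h := derivation_comm _ _ _ _ (contr_X q ℓ a) (contr_X q ℓ b) u
  simp only [Module.End.mul_apply, LinearMap.add_apply, cre_apply, map_add,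
    Derivation.coeFn_coe, Derivation.leibniz, contr_X, smul_eq_mul, h, gconst_comm q ℓ hq0 b a]
  ring

/-- The passage from the normal ordering of the vertex algebra to that of the fields on `W`. -/
def wick (hq0 : q ≠ 0) : Fock →ₗ[ℂ] Fock :=
  LinearMap.applyₗ 1 ∘ₗ (commEval (fun a : ℤ × ℕ => cre a.1 a.2 + (contr q ℓ a).toLinearMap)
    (wick_comm q ℓ hq0)).toLinearMap

variable (hq0 : q ≠ 0)

theorem wick_one : wick q ℓ hq0 1 = 1 := by
  simp [wick]

theorem wick_X_mul (a : ℤ × ℕ) (u : Fock) : wick q ℓ hq0 (X a * u) =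
    X a * wick q ℓ hq0 u + contr q ℓ a (wick q ℓ hq0 u) := by
  simp [wick, cre_apply]

/-- A derivation with constant coefficients commutes with contractions, so it passes through the
recursion for `wick`. This is applied to the partial derivatives and to the contractions themselves.
-/
theorem derivation_wick (D : Derivation ℂ Fock Fock) (χ : ℤ × ℕ → ℂ) (hD : ∀ a, D (X a) = C (χ a))
    (u : Fock) : D (wick q ℓ hq0 u) = wick q ℓ hq0 (D u) := by
  induction u using MvPolynomial.induction_on with
  | C s =>
    rw [show (C s : Fock) = s • 1 by rw [MvPolynomial.smul_eq_C_mul, mul_one], map_smul, wick_one]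
    simp
  | add u v hu hv => simp only [map_add, hu, hv]
  | mul_X u a hu =>
    rw [mul_comm, wick_X_mul, map_add, Derivation.leibniz, Derivation.leibniz, map_add, hD,
      derivation_comm _ _ _ _ hD (contr_X q ℓ a), hu, smul_eq_mul, smul_eq_mul, smul_eq_mul,
      smul_eq_mul, wick_X_mul, mul_comm u, ← MvPolynomial.smul_eq_C_mul, map_smul, mul_comm _ (C _),
      ← MvPolynomial.smul_eq_C_mul]
    abel

end Fock

/-! ### The fields on a restricted module -/

section Fields

variable {q : ℂ} {W : Type*} [AddCommGroup W] [Module ℂ W]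
  [LieRingModule (QHeisenberg q) W] [LieModule ℂ (QHeisenberg q) W]

variable (q W) in
/-- The operator `β_n`. -/
def βOp (n : ℤ) : Module.End ℂ W := LieModule.toEnd ℂ (QHeisenberg q) W (β q n)

theorem βOp_comm {ℓ : ℂ} (hℓ : HasLevel q W ℓ) (m n : ℤ) (w : W) :
    βOp q W m (βOp q W n w) = βOp q W n (βOp q W m w) +
      ((if m + n = 0 then qInt q m else 0) * ℓ) • w := by
  have h := leibniz_lie (β q m) (β q n) w
  rw [lie_β, smul_lie, hℓ w, smul_smul] at h
  change ⁅β q m, ⁅β q n, w⁆⁆ = ⁅β q n, ⁅β q m, w⁆⁆ + _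
  rw [h, add_comm]

theorem βOp_eventually (hW : IsRestricted q W) (w : W) : ∀ᶠ i : ℕ in atTop, βOp q W i w = 0 := by
  obtain ⟨N, hN⟩ := hW w
  filter_upwards [eventually_ge_atTop N.toNat] with i hi
  exact hN i (by omega)

/-- The field `(x∂)^k β(q^r x) / k!`. -/
def βSplit (hW : IsRestricted q W) (a : ℤ × ℕ) : SplitField W where
  cm i := ((i + 1 : ℂ) ^ a.2 / a.2.factorial * q ^ (a.1 * (i + 1))) • βOp q W (-i - 1)
  cp i := ((-i : ℂ) ^ a.2 / a.2.factorial * q ^ (-(a.1 * i))) • βOp q W i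
  sm := 1
  sp := 0
  eventually_cp w := by
    filter_upwards [βOp_eventually hW w] with i hi
    rw [LinearMap.smul_apply, hi, smul_zero]

variable (hW : IsRestricted q W) {ℓ : ℂ}

theorem βSplit_cm_comm (hℓ : HasLevel q W ℓ) (a b : ℤ × ℕ) (i j : ℕ) :
    (βSplit hW a).cm i * (βSplit hW b).cm j = (βSplit hW b).cm j * (βSplit hW a).cm i := by
  refine LinearMap.ext fun w => ?_
  simp only [βSplit, Module.End.mul_apply, LinearMap.smul_apply, map_smul]
  rw [smul_comm, βOp_comm hℓ, if_neg (by omega), zero_mul, zero_smul, add_zero]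

/-- The mode `β_0` counts as an annihilation operator; this is harmless because `[0]_q = 0`. -/
theorem βSplit_cp_comm (hℓ : HasLevel q W ℓ) (a b : ℤ × ℕ) (i j : ℕ) :
    (βSplit hW a).cp i * (βSplit hW b).cp j = (βSplit hW b).cp j * (βSplit hW a).cp i := by
  refine LinearMap.ext fun w => ?_
  simp only [βSplit, Module.End.mul_apply, LinearMap.smul_apply, map_smul]
  rw [smul_comm, βOp_comm hℓ]
  have h : (if (i : ℤ) + j = 0 then qInt q i else 0) = 0 := by
    split_ifs with h
    · rw [show (i : ℤ) = 0 by omega]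
      simp [qInt]
    · rfl
  rw [h, zero_mul, zero_smul, add_zero]

variable (hℓ : HasLevel q W ℓ) (hq0 : q ≠ 0)

/-- The normally ordered fields on `W`. -/
def βField₀ : Fock →ₗ[ℂ] VertexOperator ℂ W :=
  fieldMap (βSplit hW) (βSplit_cm_comm hW hℓ) (βSplit_cp_comm hW hℓ)

/-- The state-field map of the quasi module, on the Fock space. -/
def quasiY : Fock →ₗ[ℂ] VertexOperator ℂ W := βField₀ hW hℓ ∘ₗ Fock.wick q ℓ hq0

theorem quasiY_one : quasiY hW hℓ hq0 1 = idField W := by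
  rw [quasiY, LinearMap.comp_apply, Fock.wick_one, βField₀, fieldMap_one]

theorem quasiY_X_mul (a : ℤ × ℕ) (u : Fock) : quasiY hW hℓ hq0 (X a * u) =
    (βSplit hW a).nprod (quasiY hW hℓ hq0 u) + quasiY hW hℓ hq0 (Fock.contr q ℓ a u) := by
  rw [quasiY, LinearMap.comp_apply, LinearMap.comp_apply, LinearMap.comp_apply, Fock.wick_X_mul,
    map_add, βField₀, fieldMap_X_mul, Fock.derivation_wick q ℓ hq0 _ _ (Fock.contr_X q ℓ a)]

/-- The annihilation mode of index `p` has scalar commutators with the generating modes, namely the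
coefficients of `t^p` in the contractions. So it acts on normally ordered fields through partial
derivatives, which pass through `Fock.wick`. -/
theorem cp_quasiY (a : ℤ × ℕ) (p : ℕ) (v : Fock) (J : Finset (ℤ × ℕ))
    (hJ : ∀ b ∉ J, pderiv b v = 0) (n : ℤ) (w : W) :
    (βSplit hW a).cp p (cf (quasiY hW hℓ hq0 v) n w) =
      cf (quasiY hW hℓ hq0 v) n ((βSplit hW a).cp p w) +
      ∑ b ∈ J, (hT q ℓ a b).coeff p • cf (quasiY hW hℓ hq0 (pderiv b v)) (n - p) w := by
  classical
  have h := adField_fieldMap (βSplit hW) (βSplit_cm_comm hW hℓ) (βSplit_cp_comm hW hℓ)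
    ((βSplit hW a).cp p) (fun b : ℤ × ℕ => (hT q ℓ a b).coeff p • pderiv b)
    (fun b c => if c = b then (hT q ℓ a b).coeff p else 0) (fun _ => (p : ℤ)) ?_ ?_
    (Fock.wick q ℓ hq0 v)
  · obtain ⟨I, hI, hJI⟩ := (h.and (eventually_ge_atTop J)).exists
    have h1 := congrArg (fun A => cf A n w) hI
    simp only [map_sum, Finset.sum_apply, LinearMap.sum_apply] at h1
    rw [← sub_eq_iff_eq_add']
    refine h1.trans ?_
    have h2 : ∀ b, cf (shiftField p (fieldMap (βSplit hW) (βSplit_cm_comm hW hℓ)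
        (βSplit_cp_comm hW hℓ) (((hT q ℓ a b).coeff p • pderiv b) (Fock.wick q ℓ hq0 v)))) n w =
        (hT q ℓ a b).coeff p • cf (quasiY hW hℓ hq0 (pderiv b v)) (n - p) w := by
      intro b
      rw [cf_shiftField, Derivation.smul_apply, Fock.derivation_wick q ℓ hq0 (pderiv b)
        (fun a => if a = b then 1 else 0), map_smul, map_smul]
      · rfl
      · intro c
        rw [MvPolynomial.pderiv_X, Pi.single_apply]
        split_ifs <;> simp
    simp only [h2]
    refine (sum_subset hJI fun b _ hb => ?_).symm
    rw [hJ b hb, map_zero, map_zero, Pi.zero_apply, LinearMap.zero_apply, smul_zero]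
  · intro b c
    rw [Derivation.smul_apply, MvPolynomial.pderiv_X, Pi.single_apply]
    split_ifs <;> simp [MvPolynomial.smul_eq_C_mul]
  · intro c
    filter_upwards [eventually_ge_atTop {c}] with I hI A
    have hc : c ∈ I := hI (mem_singleton_self c)
    refine cf_ext fun n w => ?_
    rw [SplitField.cf_adField_nprod _ _
      (fun i => if (i : ℤ) + 1 = p then (hT q ℓ a c).coeff p else 0) (fun _ => 0),
      map_add, Pi.add_apply, LinearMap.add_apply]
    · congr 1
      rw [sum_eq_single_of_mem c hc fun b _ hb => by rw [if_neg (Ne.symm hb), zero_smul], if_pos rfl,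
        map_smul, Pi.smul_apply, LinearMap.smul_apply, cf_shiftField]
      simp only [zero_smul, map_zero, finsum_zero, add_zero]
      rcases p with _ | p
      -- Creation modes have index `-i - 1`, so none pairs with `β_0`; correspondingly the constant
      -- coefficient of the contraction is `0`.
      · rw [finsum_eq_zero_of_forall_eq_zero, hT_coeff_natCast q ℓ hq0]
        · simp [qInt]
        · intro i
          rw [if_neg (by omega), zero_smul]
      · rw [finsum_eq_single _ p]
        · rw [if_pos (by push_cast; ring)]
          congr 3
          refine congrArg (cf A) ?_
          change n - 1 - (p : ℤ) = _
          push_cast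
          ring
        · intro i hi
          rw [if_neg (by omega), zero_smul]
    · intro i w
      simp only [βSplit, LinearMap.smul_apply, map_smul]
      rw [βOp_comm hℓ, smul_add, smul_add, smul_comm, add_sub_cancel_left, smul_smul, smul_smul]
      congr 1
      by_cases h : (i : ℤ) + 1 = p
      · rw [if_pos h, if_pos (by omega), hT_coeff_natCast q ℓ hq0, ← h,
          show (p : ℂ) = i + 1 by exact_mod_cast h.symm, sub_mul, sub_eq_add_neg (c.1 * _), zpow_add₀ hq0]
        ring
      · rw [if_neg h, if_neg (by omega)]
        ring
    · intro i w
      have h := LinearMap.congr_fun (βSplit_cp_comm hW hℓ a c p i) w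
      rw [Module.End.mul_apply, Module.End.mul_apply] at h
      rw [h, sub_self, zero_smul]

end Fields

end QHeis

namespace QHeis

open VertexOperator (ncoeff)

open MvPolynomial (X C pderiv)

/-! ### The state-field map of the Fock space as a map to Laurent series -/

theorem HM_smul_smul {V : Type*} [AddCommGroup V] [Module ℂ V] (s t : LaurentSeries ℂ) (x : HM V) :
    s • t • x = (s * t) • x := smul_smul s t x

theorem HM_smul_comm {V : Type*} [AddCommGroup V] [Module ℂ V] (s t : LaurentSeries ℂ) (x : HM V) :
    s • t • x = t • s • x := by
  rw [HM_smul_smul, mul_comm, HM_smul_smul]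

theorem hc_sum {V ι : Type*} [AddCommGroup V] [Module ℂ V] (J : Finset ι) (f : ι → HM V) (n : ℤ) :
    hc (∑ b ∈ J, f b) n = ∑ b ∈ J, hc (f b) n :=
  map_sum (LinearMap.proj n ∘ₗ hc) f J

namespace Fock

variable (q ℓ : ℂ)

/-- The creation part of `(1/k!) ∂^k β^{(r)}(z)`. -/
def creSeries (a : ℤ × ℕ) : HM Fock →ₗ[ℂ] HM Fock :=
  opSeries fun i => ((i + a.2).choose a.2 : ℂ) • cre a.1 (i + a.2)

/-- The contraction with `(1/k!) ∂^k β^{(r)}(z)`. -/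
def contrSeries (a : ℤ × ℕ) : HM Fock →ₗ[ℂ] HM Fock :=
  opSeries fun i => ((i + a.2).choose a.2 : ℂ) • (contr q ℓ (a.1, i + a.2)).toLinearMap

/-- The singular part of the contraction. -/
def hPole (a b : ℤ × ℕ) : LaurentSeries ℂ :=
  HahnSeries.single (-(a.2 + b.2 : ℕ) - 1 : ℤ)
    ((-1) ^ a.2 * ((a.2 + b.2).choose a.2 : ℂ) * kap q ℓ a.1 b.1)

/-- The regular part of the contraction. -/
def hReg (a b : ℤ × ℕ) : LaurentSeries ℂ := HahnSeries.ofPowerSeries ℤ ℂ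
  (PowerSeries.mk fun m => ((m + a.2).choose a.2 : ℂ) * gconst q ℓ (a.1, m + a.2) b)

/-- The singular part comes from the commutators in the vertex algebra, the regular part from the
correction `wick`. Only together do they form the expansion of a rational function. -/
theorem hPole_add_hReg (hq : ∀ n : ℕ, 0 < n → q ^ n ≠ 1) (a b : ℤ × ℕ) :
    hPole q ℓ a b + hReg q ℓ a b = hZ q ℓ a b := by
  obtain ⟨r, k⟩ := a
  ext m
  rw [HahnSeries.coeff_add, hPole, hReg, HahnSeries.coeff_single]
  rcases lt_or_ge m 0 with hm | hm
  · rw [ofPowerSeries_coeff_of_neg _ hm, add_zero, hZ_coeff_of_neg q ℓ hq r k b m hm]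
    by_cases h : m = -(k + b.2 : ℕ) - 1
    · rw [if_pos h, if_pos h]
    · rw [if_neg h, if_neg h]
  · obtain ⟨m, rfl⟩ := Int.eq_ofNat_of_zero_le hm
    rw [if_neg (by omega), zero_add, HahnSeries.ofPowerSeries_apply_coeff, PowerSeries.coeff_mk,
      hZ_coeff_natCast]

theorem kap_eq_pderiv (r : ℤ) (p : ℕ) (v : Fock) (J : Finset (ℤ × ℕ))
    (hJ : ∀ b ∉ J, pderiv b v = 0) : ann (kap q ℓ) r p v =
      ∑ b ∈ J, (if b.2 = p then kap q ℓ r b.1 else 0) • pderiv b v :=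
  derivation_eq_sum_pderiv _ _ (annD_X (kap q ℓ) r p) v J hJ

/-- Annihilation operators act on `v` as combinations of partial derivatives, each weighted by a
single negative power of `z`. The finite set `J` replaces a sum over all variables. -/
theorem Y_X_mul (a : ℤ × ℕ) (u v : Fock) (J : Finset (ℤ × ℕ)) (hJ : ∀ b ∉ J, pderiv b v = 0) :
    Y (kap q ℓ) (X a * u) v = creSeries a (Y (kap q ℓ) u v) +
      ∑ b ∈ J, hPole q ℓ a b • Y (kap q ℓ) u (pderiv b v) := by
  refine hc_ext fun n => ?_
  rw [hc_add, hc_apply_eq_cf, Y, fieldMap_X_mul, ← Y, SplitField.cf_nprod, hc_sum]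
  congr 1
  · rw [creSeries, hc_opSeries]
    refine finsum_congr fun i => ?_
    rw [hc_apply_eq_cf]
    change _ = (((i + a.2).choose a.2 : ℂ) • cre a.1 (i + a.2)) _
    rw [show n - (genField (kap q ℓ) a).sm - i = n - i from by simp [genField]]
    rfl
  · have h1 : ∀ i : ℕ, cf (Y (kap q ℓ) u) (n + (genField (kap q ℓ) a).sp + i)
        ((genField (kap q ℓ) a).cp i v) = ∑ b ∈ J, if i = b.2 then
          hc (hPole q ℓ a b • Y (kap q ℓ) u (pderiv b v)) n else 0 := by
      intro i
      simp only [genField, LinearMap.smul_apply]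
      rw [kap_eq_pderiv q ℓ a.1 i v J hJ, smul_sum, map_sum]
      refine sum_congr rfl fun b _ => ?_
      split_ifs with h h' h'
      · rw [hPole, hc_single_smul, hc_apply_eq_cf, h, smul_smul, map_smul]
        congr 3
        · rw [add_comm a.2]
        · push_cast
          ring_nf
      · exact absurd h.symm h'
      · exact absurd h'.symm h
      · simp
    simp only [h1]
    have h2 : ∀ b : ℤ × ℕ, ∀ x : Fock, (Function.support fun i : ℕ => if i = b.2 then x else 0).Finite := by
      intro b x
      refine (Set.finite_singleton b.2).subset fun i hi => ?_
      by_contra h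
      exact hi (if_neg h)
    rw [finsum_sum_comm _ _ fun b _ => h2 b _]
    refine sum_congr rfl fun b _ => ?_
    rw [finsum_eq_single _ b.2, if_pos rfl]
    intro i hi
    rw [if_neg hi]

theorem opSeries_add {V V' : Type*} [AddCommGroup V] [Module ℂ V] [AddCommGroup V'] [Module ℂ V']
    (D D' : ℕ → V →ₗ[ℂ] V') (x : HM V) :
    opSeries (fun i => D i + D' i) x = opSeries D x + opSeries D' x := by
  refine hc_ext fun n => ?_
  rw [hc_add, hc_opSeries, hc_opSeries, hc_opSeries,
    ← finsum_add_eventually (opSeries_eventually D x n) (opSeries_eventually D' x n)]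
  rfl

/-- Beyond the factor `C(p+i, p) (-1)^i`, the expression depends on `p` and `i` only through `p +
i`. -/
theorem choose_mul_choose_mul_gconst (r : ℤ) (k p i : ℕ) (c : ℤ × ℕ) :
    ((p + k).choose k : ℂ) * ((i + c.2).choose c.2 : ℂ) * gconst q ℓ (r, p + k) (c.1, i + c.2) =
      ((p + i).choose p * (-1) ^ i) * ((-1) ^ c.2 * ((p + i + k + c.2).factorial /
        ((p + i).factorial * k.factorial * c.2.factorial)) *
          (contrZ q ℓ r c.1).coeff (p + i + k + c.2 : ℕ)) := by
  rw [gconst_eq, ← Nat.choose_symm_add (a := p) (b := k), ← Nat.choose_symm_add (a := i) (b := c.2)]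
  simp only [Nat.cast_add_choose]
  rw [show p + k + (i + c.2) = p + i + k + c.2 by ring, pow_add]
  have h1 : ∀ n : ℕ, (n.factorial : ℂ) ≠ 0 := fun n => by exact_mod_cast n.factorial_ne_zero
  have := h1 p
  have := h1 i
  have := h1 k
  have := h1 c.2
  have := h1 (p + k)
  have := h1 (i + c.2)
  have := h1 (p + i)
  field_simp

/-- The binomial theorem for `(1 - 1)^n`. It expresses translation invariance: shifting both points
by `z` leaves the contraction unchanged. -/
theorem sum_gconst (r : ℤ) (k n : ℕ) (c : ℤ × ℕ) :
    ∑ p ∈ antidiagonal n, ((p.1 + k).choose k : ℂ) * ((p.2 + c.2).choose c.2 : ℂ) *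
      gconst q ℓ (r, p.1 + k) (c.1, p.2 + c.2) = if n = 0 then gconst q ℓ (r, k) c else 0 := by
  rcases n with _ | n
  · simp
  · rw [if_neg (by omega)]
    have h : ∀ p ∈ antidiagonal (n + 1), ((p.1 + k).choose k : ℂ) * ((p.2 + c.2).choose c.2 : ℂ) *
        gconst q ℓ (r, p.1 + k) (c.1, p.2 + c.2) = ((n + 1).choose p.1 • (1 ^ p.1 * (-1 : ℂ) ^ p.2)) *
        ((-1) ^ c.2 * ((n + 1 + k + c.2).factorial /
        ((n + 1).factorial * k.factorial * c.2.factorial)) *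
          (contrZ q ℓ r c.1).coeff (n + 1 + k + c.2 : ℕ)) := by
      intro p hp
      rw [HasAntidiagonal.mem_antidiagonal] at hp
      rw [choose_mul_choose_mul_gconst, hp, one_pow, one_mul, nsmul_eq_mul]
    rw [sum_congr rfl h, ← sum_mul, ← (Commute.all (1 : ℂ) (-1)).add_pow']
    simp

/-- Both series are shifted by the same `z`, so by `sum_gconst` their commutator is the constant
`gconst q ℓ a c`, without higher powers of `z`. -/
theorem contrSeries_creSeries (a c : ℤ × ℕ) (x : HM Fock) :
    contrSeries q ℓ a (creSeries c x) = creSeries c (contrSeries q ℓ a x) +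
      gconst q ℓ a c • x := by
  have h : gconst q ℓ a c • x = hmap (gconst q ℓ a c • LinearMap.id) x :=
    hc_ext fun n => by rw [hc_hmap, hc_base_smul]; rfl
  rw [contrSeries, creSeries, opSeries_opSeries, opSeries_opSeries, h, hmap, ← opSeries_add]
  refine congrArg (fun D => opSeries D x) (funext fun n => ?_)
  rw [← Nat.sum_antidiagonal_swap]
  have e : (if n = 0 then gconst q ℓ a c • LinearMap.id else 0 : Fock →ₗ[ℂ] Fock) =
      (if n = 0 then gconst q ℓ (a.1, a.2) c else 0) • LinearMap.id := by
    split_ifs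
    · rfl
    · rw [zero_smul]
  rw [e, ← sum_gconst, sum_smul, ← Nat.sum_antidiagonal_swap (n := n)
    (f := fun p => (((p.1 + a.2).choose a.2 : ℂ) * ((p.2 + c.2).choose c.2 : ℂ) *
      gconst q ℓ (a.1, p.1 + a.2) (c.1, p.2 + c.2)) • (LinearMap.id : Fock →ₗ[ℂ] Fock)), ← sum_add_distrib]
  refine sum_congr rfl fun p _ => LinearMap.ext fun v => ?_
  simp only [LinearMap.comp_apply, LinearMap.smul_apply, LinearMap.add_apply,
    cre_apply, Prod.fst_swap, Prod.snd_swap, Derivation.coeFn_coe, Derivation.leibniz, contr_X,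
    LinearMap.id_apply, smul_eq_mul, MvPolynomial.smul_eq_C_mul, map_mul, MvPolynomial.derivation_C, mul_zero, add_zero]
  ring

theorem contrSeries_smul (a : ℤ × ℕ) (s : LaurentSeries ℂ) (x : HM Fock) :
    contrSeries q ℓ a (s • x) = s • contrSeries q ℓ a x := opSeries_smul _ _ _

theorem creSeries_smul (a : ℤ × ℕ) (s : LaurentSeries ℂ) (x : HM Fock) :
    creSeries a (s • x) = s • creSeries a x := opSeries_smul _ _ _

/-- The commutator of the contraction series with the fields. -/
theorem contrSeries_Y (a : ℤ × ℕ) (u v : Fock) (J : Finset (ℤ × ℕ))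
    (hJ : ∀ b ∉ J, pderiv b v = 0) : contrSeries q ℓ a (Y (kap q ℓ) u v) =
      Y (kap q ℓ) (contr q ℓ a u) v + ∑ b ∈ J, hReg q ℓ a b • Y (kap q ℓ) u (pderiv b v) := by
  induction u using MvPolynomial.induction_on generalizing v with
  | C s =>
    have h1 : ∀ w, Y (kap q ℓ) (C s) w = idField Fock (s • w) := fun w => by
      rw [Y, fieldMap_C, LinearMap.smul_apply, map_smul]
    rw [MvPolynomial.derivation_C, map_zero, LinearMap.zero_apply, zero_add]
    simp only [h1, ← Derivation.map_smul]
    have hJ' : ∀ b ∉ J, pderiv b (s • v) = 0 := fun b hb => by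
      rw [Derivation.map_smul, hJ b hb, smul_zero]
    clear hJ
    generalize s • v = v at hJ' ⊢
    refine hc_ext fun n => ?_
    rw [hc_sum, contrSeries, hc_opSeries]
    simp only [hReg, hc_powerSeries_smul, PowerSeries.coeff_mk, hc_apply_eq_cf, cf_idField]
    rw [← finsum_sum_comm]
    · refine finsum_congr fun i => ?_
      rw [LinearMap.smul_apply]
      split_ifs with h
      · simp only [Derivation.coeFn_coe, mul_smul, ← smul_sum]
        rw [derivation_eq_sum_pderiv _ _ (contr_X q ℓ (a.1, i + a.2)) v J hJ']
      · simp
    · intro b _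
      refine (Set.finite_singleton n.toNat).subset fun i hi => ?_
      by_contra h
      refine hi ?_
      simp only [Set.mem_singleton_iff] at h
      simp only
      rw [if_neg (by omega), smul_zero]
  | add u u' hu hu' =>
    simp only [map_add, LinearMap.add_apply, hu v hJ, hu' v hJ, smul_add, sum_add_distrib]
    abel
  | mul_X u c hu =>
    have hJ' : ∀ b, ∀ b' ∉ J, pderiv b' (pderiv b v) = 0 := fun b b' hb' => by
      rw [pderiv_comm, hJ b' hb', map_zero]
    rw [mul_comm, Y_X_mul q ℓ c u v J hJ, map_add, contrSeries_creSeries, hu v hJ, map_sum,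
      Derivation.leibniz, contr_X, smul_eq_mul, smul_eq_mul, map_add (Y (kap q ℓ)),
      LinearMap.add_apply, Y_X_mul q ℓ c _ v J hJ, mul_comm u, ← MvPolynomial.smul_eq_C_mul,
      map_smul, LinearMap.smul_apply, map_add (creSeries c), map_sum]
    have key : ∑ b ∈ J, ∑ b' ∈ J, hPole q ℓ c b • hReg q ℓ a b' •
        Y (kap q ℓ) u (pderiv b' (pderiv b v)) = ∑ b' ∈ J, ∑ b ∈ J, hReg q ℓ a b' •
          hPole q ℓ c b • Y (kap q ℓ) u (pderiv b (pderiv b' v)) := by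
      rw [sum_comm]
      refine sum_congr rfl fun b _ => sum_congr rfl fun b' _ => ?_
      rw [pderiv_comm]
      exact HM_smul_comm _ _ _
    simp only [Y_X_mul q ℓ c u _ J (hJ' _), contrSeries_smul, hu _ (hJ' _), creSeries_smul, smul_add,
      sum_add_distrib, smul_sum, key]
    abel

end Fock

end QHeis

namespace QHeis

open VertexOperator (ncoeff)

open MvPolynomial (X C pderiv)

/-! ### Products and iterates of fields, sorted by total degree -/

section Products

variable {W : Type*} [AddCommGroup W] [Module ℂ W]

theorem shiftField_apply (e : ℤ) (A : VertexOperator ℂ W) (w : W) :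
    shiftField e A w = shiftH e (A w) := rfl

/-- The product `A(x₁) B(x₂) w` as a series in `t = x₂ / x₁` whose coefficients are series
indexed by the total degree. -/
def prodH (A B : VertexOperator ℂ W) : W →ₗ[ℂ] HM (HM W) where
  toFun w := mkH (fun n => shiftField n A (cf B n w)) (by
    filter_upwards [cf_eventually B w] with n hn
    rw [hn, map_zero])
  map_add' w w' := hc_ext fun n => by
    rw [hc_add]
    change shiftField n A (cf B n (w + w')) = _
    rw [map_add, map_add]
    rfl
  map_smul' s w := hc_ext fun n => by
    rw [hc_base_smul]
    change shiftField n A (cf B n (s • w)) = _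
    rw [map_smul, map_smul]
    rfl

theorem hc_prodH (A B : VertexOperator ℂ W) (w : W) (n : ℤ) :
    hc (prodH A B w) n = shiftField n A (cf B n w) := rfl

theorem hc_hc_prodH (A B : VertexOperator ℂ W) (w : W) (n d : ℤ) :
    hc (hc (prodH A B w) n) d = cf A (d - n) (cf B n w) := rfl

theorem prodH_add (A A' B : VertexOperator ℂ W) (w : W) :
    prodH (A + A') B w = prodH A B w + prodH A' B w :=
  hc_ext fun n => by
    rw [hc_add, hc_prodH, hc_prodH, hc_prodH, map_add]
    rfl

/-- The coefficients of the multiplication by `e^{-dz}` in degree `d`. -/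
def twistCoeff (i : ℕ) : HM W →ₗ[ℂ] HM W where
  toFun x := mkH (fun d => expCoeff (-d) i • hc x d) (by
    filter_upwards [hc_eventually x] with d hd
    rw [hd, smul_zero])
  map_add' x y := hc_ext fun d => smul_add _ _ _
  map_smul' s x := hc_ext fun d => smul_comm _ s _

theorem hc_twistCoeff (i : ℕ) (x : HM W) (d : ℤ) :
    hc (twistCoeff i x) d = expCoeff (-d) i • hc x d := rfl

/-- Multiplication by `e^{-dz}` in degree `d`. -/
def twist : HM (HM W) →ₗ[ℂ] HM (HM W) := opSeries twistCoeff

theorem twist_smul (s : LaurentSeries ℂ) (x : HM (HM W)) : twist (s • x) = s • twist x :=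
  opSeries_smul _ s x

/-- The Taylor series of `(x∂)^k / k!` on `x^e` at the point `x e^z` sums to `(e^k / k!) e^{ez}
x^e`, where `e` is the exponent. -/
theorem choose_mul_pow_div (e : ℂ) (j k : ℕ) : ((j + k).choose k : ℂ) * (e ^ (j + k) / (j + k).factorial) =
    e ^ k / k.factorial * (e ^ j / j.factorial) := by
  rw [← Nat.choose_symm_add, Nat.cast_add_choose, pow_add]
  have h1 : ((j + k).factorial : ℂ) ≠ 0 := by exact_mod_cast (j + k).factorial_ne_zero
  field_simp

theorem hmap_opSeries {V V' V'' : Type*} [AddCommGroup V] [Module ℂ V] [AddCommGroup V']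
    [Module ℂ V'] [AddCommGroup V''] [Module ℂ V''] (L : V' →ₗ[ℂ] V'') (D : ℕ → V →ₗ[ℂ] V')
    (x : HM V) : hmap L (opSeries D x) = opSeries (fun i => L ∘ₗ D i) x :=
  hc_ext fun n => by
    rw [hc_hmap, hc_opSeries, hc_opSeries, map_finsum_eventually L (opSeries_eventually D x n)]
    rfl

/-- The twist intertwines the Taylor series of an operator of degree `e` with the operator. -/
theorem twist_opSeries_shiftH (e : ℤ) (k : ℕ) (x : HM (HM W)) :
    twist (opSeries (fun i => (((i + k).choose k : ℂ) * ((e : ℂ) ^ (i + k) / (i + k).factorial)) •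
      shiftH e) x) = ((e : ℂ) ^ k / k.factorial) • hmap (shiftH e) (twist x) := by
  rw [twist, opSeries_opSeries, hmap_opSeries, ← LinearMap.smul_apply]
  have h : ∀ (s : ℂ) (D : ℕ → HM W →ₗ[ℂ] HM W), s • opSeries D = opSeries fun i => s • D i := by
    intro s D
    refine LinearMap.ext fun x => hc_ext fun n => ?_
    rw [LinearMap.smul_apply, hc_base_smul, hc_opSeries, hc_opSeries,
      smul_finsum_eventually _ (opSeries_eventually D x n)]
    rfl
  rw [h]
  refine congrArg (fun D => opSeries D x) (funext fun n => LinearMap.ext fun y => hc_ext fun d => ?_)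
  rw [LinearMap.sum_apply, hc_sum]
  simp only [LinearMap.comp_apply, LinearMap.smul_apply, hc_twistCoeff, hc_base_smul, hc_shiftH,
    choose_mul_pow_div, smul_smul]
  rw [← sum_smul, show -(d - e) = -d + e by ring, ← sum_expCoeff, mul_sum]
  refine congrArg (· • _) (sum_congr rfl fun p _ => ?_)
  rw [expCoeff, expCoeff]
  ring

end Products

/-! ### Matching recursions for products and iterates on the restricted module -/

section Recursions

variable {q : ℂ} {W : Type*} [AddCommGroup W] [Module ℂ W]
  [LieRingModule (QHeisenberg q) W] [LieModule ℂ (QHeisenberg q) W]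
  (hW : IsRestricted q W) {ℓ : ℂ} (hℓ : HasLevel q W ℓ) (hq0 : q ≠ 0)

/-- A creation mode `i` raises the degree by `i + 1`, and its Taylor series contributes
`e^{(i+1)z}`. The change of `e^{-dz}` in the twist cancels this factor. -/
theorem twist_opSeries_cmOp (a : ℤ × ℕ) (x : HM (HM W)) :
    twist (opSeries (fun i => ((i + a.2).choose a.2 : ℂ) • (βSplit hW (a.1, i + a.2)).cmOp) x) =
      hmap (βSplit hW a).cmOp (twist x) := by
  rw [twist, opSeries_opSeries, hmap_opSeries]
  refine congrArg (fun D => opSeries D x) (funext fun n => LinearMap.ext fun y => hc_ext fun d => ?_)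
  rw [LinearMap.sum_apply, hc_sum, LinearMap.comp_apply, SplitField.hc_cmOp]
  have h0 : ∀ j : ℕ, ∀ᶠ i : ℕ in atTop, (βSplit hW (a.1, j)).cm i (hc y (d - 1 - i)) = 0 := by
    intro j
    filter_upwards [hc_sub_eventually y (d - 1)] with i hi
    rw [hi, map_zero]
  have h1 : ∀ p : ℕ × ℕ, hc ((twistCoeff p.1 ∘ₗ
      (((p.2 + a.2).choose a.2 : ℂ) • (βSplit hW (a.1, p.2 + a.2)).cmOp)) y) d = ∑ᶠ i : ℕ,
        (expCoeff (-d) p.1 * ((p.2 + a.2).choose a.2 : ℂ)) •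
          (βSplit hW (a.1, p.2 + a.2)).cm i (hc y (d - 1 - i)) := by
    intro p
    rw [← smul_finsum_eventually _ (h0 _), LinearMap.comp_apply, hc_twistCoeff,
      LinearMap.smul_apply, hc_base_smul, smul_smul]
    rfl
  simp only [h1]
  rw [← finsum_sum_comm]
  · refine finsum_congr fun i => ?_
    change _ = (βSplit hW a).cm i (expCoeff (-(d - 1 - i)) n • hc y (d - 1 - i))
    simp only [βSplit, LinearMap.smul_apply, map_smul, smul_smul]
    rw [← sum_smul, show -(d - 1 - i) = -d + (i + 1) by ring, ← sum_expCoeff, sum_mul]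
    refine congrArg (· • _) (sum_congr rfl fun p _ => ?_)
    have h := choose_mul_pow_div ((i : ℂ) + 1) p.2 a.2
    simp only [expCoeff] at h ⊢
    push_cast
    linear_combination ((-(d : ℂ)) ^ p.1 / p.1.factorial * q ^ (a.1 * ((i : ℤ) + 1))) * h
  · intro p _
    refine hasFiniteSupport_of_eventually ?_
    filter_upwards [h0 (p.2 + a.2)] with i hi
    rw [hi, smul_zero]

/-- The iterate `Y_W(Y(u, z) v, x) w`, twisted by `e^{-dz}` in degree `d`. -/
def iterH (u v : Fock) : W →ₗ[ℂ] HM (HM W) where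
  toFun w := twist (hmap ((quasiY hW hℓ hq0).flip w) (Fock.Y (kap q ℓ) u v))
  map_add' w w' := by
    rw [← map_add]
    refine congrArg twist (hc_ext fun n => ?_)
    simp only [hc_add, hc_hmap, map_add, LinearMap.add_apply]
  map_smul' s w := by
    rw [RingHom.id_apply, ← map_smul]
    refine congrArg twist (hc_ext fun n => ?_)
    simp only [hc_base_smul, hc_hmap, map_smul, LinearMap.smul_apply]

theorem iterH_apply (u v : Fock) (w : W) : iterH hW hℓ hq0 u v w =
    twist (hmap ((quasiY hW hℓ hq0).flip w) (Fock.Y (kap q ℓ) u v)) := rfl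

/-- The normally ordered product with a split field, on series sorted by total degree. -/
def nprodH (c : SplitField W) (Z : W →ₗ[ℂ] HM (HM W)) (w : W) : HM (HM W) :=
  hmap c.cmOp (Z w) + ∑ᶠ i : ℕ, hmap (shiftH (-c.sp - i)) (Z (c.cp i w))

theorem nprodH_eventually (c : SplitField W) (Z : W →ₗ[ℂ] HM (HM W)) (w : W) :
    ∀ᶠ i : ℕ in atTop, hmap (shiftH (-c.sp - i)) (Z (c.cp i w)) = 0 := by
  filter_upwards [c.eventually_cp w] with i hi
  rw [hi, map_zero, map_zero]

/-- The annihilation part of the field of `a` is moved to the right through the field of `v` by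
`cp_quasiY`. The commutators assemble into multiplication by the contractions in `t`. -/
theorem prodH_X_mul (a : ℤ × ℕ) (u v : Fock) (J : Finset (ℤ × ℕ)) (hJ : ∀ b ∉ J, pderiv b v = 0)
    (w : W) : prodH (quasiY hW hℓ hq0 (X a * u)) (quasiY hW hℓ hq0 v) w =
      nprodH (βSplit hW a) (prodH (quasiY hW hℓ hq0 u) (quasiY hW hℓ hq0 v)) w +
      ∑ b ∈ J, hT q ℓ a b • prodH (quasiY hW hℓ hq0 u) (quasiY hW hℓ hq0 (pderiv b v)) w +
      prodH (quasiY hW hℓ hq0 (Fock.contr q ℓ a u)) (quasiY hW hℓ hq0 v) w := by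
  rw [quasiY_X_mul, prodH_add]
  congr 1
  refine hc_ext fun n => ?_
  rw [nprodH, hc_add, hc_add, finsum_hc (nprodH_eventually _ _ w), hc_sum, hc_prodH, hc_hmap,
    ← SplitField.nprod_shiftField, SplitField.nprod_apply, ← hc_prodH, add_assoc]
  congr 1
  have h1 : ∀ b, hc (hT q ℓ a b • prodH (quasiY hW hℓ hq0 u) (quasiY hW hℓ hq0 (pderiv b v)) w) n =
      ∑ᶠ p : ℕ, (hT q ℓ a b).coeff p •
        hc (prodH (quasiY hW hℓ hq0 u) (quasiY hW hℓ hq0 (pderiv b v)) w) (n - p) := by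
    intro b
    rw [hc_smul _ 0 fun e he => hT_coeff_of_neg q ℓ a b e (by omega)]
    simp only [sub_zero, add_zero]
  have h2 : ∀ b, ∀ᶠ p : ℕ in atTop, (hT q ℓ a b).coeff p •
      hc (prodH (quasiY hW hℓ hq0 u) (quasiY hW hℓ hq0 (pderiv b v)) w) (n - p) = 0 := by
    intro b
    filter_upwards [hc_sub_eventually (prodH (quasiY hW hℓ hq0 u)
      (quasiY hW hℓ hq0 (pderiv b v)) w) n] with p hp
    rw [hp]
    exact smul_zero _
  simp only [h1]
  rw [← finsum_sum_comm _ _ fun b _ => hasFiniteSupport_of_eventually (h2 b),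
    ← finsum_add_eventually]
  · refine finsum_congr fun p => ?_
    rw [cp_quasiY hW hℓ hq0 a p v J hJ, map_add, map_add, hc_hmap, hc_prodH, map_sum, map_sum]
    congr 1
    refine sum_congr rfl fun b _ => ?_
    -- The commutator lowers the second exponent by `p`, and the shift by `-p` restores the
    -- bookkeeping: the term lies at exponent `n - p` of `t` in the same total degree.
    rw [map_smul, map_smul, hc_prodH]
    congr 1
    refine hc_ext fun d => ?_
    rw [hc_shiftH, shiftField_apply, shiftField_apply, hc_shiftH, hc_shiftH]
    rw [show d - (-(βSplit hW a).sp - (p : ℤ)) - n = d - (n - p) by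
      change d - (-0 - (p : ℤ)) - n = d - (n - p)
      ring]
  · filter_upwards [nprodH_eventually (βSplit hW a)
      (prodH (quasiY hW hℓ hq0 u) (quasiY hW hℓ hq0 v)) w] with i hi
    rw [hi]
    rfl
  · filter_upwards [(Filter.eventually_all_finset J).2 fun b _ => h2 b] with p hp
    exact sum_eq_zero hp

/-- Apply `quasiY_X_mul` to every variable `X (a.1, i + a.2)` of the creation series. The binomial
weights make the creation and annihilation parts Taylor series, and the contractions assemble into
`contrSeries`. -/
theorem hmap_creSeries (a : ℤ × ℕ) (x : HM Fock) (w : W) :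
    hmap ((quasiY hW hℓ hq0).flip w) (Fock.creSeries a x) =
      opSeries (fun i => ((i + a.2).choose a.2 : ℂ) • (βSplit hW (a.1, i + a.2)).cmOp)
        (hmap ((quasiY hW hℓ hq0).flip w) x) +
      ∑ᶠ p : ℕ, opSeries (fun i => (((i + a.2).choose a.2 : ℂ) *
        (((-p : ℤ) : ℂ) ^ (i + a.2) / (i + a.2).factorial)) • shiftH (-p : ℤ))
        (hmap ((quasiY hW hℓ hq0).flip ((βSplit hW (a.1, 0)).cp p w)) x) +
      hmap ((quasiY hW hℓ hq0).flip w) (Fock.contrSeries q ℓ a x) := by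
  have e0 : ∀ᶠ p : ℕ in atTop, (βSplit hW (a.1, 0)).cp p w = 0 :=
    (βSplit hW (a.1, 0)).eventually_cp w
  have hcp : ∀ (p j : ℕ) (w : W), (βSplit hW (a.1, j)).cp p w =
      (((-p : ℤ) : ℂ) ^ j / j.factorial) • (βSplit hW (a.1, 0)).cp p w := by
    intro p j w
    simp only [βSplit, LinearMap.smul_apply, smul_smul]
    push_cast
    simp
  set Q := quasiY hW hℓ hq0 with hQ
  have eB : ∀ᶠ p : ℕ in atTop, opSeries (fun i => (((i + a.2).choose a.2 : ℂ) *
        (((-p : ℤ) : ℂ) ^ (i + a.2) / (i + a.2).factorial)) • shiftH (-p : ℤ))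
        (hmap (Q.flip ((βSplit hW (a.1, 0)).cp p w)) x) = 0 := by
    filter_upwards [e0] with p hp
    rw [hp, map_zero, hmap]
    refine hc_ext fun n => ?_
    rw [hc_opSeries, finsum_eq_zero_of_forall_eq_zero]
    · rfl
    · intro i
      rw [hc_opSeries, finsum_eq_zero_of_forall_eq_zero, map_zero]
      intro j
      split_ifs <;> rfl
  refine hc_ext fun n => ?_
  rw [hc_add, hc_add, finsum_hc eB, Fock.creSeries, Fock.contrSeries, hmap_opSeries, hmap_opSeries]
  simp only [hc_opSeries, hc_hmap, LinearMap.comp_apply, LinearMap.smul_apply, map_smul,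
    LinearMap.flip_apply, Fock.cre_apply]
  have ex := hc_sub_eventually x n
  have hB : VanishesFar fun i p : ℕ => (((i + a.2).choose a.2 : ℂ) *
      (((-p : ℤ) : ℂ) ^ (i + a.2) / (i + a.2).factorial)) • shiftH (-p : ℤ)
        (Q (hc x (n - i)) ((βSplit hW (a.1, 0)).cp p w)) := by
    refine vanishesFar_of_eventually ?_ fun i => ?_
    · filter_upwards [ex] with i hi p
      rw [hi, map_zero, LinearMap.zero_apply, map_zero]
      exact smul_zero _
    · filter_upwards [e0] with p hp
      rw [hp, map_zero, map_zero]
      exact smul_zero _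
  rw [← hB.finsum_comm, ← finsum_add_eventually _ hB.finsum_left, ← finsum_add_eventually]
  · refine finsum_congr fun i => ?_
    have h := quasiY_X_mul hW hℓ hq0 (a.1, i + a.2) (hc x (n - i))
    rw [← hQ] at h
    rw [h, LinearMap.add_apply, SplitField.nprod_apply, smul_add, smul_add]
    congr 2
    rw [smul_finsum_eventually _ (SplitField.nprod_apply_eventually _ _ _)]
    refine finsum_congr fun p => ?_
    rw [hcp, map_smul, map_smul, smul_smul]
    congr 2
    change shiftH (-0 - (p : ℤ)) = _
    rw [neg_zero, zero_sub]
  · filter_upwards [ex, hB.finsum_left] with i h1 h2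
    rw [h2, h1, map_zero, LinearMap.zero_apply, map_zero, add_zero]
    exact smul_zero _
  · filter_upwards [ex] with i h1
    rw [h1, map_zero, map_zero, LinearMap.zero_apply]
    exact smul_zero _
  · filter_upwards [ex] with i h1
    rw [h1, map_zero, LinearMap.zero_apply, map_zero]
    exact smul_zero _

/-- The twist turns the Taylor series of `hmap_creSeries` into the plain normally ordered product.
The poles of `Y_X_mul` and the regular terms of `contrSeries_Y` add up to `hZ`, so the result has
the shape of `prodH_X_mul`. -/
theorem iterH_X_mul (hq : ∀ n : ℕ, 0 < n → q ^ n ≠ 1) (a : ℤ × ℕ) (u v : Fock)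
    (J : Finset (ℤ × ℕ)) (hJ : ∀ b ∉ J, pderiv b v = 0) (w : W) :
    iterH hW hℓ hq0 (X a * u) v w = nprodH (βSplit hW a) (iterH hW hℓ hq0 u v) w +
      ∑ b ∈ J, hZ q ℓ a b • iterH hW hℓ hq0 u (pderiv b v) w +
      iterH hW hℓ hq0 (Fock.contr q ℓ a u) v w := by
  have hcp : ∀ (p : ℕ) (w : W), (βSplit hW a).cp p w =
      (((-p : ℤ) : ℂ) ^ a.2 / a.2.factorial) • (βSplit hW (a.1, 0)).cp p w := by
    intro p w
    simp only [βSplit, LinearMap.smul_apply, smul_smul]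
    push_cast
    simp
  have key : twist (hmap ((quasiY hW hℓ hq0).flip w) (Fock.creSeries a (Fock.Y (kap q ℓ) u v))) =
      nprodH (βSplit hW a) (iterH hW hℓ hq0 u v) w +
      twist (hmap ((quasiY hW hℓ hq0).flip w) (Fock.contrSeries q ℓ a (Fock.Y (kap q ℓ) u v))) := by
    rw [hmap_creSeries, map_add, map_add, twist_opSeries_cmOp]
    congr 1
    rw [nprodH]
    congr 1
    rw [map_finsum_eventually]
    · refine finsum_congr fun p => ?_
      rw [twist_opSeries_shiftH, hcp, map_smul, map_smul]
      congr 2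
      change _ = hmap (shiftH (-0 - (p : ℤ)))
      rw [neg_zero, zero_sub]
    · filter_upwards [(βSplit hW (a.1, 0)).eventually_cp w] with p hp
      rw [hp]
      have : hmap ((quasiY hW hℓ hq0).flip 0) (Fock.Y (kap q ℓ) u v) = 0 := by
        refine hc_ext fun n => ?_
        rw [hc_hmap, map_zero]
        rfl
      rw [this, map_zero]
  have hs : ∑ b ∈ J, hZ q ℓ a b • iterH hW hℓ hq0 u (pderiv b v) w =
      twist (hmap ((quasiY hW hℓ hq0).flip w)
        (∑ b ∈ J, Fock.hPole q ℓ a b • Fock.Y (kap q ℓ) u (pderiv b v))) +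
      twist (hmap ((quasiY hW hℓ hq0).flip w)
        (∑ b ∈ J, Fock.hReg q ℓ a b • Fock.Y (kap q ℓ) u (pderiv b v))) := by
    rw [map_sum, map_sum, map_sum, map_sum, ← sum_add_distrib]
    refine sum_congr rfl fun b _ => ?_
    rw [hmap_smul, hmap_smul, twist_smul, twist_smul, ← Fock.hPole_add_hReg q ℓ hq a b]
    exact add_smul _ _ _
  rw [iterH_apply, Fock.Y_X_mul q ℓ a u v J hJ, map_add, map_add, key,
    Fock.contrSeries_Y q ℓ a u v J hJ, map_add, map_add, ← iterH_apply, hs]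
  abel

end Recursions

end QHeis

namespace QHeis

open VertexOperator (ncoeff)

open MvPolynomial (X C pderiv)

/-! ### Simultaneous regularity of products and iterates -/

section Regular

variable {W : Type*} [AddCommGroup W] [Module ℂ W]

/-- In every degree `d`, `x` is a Laurent polynomial in `t` with exponents in `[N, d - N]`, and
`y` is its value at `t = e^{-z}`. -/
def IsRegularPair (x y : HM (HM W)) : Prop :=
  ∃ N : ℤ, (∀ n d : ℤ, n < N ∨ d - N < n → hc (hc x n) d = 0) ∧
    ∀ i d : ℤ, hc (hc y i) d =
      if 0 ≤ i then ∑ᶠ n : ℤ, expCoeff (-n) i.toNat • hc (hc x n) d else 0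

theorem finite_support_of_vanish {M : Type*} [Zero M] {f : ℤ → M} {a b : ℤ}
    (h : ∀ n, n < a ∨ b < n → f n = 0) : f.HasFiniteSupport := by
  refine (Set.finite_Icc a b).subset fun n hn => ?_
  by_contra hlt
  refine hn (h n ?_)
  simp only [Set.mem_Icc, not_and_or, not_le] at hlt
  exact hlt

theorem finsum_eq_sum_Icc {M : Type*} [AddCommMonoid M] {f : ℤ → M} {a b : ℤ}
    (h : ∀ n, n < a ∨ b < n → f n = 0) : ∑ᶠ n, f n = ∑ n ∈ Finset.Icc a b, f n := by
  refine finsum_eq_sum_of_support_subset _ fun n hn => ?_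
  by_contra hlt
  refine hn (h n ?_)
  simp only [coe_Icc, Set.mem_Icc, not_and_or, not_le] at hlt
  exact hlt

theorem IsRegularPair.zero : IsRegularPair (0 : HM (HM W)) 0 := by
  refine ⟨0, fun n d _ => rfl, fun i d => ?_⟩
  have : ∀ n : ℤ, expCoeff (-n) i.toNat • hc (hc (0 : HM (HM W)) n) d = 0 := fun n => smul_zero _
  simp only [this, finsum_zero, ite_self]
  rfl

theorem IsRegularPair.add {x y x' y' : HM (HM W)} (h : IsRegularPair x y)
    (h' : IsRegularPair x' y') : IsRegularPair (x + x') (y + y') := by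
  obtain ⟨N, h1, h2⟩ := h
  obtain ⟨N', h1', h2'⟩ := h'
  refine ⟨min N N', fun n d hn => ?_, fun i d => ?_⟩
  · rw [hc_add, hc_add, h1 n d (by omega), h1' n d (by omega), add_zero]
  · rw [hc_add, hc_add, h2, h2']
    split_ifs
    · rw [← finsum_add_distrib]
      · simp only [hc_add, smul_add]
      · exact finite_support_of_vanish (a := N) (b := d - N) fun n hn => by
          rw [h1 n d hn, smul_zero]
      · exact finite_support_of_vanish (a := N') (b := d - N') fun n hn => by
          rw [h1' n d hn, smul_zero]
    · rw [add_zero]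

theorem IsRegularPair.sum {ι : Type*} (J : Finset ι) {x y : ι → HM (HM W)}
    (h : ∀ b ∈ J, IsRegularPair (x b) (y b)) : IsRegularPair (∑ b ∈ J, x b) (∑ b ∈ J, y b) := by
  classical
  induction J using Finset.induction_on with
  | empty => exact IsRegularPair.zero
  | insert b J hb ih =>
    rw [sum_insert hb, sum_insert hb]
    exact (h b (mem_insert_self b J)).add (ih fun c hc => h c (mem_insert_of_mem hc))

theorem IsRegularPair.shiftH {x y : HM (HM W)} (h : IsRegularPair x y) (e : ℤ) :
    IsRegularPair (hmap (shiftH e) x) (hmap (QHeis.shiftH e) y) := by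
  obtain ⟨N, h1, h2⟩ := h
  -- The degree moves by `e` while the exponent of `t` stays, so widening the window by `|e|`
  -- suffices for either sign.
  refine ⟨N - |e|, fun n d hn => ?_, fun i d => ?_⟩
  · rw [hc_hmap, hc_shiftH]
    have := neg_abs_le e
    have := le_abs_self e
    exact h1 _ _ (by omega)
  · simp only [hc_hmap, hc_shiftH, h2]

/-- Creation modes with nonnegative offset only raise the degree, so the window for the exponents of
`t` stays valid with the same `N`. -/
theorem IsRegularPair.cmOp {x y : HM (HM W)} (h : IsRegularPair x y) (c : SplitField W)
    (hc0 : 0 ≤ c.sm) : IsRegularPair (hmap c.cmOp x) (hmap c.cmOp y) := by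
  obtain ⟨N, h1, h2⟩ := h
  refine ⟨N, fun n d hn => ?_, fun i d => ?_⟩
  · rw [hc_hmap, c.hc_cmOp]
    refine finsum_eq_zero_of_forall_eq_zero fun i => ?_
    rw [h1 _ _ (by omega), map_zero]
  · simp only [hc_hmap, c.hc_cmOp, h2]
    split_ifs with hi
    · have e1 : ∀ m : ℕ, ∑ᶠ n : ℤ, expCoeff (-n) i.toNat • hc (hc x n) (d - c.sm - m) =
          ∑ n ∈ Finset.Icc N (d - N), expCoeff (-n) i.toNat • hc (hc x n) (d - c.sm - m) := by
        intro m
        refine finsum_eq_sum_Icc fun n hn => ?_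
        rw [h1 _ _ (by omega), smul_zero]
      have e2 : ∀ n : ℤ, ∀ᶠ m : ℕ in atTop, c.cm m (hc (hc x n) (d - c.sm - m)) = 0 := by
        intro n
        filter_upwards [hc_sub_eventually (hc x n) (d - c.sm)] with m hm
        rw [hm, map_zero]
      rw [finsum_eq_sum_Icc (a := N) (b := d - N)]
      · simp only [e1, map_sum, map_smul]
        rw [finsum_sum_comm]
        · exact sum_congr rfl fun n _ => (smul_finsum_eventually _ (e2 n)).symm
        · intro n _
          refine hasFiniteSupport_of_eventually ?_
          filter_upwards [e2 n] with m hm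
          rw [hm, smul_zero]
      · intro n hn
        rw [finsum_eq_zero_of_forall_eq_zero, smul_zero]
        intro m
        rw [h1 _ _ (by omega), map_zero]
    · simp

theorem hc_expL_smul_of_nonneg {V : Type*} [AddCommGroup V] [Module ℂ V] (m : ℤ) (y : HM V)
    (hy : ∀ i < 0, hc y i = 0) (i : ℕ) : hc (expL m • y) i =
      ∑ p ∈ antidiagonal i, expCoeff m p.1 • hc y p.2 := by
  rw [expL, hc_powerSeries_smul, finsum_eq_sum_range (n := i + 1),
    Nat.sum_antidiagonal_eq_sum_range_succ (fun a b => expCoeff m a • hc y b)]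
  · refine sum_congr rfl fun j hj => ?_
    rw [mem_range] at hj
    rw [coeff_expS, Nat.cast_sub (by omega)]
  · intro j hj
    rw [hy _ (by omega), smul_zero]

theorem hc_expL_smul_of_neg {V : Type*} [AddCommGroup V] [Module ℂ V] (m : ℤ) (y : HM V)
    (hy : ∀ i < 0, hc y i = 0) (i : ℤ) (hi : i < 0) : hc (expL m • y) i = 0 := by
  rw [expL, hc_powerSeries_smul]
  refine finsum_eq_zero_of_forall_eq_zero fun j => ?_
  rw [hy _ (by omega), smul_zero]

/-- Multiplication by `t` is multiplication by `e^{-z}` after substitution; the window moves by one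
at its upper end. -/
theorem IsRegularPair.tvar_smul {x y : HM (HM W)} (h : IsRegularPair x y) :
    IsRegularPair (tvar • x) (expL (-1) • y) := by
  obtain ⟨N, h1, h2⟩ := h
  have hx : ∀ n d, hc (hc (tvar • x) n) d = hc (hc x (n - 1)) d := by
    intro n d
    rw [hc_single_smul, hc_base_smul, one_smul]
  have hy : ∀ i < 0, hc y i = 0 := fun i hi => hc_ext fun d => by
    rw [h2, if_neg (by omega)]
    rfl
  refine ⟨N - 1, fun n d hn => ?_, fun i d => ?_⟩
  · rw [hx, h1 _ _ (by omega)]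
  · split_ifs with hi
    · obtain ⟨k, rfl⟩ := Int.eq_ofNat_of_zero_le hi
      rw [hc_expL_smul_of_nonneg _ _ hy, hc_sum]
      simp only [hc_base_smul, h2, hx, Int.toNat_natCast, Nat.cast_nonneg, if_true]
      have e1 : ∀ j : ℕ, ∑ᶠ n : ℤ, expCoeff (-n) j • hc (hc x n) d =
          ∑ n ∈ Finset.Icc N (d - N), expCoeff (-n) j • hc (hc x n) d := fun j =>
        finsum_eq_sum_Icc fun n hn => by rw [h1 _ _ hn, smul_zero]
      have e2 : ∑ᶠ n : ℤ, expCoeff (-n) k • hc (hc x (n - 1)) d =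
          ∑ᶠ n : ℤ, expCoeff (-(n + 1)) k • hc (hc x n) d := by
        rw [← finsum_comp_equiv (Equiv.addRight (1 : ℤ))]
        refine finsum_congr fun n => ?_
        simp
      rw [e2, finsum_eq_sum_Icc (a := N) (b := d - N) fun n hn => by rw [h1 _ _ hn, smul_zero]]
      simp only [e1, smul_sum, smul_smul]
      rw [sum_comm]
      refine sum_congr rfl fun n _ => ?_
      rw [← sum_smul, sum_expCoeff, neg_add, add_comm]
    · rw [hc_expL_smul_of_neg _ _ hy _ (by omega)]
      rfl

theorem IsRegularPair.C_smul {x y : HM (HM W)} (h : IsRegularPair x y) (s : ℂ) :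
    IsRegularPair ((HahnSeries.C s : LaurentSeries ℂ) • x)
      ((HahnSeries.C s : LaurentSeries ℂ) • y) := by
  obtain ⟨N, h1, h2⟩ := h
  have hx : ∀ (x : HM (HM W)) n d, hc (hc ((HahnSeries.C s : LaurentSeries ℂ) • x) n) d =
      s • hc (hc x n) d := by
    intro x n d
    rw [HahnSeries.C_apply, hc_single_smul, hc_base_smul, sub_zero]
  refine ⟨N, fun n d hn => ?_, fun i d => ?_⟩
  · rw [hx, h1 _ _ hn, smul_zero]
  · simp only [hx, h2]
    split_ifs with hi
    · rw [smul_finsum' s (finite_support_of_vanish (a := N) (b := d - N) fun n hn => by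
        rw [h1 _ _ hn, smul_zero])]
      exact finsum_congr fun n => smul_comm _ _ _
    · rw [smul_zero]

theorem HM_add_smul {V : Type*} [AddCommGroup V] [Module ℂ V] (s t : LaurentSeries ℂ) (x : HM V) :
    (s + t) • x = s • x + t • x := add_smul s t x

theorem IsRegularPair.evalL_smul {x y : HM (HM W)} (h : IsRegularPair x y) (P : Polynomial ℂ) :
    IsRegularPair (evalL tvar P • x) (evalL (expL (-1)) P • y) := by
  induction P using Polynomial.induction_on with
  | C s =>
    rw [evalL_C, evalL_C]
    exact h.C_smul s
  | add P Q hP hQ =>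
    rw [map_add, map_add, HM_add_smul, HM_add_smul]
    exact hP.add hQ
  | monomial n s hn =>
    rw [pow_succ', mul_left_comm, map_mul, map_mul _ Polynomial.X, evalL_X, evalL_X,
      ← HM_smul_smul, ← HM_smul_smul]
    exact hn.tvar_smul

/-- After multiplication by one nonzero polynomial, all pairs of vectors are regular. -/
def IsGoodPair (x y : W → HM (HM W)) : Prop :=
  ∃ π : Polynomial ℂ, π ≠ 0 ∧ ∀ w, IsRegularPair (evalL tvar π • x w) (evalL (expL (-1)) π • y w)

theorem IsGoodPair.zero : IsGoodPair (0 : W → HM (HM W)) 0 := by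
  refine ⟨1, one_ne_zero, fun w => ?_⟩
  simp only [Pi.zero_apply]
  have h : ∀ s : LaurentSeries ℂ, s • (0 : HM (HM W)) = 0 := fun s => smul_zero s
  rw [h, h]
  exact IsRegularPair.zero

theorem IsGoodPair.add {x y x' y' : W → HM (HM W)} (h : IsGoodPair x y)
    (h' : IsGoodPair x' y') : IsGoodPair (x + x') (y + y') := by
  obtain ⟨π, hπ, h⟩ := h
  obtain ⟨π', hπ', h'⟩ := h'
  refine ⟨π * π', mul_ne_zero hπ hπ', fun w => ?_⟩
  have e : ∀ (τ : LaurentSeries ℂ) (a b : HM (HM W)), evalL τ (π * π') • (a + b) =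
      evalL τ π' • evalL τ π • a + evalL τ π • evalL τ π' • b := by
    intro τ a b
    rw [HM_smul_smul, HM_smul_smul, map_mul, mul_comm (evalL τ π')]
    exact smul_add _ _ _
  rw [Pi.add_apply, Pi.add_apply, e, e]
  exact ((h w).evalL_smul π').add ((h' w).evalL_smul π)

theorem IsGoodPair.sum {ι : Type*} (J : Finset ι) {x y : ι → W → HM (HM W)}
    (h : ∀ b ∈ J, IsGoodPair (x b) (y b)) : IsGoodPair (∑ b ∈ J, x b) (∑ b ∈ J, y b) := by
  classical
  induction J using Finset.induction_on with
  | empty => exact IsGoodPair.zero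
  | insert b J hb ih =>
    rw [sum_insert hb, sum_insert hb]
    exact (h b (mem_insert_self b J)).add (ih fun c hc => h c (mem_insert_of_mem hc))

/-- Adding the denominator of the rational function to the clearing polynomial leaves multiplication
by its numerator on both sides. -/
theorem IsGoodPair.smul {x y : W → HM (HM W)} (h : IsGoodPair x y) {a b : LaurentSeries ℂ}
    (hab : IsRat a b) : IsGoodPair (fun w => a • x w) (fun w => b • y w) := by
  obtain ⟨π, hπ, h⟩ := h
  obtain ⟨p, P, hp, h1, h2⟩ := hab
  refine ⟨p * π, mul_ne_zero hp hπ, fun w => ?_⟩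
  have e : ∀ (τ s : LaurentSeries ℂ) (m : HM (HM W)), evalL τ p * s = evalL τ P →
      evalL τ (p * π) • s • m = evalL τ P • evalL τ π • m := by
    intro τ s m hs
    rw [HM_smul_smul, HM_smul_smul, map_mul, mul_right_comm, hs]
  rw [e _ _ _ h1, e _ _ _ h2]
  exact (h w).evalL_smul P

theorem IsRegularPair.nprodH {x y : W →ₗ[ℂ] HM (HM W)} {s t : LaurentSeries ℂ}
    (h : ∀ w, IsRegularPair (s • x w) (t • y w)) (c : SplitField W) (hc0 : 0 ≤ c.sm) (w : W) :
    IsRegularPair (s • nprodH c x w) (t • QHeis.nprodH c y w) := by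
  obtain ⟨P, hP⟩ := eventually_atTop.1 (c.eventually_cp w)
  have e : ∀ (s : LaurentSeries ℂ) (x : W →ₗ[ℂ] HM (HM W)), s • QHeis.nprodH c x w =
      hmap c.cmOp (s • x w) + ∑ i ∈ range P, hmap (QHeis.shiftH (-c.sp - i)) (s • x (c.cp i w)) := by
    intro s x
    rw [QHeis.nprodH, finsum_eq_sum_range (n := P) fun i hi => by rw [hP i hi, map_zero, map_zero]]
    simp only [hmap_smul]
    refine (smul_add s _ _).trans ?_
    congr 1
    exact smul_sum
  rw [e, e]
  exact ((h w).cmOp c hc0).add (IsRegularPair.sum _ fun i _ => (h _).shiftH _)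

/-- The normally ordered product at `w` involves the vectors `c.cp i w`, so the clearing polynomial
must not depend on the vector. The bound `N` may depend on it, since only finitely many of these
vectors are nonzero. -/
theorem IsGoodPair.nprodH {x y : W →ₗ[ℂ] HM (HM W)} (h : IsGoodPair x y) (c : SplitField W)
    (hc0 : 0 ≤ c.sm) : IsGoodPair (nprodH c x) (QHeis.nprodH c y) := by
  obtain ⟨π, hπ, h⟩ := h
  exact ⟨π, hπ, IsRegularPair.nprodH h c hc0⟩

end Regular

/-! ### Induction along contractions -/

namespace Fock

/-- The iterated contractions. -/
def contrList (q ℓ : ℂ) : List (ℤ × ℕ) → Fock →ₗ[ℂ] Fock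
  | [] => LinearMap.id
  | a :: L => contrList q ℓ L ∘ₗ (contr q ℓ a).toLinearMap

/-- Induction for predicates for which `X_a u` can be reduced to `u` and its contraction. -/
theorem contr_induction (q ℓ : ℂ) {P : Fock → Prop} (one : P 1)
    (add : ∀ u v, P u → P v → P (u + v)) (smul : ∀ (s : ℂ) u, P u → P (s • u))
    (X_mul : ∀ a u, P u → P (contr q ℓ a u) → P (X a * u)) (u : Fock) : P u := by
  have h0 : P 0 := by
    rw [← zero_smul ℂ 1]
    exact smul 0 1 one
  -- The case `X_a u` needs the predicate for a contraction of `u`, not just for `u`. Strengthening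
  -- it to all iterated contractions makes ordinary polynomial induction work.
  suffices h : ∀ L, P (contrList q ℓ L u) from h []
  induction u using MvPolynomial.induction_on with
  | C s =>
    intro L
    cases L with
    | nil =>
      have := smul s 1 one
      rwa [MvPolynomial.smul_eq_C_mul, mul_one] at this
    | cons a L =>
      change P (contrList q ℓ L (contr q ℓ a (C s)))
      rwa [MvPolynomial.derivation_C, map_zero]
  | add u u' hu hu' =>
    intro L
    rw [map_add]
    exact add _ _ (hu L) (hu' L)
  | mul_X u a hu =>
    intro L
    induction L generalizing u with
    | nil =>
      rw [mul_comm]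
      exact X_mul a _ (hu []) (hu [a])
    | cons b L ih =>
      change P (contrList q ℓ L (contr q ℓ b (u * X a)))
      rw [Derivation.leibniz, contr_X, smul_eq_mul, smul_eq_mul, map_add, mul_comm u,
        ← MvPolynomial.smul_eq_C_mul, map_smul, mul_comm]
      exact add _ _ (smul _ _ (hu L)) (ih _ fun L' => hu (b :: L'))

end Fock

/-! ### Regularity of all products and iterates by induction on the first state -/

section Good

variable {q : ℂ} {W : Type*} [AddCommGroup W] [Module ℂ W]
  [LieRingModule (QHeisenberg q) W] [LieModule ℂ (QHeisenberg q) W]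
  (hW : IsRestricted q W) {ℓ : ℂ} (hℓ : HasLevel q W ℓ) (hq0 : q ≠ 0)

/-- The products and iterates of the fields of `u` with all other fields are good. -/
def IsGood (u : Fock) : Prop := ∀ v : Fock, IsGoodPair
  (prodH (quasiY hW hℓ hq0 u) (quasiY hW hℓ hq0 v)) (iterH hW hℓ hq0 u v)

/-- In degree `d` the product is the single monomial `t^d`, and the iterate is constant in `z` up to
the twist `e^{-dz}`, which is the value of that monomial. -/
theorem isGood_one : IsGood hW hℓ hq0 1 := by
  intro v
  refine ⟨1, one_ne_zero, fun w => ?_⟩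
  rw [map_one (evalL _), map_one (evalL _)]
  have e : ∀ x : HM (HM W), (1 : LaurentSeries ℂ) • x = x := fun x => one_smul _ x
  rw [e, e, quasiY_one]
  obtain ⟨N, hN⟩ := eventually_atBot.1 (cf_eventually (quasiY hW hℓ hq0 v) w)
  have h1 : ∀ n d, hc (hc (prodH (idField W) (quasiY hW hℓ hq0 v) w) n) d =
      if n = d then cf (quasiY hW hℓ hq0 v) d w else 0 := by
    intro n d
    rw [hc_hc_prodH, cf_idField]
    by_cases h : n = d
    · rw [if_pos (by omega), if_pos h, h]
    · rw [if_neg (by omega), if_neg h]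
  -- The exponent equals `d`, so the upper end of the window requires the bound to be at most `0`.
  refine ⟨min N 0, fun n d hn => ?_, fun i d => ?_⟩
  · rw [h1]
    split_ifs with h
    · exact hN d (by omega)
    · rfl
  · rw [iterH_apply, twist, hc_opSeries]
    have h2 : ∀ j : ℕ, twistCoeff j (hc (hmap ((quasiY hW hℓ hq0).flip w)
        (Fock.Y (kap q ℓ) 1 v)) (i - j)) = if i = j then
          twistCoeff j (quasiY hW hℓ hq0 v w) else 0 := by
      intro j
      rw [hc_hmap, hc_apply_eq_cf, Fock.Y, fieldMap_one, cf_idField]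
      by_cases h : i = j
      · rw [if_pos (by omega), if_pos h, LinearMap.flip_apply]
      · rw [if_neg (by omega), if_neg h, map_zero, map_zero]
    simp only [h2, h1]
    split_ifs with hi
    · obtain ⟨k, rfl⟩ := Int.eq_ofNat_of_zero_le hi
      rw [finsum_eq_single _ k fun j hj => if_neg (by omega), if_pos rfl, hc_twistCoeff,
        finsum_eq_single _ d fun n hn => by rw [if_neg hn, smul_zero], if_pos rfl, hc_apply_eq_cf]
      rfl
    · rw [finsum_eq_zero_of_forall_eq_zero fun j => if_neg (by omega)]
      rfl

theorem IsGood.add {u u' : Fock} (h : IsGood hW hℓ hq0 u) (h' : IsGood hW hℓ hq0 u') :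
    IsGood hW hℓ hq0 (u + u') := by
  intro v
  have h1 := (h v).add (h' v)
  convert h1 using 1
  · funext w
    rw [map_add, prodH_add]
    rfl
  · funext w
    rw [Pi.add_apply, iterH_apply, map_add, LinearMap.add_apply, map_add, map_add]
    rfl

theorem isRat_C (s : ℂ) : IsRat (HahnSeries.C s) (HahnSeries.C s) :=
  ⟨1, Polynomial.C s, one_ne_zero, by rw [map_one, one_mul, evalL_C],
    by rw [map_one, one_mul, evalL_C]⟩

theorem HM_C_smul {V : Type*} [AddCommGroup V] [Module ℂ V] (s : ℂ) (x : HM V) :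
    (HahnSeries.C s : LaurentSeries ℂ) • x = s • x :=
  hc_ext fun n => by rw [HahnSeries.C_apply, hc_single_smul, hc_base_smul, sub_zero]

theorem IsGood.smul {u : Fock} (h : IsGood hW hℓ hq0 u) (s : ℂ) : IsGood hW hℓ hq0 (s • u) := by
  intro v
  have h1 := (h v).smul (isRat_C s)
  simp only [HM_C_smul] at h1
  convert h1 using 1
  · funext w
    rw [map_smul]
    refine hc_ext fun n => ?_
    rw [hc_base_smul, hc_prodH, hc_prodH, map_smul]
    rfl
  · funext w
    rw [iterH_apply, map_smul, LinearMap.smul_apply, map_smul, map_smul]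
    rfl

theorem IsGood.X_mul (hq : ∀ n : ℕ, 0 < n → q ^ n ≠ 1) {u : Fock} (a : ℤ × ℕ)
    (h : IsGood hW hℓ hq0 u) (h' : IsGood hW hℓ hq0 (Fock.contr q ℓ a u)) :
    IsGood hW hℓ hq0 (X a * u) := by
  intro v
  have hJ : ∀ b ∉ v.vars, pderiv b v = 0 := pderiv_eq_zero_of_notMem v
  -- The three summands are those common to the recursions `prodH_X_mul` and `iterH_X_mul`;
  -- `isRat_h` relates their only differing coefficients.
  have h1 := ((IsGoodPair.nprodH (h v) (βSplit hW a) zero_le_one).add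
    (IsGoodPair.sum v.vars fun b _ => (h (pderiv b v)).smul (isRat_h q ℓ a b))).add (h' v)
  convert h1 using 1
  · funext w
    rw [prodH_X_mul hW hℓ hq0 a u v _ hJ, Pi.add_apply, Pi.add_apply, Finset.sum_apply]
  · funext w
    rw [iterH_X_mul hW hℓ hq0 hq a u v _ hJ, Pi.add_apply, Pi.add_apply, Finset.sum_apply]

theorem isGood (hq : ∀ n : ℕ, 0 < n → q ^ n ≠ 1) (u : Fock) : IsGood hW hℓ hq0 u := by
  induction u using Fock.contr_induction q ℓ with
  | one => exact isGood_one hW hℓ hq0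
  | add u u' hu hu' => exact hu.add hW hℓ hq0 hu'
  | smul s u hu => exact hu.smul hW hℓ hq0 s
  | X_mul a u hu hu' => exact IsGood.X_mul hW hℓ hq0 hq a hu hu'

end Good

end QHeis

namespace QHeis

open VertexOperator (ncoeff)

open MvPolynomial (X C pderiv)

/-! ### The quasi module structure for the Fock space -/

section Homogenization

/-! ### Homogenization of polynomials in one variable -/

/-- The exponent of `x₁^{M-k} x₂^k`. -/
def homExp (M k : ℕ) : Fin 2 →₀ ℕ := Finsupp.single 0 (M - k) + Finsupp.single 1 k

theorem homExp_zero (M k : ℕ) : homExp M k 0 = M - k := by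
  simp [homExp]

theorem homExp_one (M k : ℕ) : homExp M k 1 = k := by
  simp [homExp]

theorem homExp_injective (M : ℕ) : Function.Injective (homExp M) := fun k k' h => by
  rw [← homExp_one M k, h, homExp_one]

/-- The homogenization `x₁^M π(x₂ / x₁)` of a polynomial of degree `M`. -/
def homogenization (π : Polynomial ℂ) : MvPolynomial (Fin 2) ℂ :=
  ∑ k ∈ range (π.natDegree + 1), MvPolynomial.monomial (homExp π.natDegree k) (π.coeff k)

theorem coeff_homogenization (π : Polynomial ℂ) (k : ℕ) (hk : k ∈ range (π.natDegree + 1)) :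
    (homogenization π).coeff (homExp π.natDegree k) = π.coeff k := by
  classical
  rw [homogenization, MvPolynomial.coeff_sum, sum_eq_single_of_mem k hk]
  · rw [MvPolynomial.coeff_monomial, if_pos rfl]
  · intro j _ hj
    rw [MvPolynomial.coeff_monomial, if_neg ((homExp_injective _).ne hj)]

theorem homogenization_ne_zero {π : Polynomial ℂ} (hπ : π ≠ 0) : homogenization π ≠ 0 := by
  intro h
  have h1 := coeff_homogenization π π.natDegree (self_mem_range_succ _)
  rw [h, MvPolynomial.coeff_zero] at h1
  exact hπ (Polynomial.leadingCoeff_eq_zero.1 h1.symm)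

theorem sum_homogenization {M : Type*} [AddCommGroup M] [Module ℂ M] (π : Polynomial ℂ)
    (F : (Fin 2 →₀ ℕ) → M) : ∑ s ∈ (homogenization π).support, (homogenization π).coeff s • F s =
      ∑ k ∈ range (π.natDegree + 1), π.coeff k • F (homExp π.natDegree k) := by
  classical
  rw [sum_subset (s₂ := (range (π.natDegree + 1)).image (homExp π.natDegree)),
    sum_image fun a _ b _ h => homExp_injective _ h]
  · exact sum_congr rfl fun k hk => by rw [coeff_homogenization π k hk]
  · intro s hs
    by_contra h
    refine MvPolynomial.mem_support_iff.1 hs ?_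
    rw [homogenization, MvPolynomial.coeff_sum]
    refine sum_eq_zero fun k hk => ?_
    rw [MvPolynomial.coeff_monomial, if_neg]
    rintro rfl
    exact h (mem_image_of_mem _ hk)
  · intro s _ hs
    rw [MvPolynomial.notMem_support_iff.1 hs, zero_smul]

theorem evalL_eq_sum (τ : LaurentSeries ℂ) (π : Polynomial ℂ) :
    evalL τ π = ∑ k ∈ range (π.natDegree + 1), HahnSeries.C (π.coeff k) * τ ^ k :=
  Polynomial.eval₂_eq_sum_range _ _

theorem HM_sum_smul {V ι : Type*} [AddCommGroup V] [Module ℂ V] (J : Finset ι)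
    (s : ι → LaurentSeries ℂ) (x : HM V) : (∑ b ∈ J, s b) • x = ∑ b ∈ J, s b • x := sum_smul

theorem hc_evalL_tvar_smul {V : Type*} [AddCommGroup V] [Module ℂ V] (π : Polynomial ℂ) (x : HM V)
    (n : ℤ) : hc (evalL tvar π • x) n =
      ∑ k ∈ range (π.natDegree + 1), π.coeff k • hc x (n - k) := by
  rw [evalL_eq_sum, HM_sum_smul, hc_sum]
  refine sum_congr rfl fun k _ => ?_
  rw [← HM_smul_smul, HM_C_smul, hc_base_smul, HahnSeries.single_pow, one_pow, hc_single_smul,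
    one_smul, nsmul_eq_mul, mul_one]

theorem expL_pow (m : ℤ) (k : ℕ) : expL m ^ k = expL (k * m) := by
  induction k with
  | zero => rw [pow_zero, Nat.cast_zero, zero_mul, expL_zero]
  | succ k ih =>
    rw [pow_succ, ih, ← expL_add]
    push_cast
    ring_nf

/-- The value of `x₁^M π(x₂/x₁)` at `x₁ = e^z`, `x₂ = 1`, written monomial by monomial. -/
theorem expL_mul_evalL (π : Polynomial ℂ) : expL π.natDegree * evalL (expL (-1)) π =
    ∑ k ∈ range (π.natDegree + 1), HahnSeries.C (π.coeff k) * expL ((π.natDegree - k : ℕ) : ℤ) := by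
  rw [evalL_eq_sum, mul_sum]
  refine sum_congr rfl fun k hk => ?_
  rw [mem_range] at hk
  rw [mul_left_comm, expL_pow, ← expL_add, Nat.cast_sub (by omega)]
  congr 2
  ring

end Homogenization

/-! ### From regular pairs to quasi associativity -/

section QuasiModule

variable {q : ℂ} {W : Type*} [AddCommGroup W] [Module ℂ W]
  [LieRingModule (QHeisenberg q) W] [LieModule ℂ (QHeisenberg q) W]
  (hW : IsRestricted q W) {ℓ : ℂ} (hℓ : HasLevel q W ℓ) (hq0 : q ≠ 0)

/-- The coefficient of degree `d`. -/
def hproj (V : Type*) [AddCommGroup V] [Module ℂ V] (d : ℤ) : HM V →ₗ[ℂ] V := LinearMap.proj d ∘ₗ hc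

theorem hproj_apply {V : Type*} [AddCommGroup V] [Module ℂ V] (d : ℤ) (x : HM V) :
    hproj V d x = hc x d := rfl

theorem hmap_hproj_twist (d : ℤ) (x : HM (HM W)) :
    hmap (hproj W d) (twist x) = expL (-d) • hmap (hproj W d) x := by
  rw [twist, hmap_opSeries]
  refine hc_ext fun n => ?_
  rw [hc_opSeries, expL, hc_powerSeries_smul]
  refine finsum_congr fun i => ?_
  rw [coeff_expS, hc_hmap]
  rfl

/-- The factor `π(t)` of the homogenization acts on the series in `t`; the factor `x₁^M` only shifts
the total degree by `M = π.natDegree`. -/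
theorem polyMulCoeff_homogenization (π : Polynomial ℂ) (A B : VertexOperator ℂ W) (m n : ℤ) (w : W) :
    polyMulCoeff (homogenization π) A B m n w =
      hc (hc (evalL tvar π • prodH A B w) n) (m + n - π.natDegree) := by
  have h : polyMulCoeff (homogenization π) A B m n = _ := sum_homogenization π _
  rw [h, hc_evalL_tvar_smul, hc_sum, LinearMap.sum_apply]
  refine sum_congr rfl fun k hk => ?_
  rw [mem_range] at hk
  rw [hc_base_smul, hc_hc_prodH, LinearMap.smul_apply, LinearMap.comp_apply, homExp_zero,
    homExp_one, Nat.cast_sub (by omega), coeff_eq_cf, coeff_eq_cf,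
    show m + n - (π.natDegree : ℤ) - (n - k) = m - (π.natDegree - k) by ring]

theorem iterateCoeff_homogenization (π : Polynomial ℂ) (u v : Fock) (w : W) (i j : ℤ) :
    iterateCoeff (Fock.vertexAlgebra (kap q ℓ) (kap_skew q ℓ)) (quasiY hW hℓ hq0)
      (homogenization π) u v w i j = hc (expL j • hmap (hproj W (j - π.natDegree))
        (evalL (expL (-1)) π • iterH hW hℓ hq0 u v w)) i := by
  have h : iterateCoeff (Fock.vertexAlgebra (kap q ℓ) (kap_skew q ℓ)) (quasiY hW hℓ hq0)
      (homogenization π) u v w i j = _ := sum_homogenization π _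
  have e : expL j * evalL (expL (-1)) π * expL (-(j - π.natDegree)) =
      expL π.natDegree * evalL (expL (-1)) π := by
    rw [mul_right_comm, ← expL_add, show j + -(j - (π.natDegree : ℤ)) = π.natDegree by ring]
  rw [h, iterH_apply, hmap_smul, hmap_hproj_twist, HM_smul_smul, HM_smul_smul, e, expL_mul_evalL,
    HM_sum_smul, hc_sum]
  refine sum_congr rfl fun k hk => ?_
  rw [mem_range] at hk
  rw [← HM_smul_smul, HM_C_smul, hc_base_smul, expL, hc_powerSeries_smul]
  congr 1
  refine finsum_congr fun l => ?_
  rw [coeff_expS, hc_hmap, hc_hmap, hproj_apply, LinearMap.flip_apply, hc_apply_eq_cf, homExp_zero,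
    homExp_one]
  have e2 : j - ((π.natDegree - k : ℕ) : ℤ) - (k : ℤ) = j - π.natDegree := by
    rw [Nat.cast_sub (by omega)]
    ring
  rw [e2]
  rfl

theorem isPhiQuasiModule_quasiY (hq : ∀ n : ℕ, 0 < n → q ^ n ≠ 1) :
    IsPhiQuasiModule (Fock.vertexAlgebra (kap q ℓ) (kap_skew q ℓ)) (quasiY hW hℓ hq0) where
  map_vac n w := by
    have : (Fock.vertexAlgebra (kap q ℓ) (kap_skew q ℓ)).vac = 1 := rfl
    rw [this, quasiY_one, coeff_eq_cf, cf_idField]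
  quasi_assoc u v := by
    obtain ⟨π, hπ, h⟩ := isGood hW hℓ hq0 hq u v
    refine ⟨homogenization π, homogenization_ne_zero hπ, fun w => ?_, fun w i j => ?_⟩
    · obtain ⟨N, h1, -⟩ := h w
      refine ⟨N, fun m n hmn => ?_⟩
      rw [polyMulCoeff_homogenization]
      exact h1 _ _ (by omega)
    · obtain ⟨N, h1, h2⟩ := h w
      rw [iterateCoeff_homogenization, substCoeff]
      set d : ℤ := j - π.natDegree with hd
      set x := evalL tvar π • prodH (quasiY hW hℓ hq0 u) (quasiY hW hℓ hq0 v) w with hx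
      have hy : ∀ i, hc (hmap (hproj W d) (evalL (expL (-1)) π • iterH hW hℓ hq0 u v w)) i =
          if 0 ≤ i then ∑ᶠ n : ℤ, expCoeff (-n) i.toNat • hc (hc x n) d else 0 := by
        intro i
        rw [hc_hmap, hproj_apply, h2]
      have hy0 : ∀ i < 0, hc (hmap (hproj W d)
          (evalL (expL (-1)) π • iterH hW hℓ hq0 u v w)) i = 0 := fun i hi => by
        rw [hy, if_neg (by omega)]
      split_ifs with hi
      · obtain ⟨k, rfl⟩ := Int.eq_ofNat_of_zero_le hi
        rw [hc_expL_smul_of_nonneg _ _ hy0]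
        have e1 : ∀ a : ℕ, ∑ᶠ n : ℤ, expCoeff (-n) a • hc (hc x n) d =
            ∑ n ∈ Finset.Icc N (d - N), expCoeff (-n) a • hc (hc x n) d := fun a =>
          finsum_eq_sum_Icc fun n hn => by rw [h1 _ _ hn, smul_zero]
        have e2 : ∑ᶠ m : ℤ, expCoeff m (k : ℤ).toNat • polyMulCoeff (homogenization π)
            (quasiY hW hℓ hq0 u) (quasiY hW hℓ hq0 v) m (j - m) w =
            ∑ᶠ n : ℤ, expCoeff (j - n) k • hc (hc x n) d := by
          -- With `m = j - n`, the exponential `e^{mz}` of the substitution is `e^{jz} e^{-nz}`: the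
          -- factor `e^{jz}` undoes the twist, and the rest is evaluation at `t = e^{-z}`.
          rw [← finsum_comp_equiv (Equiv.subLeft j)]
          refine finsum_congr fun n => ?_
          rw [polyMulCoeff_homogenization, Equiv.subLeft_apply, sub_sub_cancel, sub_add_cancel]
          rfl
        rw [e2, finsum_eq_sum_Icc (a := N) (b := d - N) fun n hn => by rw [h1 _ _ hn, smul_zero]]
        simp only [hy, Nat.cast_nonneg, if_true, Int.toNat_natCast, e1, smul_sum, smul_smul]
        rw [sum_comm]
        refine sum_congr rfl fun n _ => ?_
        rw [← sum_smul, sum_expCoeff, sub_eq_add_neg]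
      · exact hc_expL_smul_of_neg _ _ hy0 _ (by omega)

end QuasiModule

end QHeis

namespace QHeis

open VertexOperator (ncoeff)

open MvPolynomial (X C pderiv)

/-! ### Substitution of `x₁ = x₂ e^{x₀}` -/

section Substitution

variable {V W : Type*} [AddCommGroup V] [Module ℂ V] [AddCommGroup W] [Module ℂ W]

/-- Multiplication by a Laurent series. -/
def lsmul (s : LaurentSeries ℂ) : HM W →ₗ[ℂ] HM W where
  toFun x := s • x
  map_add' x y := smul_add s x y
  map_smul' t x := by
    rw [← HM_C_smul, ← HM_C_smul, HM_smul_comm]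
    rfl

theorem lsmul_apply (s : LaurentSeries ℂ) (x : HM W) : lsmul s x = s • x := rfl

theorem lsmul_injective {s : LaurentSeries ℂ} (hs : s ≠ 0) :
    Function.Injective (lsmul s : HM W →ₗ[ℂ] HM W) := by
  intro x y h
  rw [lsmul_apply, lsmul_apply] at h
  have h1 := congrArg (fun z : HM W => s⁻¹ • z) h
  simp only [HM_smul_smul, inv_mul_cancel₀ hs] at h1
  exact (one_smul _ x).symm.trans (h1.trans (one_smul _ y))

/-- An operator-valued power series with injective leading coefficient is injective. -/
theorem opSeries_injective (D : ℕ → V →ₗ[ℂ] W) (l : ℕ) (h0 : ∀ i < l, D i = 0)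
    (h1 : Function.Injective (D l)) : Function.Injective (opSeries D) := by
  refine (injective_iff_map_eq_zero (opSeries D)).2 fun x hx => ?_
  by_contra hne
  obtain ⟨N, hN⟩ := eventually_atBot.1 (hc_eventually x)
  -- At the lowest exponent `n` of `x`, only the leading coefficient `D l` contributes to the
  -- exponent `n + l` of the image.
  obtain ⟨n, hn, hmin⟩ := Int.exists_least_of_bdd (P := fun n => hc x n ≠ 0)
    ⟨N, fun z hz => by
      by_contra hlt
      exact hz (hN z (by omega))⟩ (by
      by_contra h
      push Not at h
      exact hne (hc_ext h))
  have h2 : hc (opSeries D x) (n + l) = D l (hc x n) := by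
    rw [hc_opSeries, finsum_eq_single _ l]
    · rw [add_sub_cancel_right]
    · intro i hi
      rcases lt_or_gt_of_ne hi with hi | hi
      · rw [h0 i hi, LinearMap.zero_apply]
      · have h3 : hc x (n + l - i) = 0 := by
          by_contra h
          have := hmin _ h
          omega
        rw [h3, map_zero]
  rw [hx] at h2
  exact hn (h1 (h2.symm.trans (map_zero (D l)).symm))

/-- The coefficient of `z^l` in `p(y e^z, y)`. -/
def expPolyCoeff (p : MvPolynomial (Fin 2) ℂ) (l : ℕ) : LaurentSeries ℂ :=
  ∑ s ∈ p.support, HahnSeries.single ((s 0 : ℤ) + s 1) (p.coeff s * expCoeff (s 0) l)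

/-- Multiplication by `p(y e^z, y)`. -/
def expPoly (p : MvPolynomial (Fin 2) ℂ) : HM (HM W) →ₗ[ℂ] HM (HM W) :=
  opSeries fun l => lsmul (expPolyCoeff p l)

theorem hc_hc_expPoly (p : MvPolynomial (Fin 2) ℂ) (x : HM (HM W)) (i j : ℤ) :
    hc (hc (expPoly p x) i) j = ∑ s ∈ p.support, p.coeff s • ∑ᶠ k : ℕ, expCoeff (s 0) k •
      hc (hc x (i - k)) (j - s 0 - s 1) := by
  have e : ∀ s : Fin 2 →₀ ℕ, ∀ᶠ k : ℕ in atTop, expCoeff (s 0) k •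
      hc (hc x (i - k)) (j - s 0 - s 1) = 0 := by
    intro s
    filter_upwards [hc_sub_eventually x i] with k hk
    rw [hk]
    exact smul_zero _
  rw [expPoly, hc_opSeries, finsum_hc (opSeries_eventually _ x i)]
  simp only [lsmul_apply, expPolyCoeff, HM_sum_smul, hc_sum, hc_single_smul, mul_smul]
  rw [finsum_sum_comm]
  · refine sum_congr rfl fun s _ => ?_
    rw [smul_finsum_eventually _ (e s)]
    simp only [sub_sub]
  · intro s _
    refine hasFiniteSupport_of_eventually ?_
    filter_upwards [e s] with k hk
    rw [← sub_sub, hk, smul_zero]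

theorem expPoly_comm (p p' : MvPolynomial (Fin 2) ℂ) (x : HM (HM W)) :
    expPoly p (expPoly p' x) = expPoly p' (expPoly p x) := by
  rw [expPoly, expPoly, opSeries_opSeries, opSeries_opSeries]
  refine congrArg (fun D => opSeries D x) (funext fun n => LinearMap.ext fun y => ?_)
  rw [← Nat.sum_antidiagonal_swap, LinearMap.sum_apply, LinearMap.sum_apply]
  refine sum_congr rfl fun s _ => ?_
  exact HM_smul_comm _ _ _

/-- The series `p(y e^z, y)` cannot vanish: within one total degree, distinct monomials of `p` give
distinct exponentials `e^{(s 0) z}`, and these are linearly independent. -/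
theorem exists_expPolyCoeff_ne_zero {p : MvPolynomial (Fin 2) ℂ} (hp : p ≠ 0) :
    ∃ l, expPolyCoeff p l ≠ 0 := by
  classical
  by_contra! h
  obtain ⟨t, ht⟩ := MvPolynomial.support_nonempty.2 hp
  set T := p.support.filter fun s => (s 0 : ℤ) + s 1 = t 0 + t 1 with hT
  have h1 : ∀ l : ℕ, ∑ s ∈ T, p.coeff s * (s 0 : ℂ) ^ l = 0 := by
    intro l
    have h2 := congrArg (fun f : LaurentSeries ℂ => f.coeff (t 0 + t 1)) (h l)
    have h3 : ∑ s ∈ T, p.coeff s * expCoeff (s 0) l = 0 := by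
      refine Eq.trans ?_ h2
      rw [hT, sum_filter, expPolyCoeff, HahnSeries.coeff_sum]
      refine sum_congr rfl fun s _ => ?_
      rw [HahnSeries.coeff_single]
      by_cases hs : (s 0 : ℤ) + s 1 = t 0 + t 1
      · rw [if_pos hs, if_pos hs.symm]
      · rw [if_neg hs, if_neg (Ne.symm hs)]
    have h4 : (l.factorial : ℂ) ≠ 0 := by exact_mod_cast l.factorial_ne_zero
    have h5 := congrArg (fun z => z * (l.factorial : ℂ)) h3
    simp only [sum_mul, zero_mul] at h5
    rw [← h5]
    refine sum_congr rfl fun s _ => ?_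
    rw [expCoeff, Int.cast_natCast]
    field_simp
  have h2 : ∀ Q : Polynomial ℂ, ∑ s ∈ T, p.coeff s * Q.eval (s 0 : ℂ) = 0 := by
    intro Q
    simp only [Polynomial.eval_eq_sum_range, mul_sum]
    rw [sum_comm]
    refine sum_eq_zero fun l _ => ?_
    have := congrArg (fun z => Q.coeff l * z) (h1 l)
    simp only [mul_sum, mul_zero] at this
    rw [← this]
    exact sum_congr rfl fun s _ => by ring
  have htT : t ∈ T := by
    rw [hT, mem_filter]
    exact ⟨ht, rfl⟩
  -- A Lagrange polynomial isolating the monomial `t`; in `T` the total degree is fixed, so the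
  -- first exponents are distinct.
  have h3 := h2 (∏ s ∈ T.erase t, (Polynomial.X - Polynomial.C (s 0 : ℂ)))
  simp only [Polynomial.eval_prod, Polynomial.eval_sub, Polynomial.eval_X, Polynomial.eval_C] at h3
  rw [sum_eq_single_of_mem t htT] at h3
  · refine mul_ne_zero (MvPolynomial.mem_support_iff.1 ht) (prod_ne_zero_iff.2 fun s hs => ?_) h3
    rw [mem_erase, hT, mem_filter] at hs
    intro h4
    have h5 : t 0 = s 0 := by exact_mod_cast sub_eq_zero.1 h4
    refine hs.1 (Finsupp.ext fun a => ?_)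
    fin_cases a
    · exact h5.symm
    · have := hs.2.2
      simp only [Fin.mk_one]
      omega
  · intro s hs hst
    refine mul_eq_zero_of_right _ (prod_eq_zero (mem_erase.2 ⟨hst, hs⟩) (sub_self _))

theorem expPoly_injective {p : MvPolynomial (Fin 2) ℂ} (hp : p ≠ 0) :
    Function.Injective (expPoly p : HM (HM W) →ₗ[ℂ] HM (HM W)) := by
  classical
  have h := exists_expPolyCoeff_ne_zero hp
  refine opSeries_injective _ (Nat.find h) (fun i hi => ?_) (lsmul_injective (Nat.find_spec h))
  have := Nat.find_min h hi
  rw [not_not] at this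
  rw [this]
  exact LinearMap.ext fun x => zero_smul (LaurentSeries ℂ) x

/-- The substitution is compatible with multiplication by polynomials. -/
theorem substCoeff_mul (p : MvPolynomial (Fin 2) ℂ) (G : ℤ → ℤ → W) (N : ℤ)
    (hG : ∀ m n, m < N ∨ n < N → G m n = 0) (x : HM (HM W))
    (hx : ∀ i j, hc (hc x i) j = substCoeff G i j) (i j : ℤ) :
    hc (hc (expPoly p x) i) j =
      substCoeff (fun m n => ∑ s ∈ p.support, p.coeff s • G (m - s 0) (n - s 1)) i j := by
  have hx0 : ∀ i < 0, hc x i = 0 := fun i hi => hc_ext fun j => by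
    rw [hx, substCoeff, if_neg (by omega)]
    rfl
  rw [hc_hc_expPoly, substCoeff]
  split_ifs with hi
  · obtain ⟨k, rfl⟩ := Int.eq_ofNat_of_zero_le hi
    have h1 : ∀ s : Fin 2 →₀ ℕ, ∑ᶠ l : ℕ, expCoeff (s 0) l •
        hc (hc x (k - l)) (j - s 0 - s 1) =
        ∑ᶠ m : ℤ, expCoeff m k • G (m - s 0) (j - m - s 1) := by
      intro s
      set j' : ℤ := j - s 0 - s 1 with hj'
      have hG' : ∀ m, m < N ∨ j' - N < m → G m (j' - m) = 0 := fun m hm => hG _ _ (by omega)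
      have h2 : ∀ a : ℕ, ∑ᶠ m : ℤ, expCoeff m a • G m (j' - m) =
          ∑ m ∈ Finset.Icc N (j' - N), expCoeff m a • G m (j' - m) := fun a =>
        finsum_eq_sum_Icc fun m hm => by rw [hG' m hm, smul_zero]
      have h3 : ∑ᶠ m : ℤ, expCoeff m k • G (m - s 0) (j - m - s 1) =
          ∑ᶠ m : ℤ, expCoeff (m + s 0) k • G m (j' - m) := by
        rw [← finsum_comp_equiv (Equiv.addRight (s 0 : ℤ))]
        refine finsum_congr fun m => ?_
        rw [Equiv.coe_addRight, add_sub_cancel_right, hj']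
        congr 2
        ring
      rw [h3, finsum_eq_sum_Icc (a := N) (b := j' - N) fun m hm => by rw [hG' m hm, smul_zero],
        finsum_eq_sum_range (n := k + 1)]
      · have h4 : ∀ l ∈ range (k + 1), expCoeff (s 0) l • hc (hc x (k - l)) j' =
            ∑ m ∈ Finset.Icc N (j' - N), (expCoeff (s 0) l * expCoeff m (k - l)) • G m (j' - m) := by
          intro l hl
          rw [mem_range] at hl
          rw [hx, substCoeff, if_pos (by omega), show ((k : ℤ) - l).toNat = k - l by omega, h2,
            smul_sum]
          simp only [smul_smul]
        rw [sum_congr rfl h4, sum_comm]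
        refine sum_congr rfl fun m _ => ?_
        rw [← sum_smul, add_comm m, ← sum_expCoeff,
          Nat.sum_antidiagonal_eq_sum_range_succ (fun a b => expCoeff (s 0) a * expCoeff m b)]
      · intro l hl
        rw [hx0 _ (by omega)]
        exact smul_zero _
    have hfin : ∀ s : Fin 2 →₀ ℕ, (fun m : ℤ =>
        expCoeff m k • G (m - s 0) (j - m - s 1)).HasFiniteSupport := fun s =>
      finite_support_of_vanish (a := N) (b := j - N) fun m hm => by
        rw [hG _ _ (by omega), smul_zero]
    simp only [h1, Int.toNat_natCast, smul_sum]
    rw [finsum_sum_comm]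
    · refine sum_congr rfl fun s _ => ?_
      rw [smul_finsum' _ (hfin s)]
      exact finsum_congr fun m => smul_comm _ _ _
    · intro s _
      exact (hfin s).subset fun m hm h => hm (by
        simp only at h ⊢
        rw [smul_comm, h, smul_zero])
  · refine sum_eq_zero fun s _ => ?_
    rw [finsum_eq_zero_of_forall_eq_zero, smul_zero]
    intro l
    rw [hx0 _ (by omega)]
    exact smul_zero _

theorem polyMulCoeff_comm (p p' : MvPolynomial (Fin 2) ℂ) (A B : VertexOperator ℂ W) (w : W)
    (m n : ℤ) : ∑ s ∈ p.support, p.coeff s • polyMulCoeff p' A B (m - s 0) (n - s 1) w =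
      ∑ s ∈ p'.support, p'.coeff s • polyMulCoeff p A B (m - s 0) (n - s 1) w := by
  simp only [polyMulCoeff, LinearMap.sum_apply, LinearMap.smul_apply, smul_sum]
  rw [sum_comm]
  refine sum_congr rfl fun s _ => sum_congr rfl fun t _ => ?_
  rw [smul_comm, sub_right_comm m, sub_right_comm n]

/-- The series `Y_W(Y(u, z) v, x) w`. -/
def compH (𝒱 : VertexAlgebra V) (YW : V →ₗ[ℂ] VertexOperator ℂ W) (u v : V) (w : W) : HM (HM W) :=
  hmap (YW.flip w) (𝒱.Y u v)

theorem hc_expPoly_compH (𝒱 : VertexAlgebra V) (YW : V →ₗ[ℂ] VertexOperator ℂ W)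
    (p : MvPolynomial (Fin 2) ℂ) (u v : V) (w : W) (i j : ℤ) :
    hc (hc (expPoly p (compH 𝒱 YW u v w)) i) j = iterateCoeff 𝒱 YW p u v w i j := by
  rw [hc_hc_expPoly, iterateCoeff]
  simp only [compH, hc_hmap]
  rfl

/-- The iterate is determined by the two fields. -/
theorem compH_eq {𝒱 : VertexAlgebra V} {YW YW' : V →ₗ[ℂ] VertexOperator ℂ W}
    (h : IsPhiQuasiModule 𝒱 YW) (h' : IsPhiQuasiModule 𝒱 YW') {u v : V} (hu : YW u = YW' u)
    (hv : YW v = YW' v) (w : W) : compH 𝒱 YW u v w = compH 𝒱 YW' u v w := by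
  obtain ⟨p, hp, h1, h2⟩ := h.quasi_assoc u v
  obtain ⟨p', hp', h1', h2'⟩ := h'.quasi_assoc u v
  obtain ⟨N, hN⟩ := h1 w
  obtain ⟨N', hN'⟩ := h1' w
  rw [← hu, ← hv] at h2' hN'
  -- The two structures come with different polynomials `p` and `p'`. After multiplication by both,
  -- each side is the substitution of `p p'` times the same product of fields.
  refine expPoly_injective hp (expPoly_injective hp' ?_)
  rw [expPoly_comm p' p (compH 𝒱 YW' u v w)]
  refine hc_ext fun i => hc_ext fun j => ?_
  rw [substCoeff_mul p' _ N hN _ fun i j => (hc_expPoly_compH 𝒱 YW p u v w i j).trans (h2 w i j),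
    substCoeff_mul p _ N' hN' _ fun i j => (hc_expPoly_compH 𝒱 YW' p' u v w i j).trans (h2' w i j)]
  simp only [polyMulCoeff_comm p p']

theorem IsPhiQuasiModule.apply_cf_eq {𝒱 : VertexAlgebra V} {YW YW' : V →ₗ[ℂ] VertexOperator ℂ W}
    (h : IsPhiQuasiModule 𝒱 YW) (h' : IsPhiQuasiModule 𝒱 YW') {u v : V} (hu : YW u = YW' u)
    (hv : YW v = YW' v) (n : ℤ) : YW (cf (𝒱.Y u) n v) = YW' (cf (𝒱.Y u) n v) := by
  refine LinearMap.ext fun w => ?_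
  have h1 := congrArg (fun x => hc x n) (compH_eq h h' hu hv w)
  simp only [compH, hc_hmap] at h1
  exact h1

end Substitution

end QHeis

namespace QHeis

open VertexOperator (ncoeff)

attribute [local instance 100] LieRing.ofAssociativeRing

open MvPolynomial (X C pderiv)

/-! ### Covariance and uniqueness -/

section

variable {W : Type*} [AddCommGroup W] [Module ℂ W]

theorem cf_dilate (a : ℂ) (A : VertexOperator ℂ W) (n : ℤ) (w : W) :
    cf (dilate a A) n w = a ^ n • cf A n w := rfl

theorem dilate_add (a : ℂ) (A B : VertexOperator ℂ W) :
    dilate a (A + B) = dilate a A + dilate a B :=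
  cf_ext fun n w => by
    simp only [map_add, Pi.add_apply, LinearMap.add_apply, cf_dilate, smul_add]

theorem dilate_smul (a s : ℂ) (A : VertexOperator ℂ W) : dilate a (s • A) = s • dilate a A :=
  cf_ext fun n w => by
    simp only [map_smul, Pi.smul_apply, LinearMap.smul_apply, cf_dilate, smul_comm s]

theorem dilate_idField (a : ℂ) : dilate a (idField W) = idField W :=
  cf_ext fun n w => by
    rw [cf_dilate, cf_idField]
    split_ifs with h
    · rw [h, zpow_zero, one_smul]
    · rw [smul_zero]

end

namespace Fock

variable (q ℓ : ℂ)

/-- The algebra endomorphism of the Fock space that shifts the first indices by `m`. -/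
def shift (m : ℤ) : Fock →ₐ[ℂ] Fock := MvPolynomial.rename fun a : ℤ × ℕ => (a.1 + m, a.2)

theorem shift_X (m : ℤ) (a : ℤ × ℕ) : shift m (X a) = X (a.1 + m, a.2) :=
  MvPolynomial.rename_X _ _

/-- The contraction depends on the upper indices only through their difference. -/
theorem gconst_shift (m : ℤ) (a b : ℤ × ℕ) :
    gconst q ℓ (a.1 + m, a.2) (b.1 + m, b.2) = gconst q ℓ a b := by
  rw [gconst_eq, gconst_eq, contrZ, contrZ, add_sub_add_right_eq_sub]

theorem contr_shift (m : ℤ) (a : ℤ × ℕ) (u : Fock) :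
    contr q ℓ (a.1 + m, a.2) (shift m u) = shift m (contr q ℓ a u) := by
  induction u using MvPolynomial.induction_on with
  | C s =>
    rw [MvPolynomial.derivation_C, map_zero, shift, MvPolynomial.rename_C,
      MvPolynomial.derivation_C]
  | add u v hu hv => simp only [map_add, hu, hv]
  | mul_X u b hu =>
    rw [map_mul, Derivation.leibniz, Derivation.leibniz, hu, shift_X, contr_X, contr_X,
      gconst_shift, map_add, smul_eq_mul, smul_eq_mul, smul_eq_mul, smul_eq_mul, map_mul, map_mul,
      shift_X, shift, MvPolynomial.rename_C]

theorem ρ_toVB (m : ℤ) (u : Fock) : ρ q ℓ m (toVB q ℓ u) = toVB q ℓ (shift m u) := by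
  induction u using MvPolynomial.induction_on with
  | C s =>
    rw [shift, MvPolynomial.rename_C, show (C s : Fock) = s • 1 by
      rw [MvPolynomial.smul_eq_C_mul, mul_one], map_smul, map_smul, toVB_one, ρ_vacVec]
  | add u v hu hv => simp only [map_add, hu, hv]
  | mul_X u a hu =>
    obtain ⟨r, k⟩ := a
    rw [mul_comm, toVB_X_mul, ρ_bMode_smul, hu, map_mul, shift_X, toVB_X_mul]
    simp [shiftB]

end Fock

section

variable {q : ℂ} {W : Type*} [AddCommGroup W] [Module ℂ W]
  [LieRingModule (QHeisenberg q) W] [LieModule ℂ (QHeisenberg q) W]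
  (hW : IsRestricted q W) {ℓ : ℂ} (hℓ : HasLevel q W ℓ) (hq0 : q ≠ 0)

/-- Raising the upper index by `m` replaces `x` by `q^m x` in the generating field, and `x∂` is
invariant under dilation. -/
theorem nprod_dilate (hq0 : q ≠ 0) (m : ℤ) (a : ℤ × ℕ) (A : VertexOperator ℂ W) :
    (βSplit hW (a.1 + m, a.2)).nprod (dilate (q ^ m) A) =
      dilate (q ^ m) ((βSplit hW a).nprod A) := by
  refine cf_ext fun n w => ?_
  rw [cf_dilate, SplitField.cf_nprod, SplitField.cf_nprod, smul_add,
    smul_finsum_eventually _ (SplitField.eventually_cm_cf _ _ _ _),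
    smul_finsum_eventually _ (SplitField.eventually_cf_cp _ _ _ _)]
  have e1 : ∀ i : ℕ, q ^ ((a.1 + m) * ((i : ℤ) + 1)) * (q ^ m) ^ (n - 1 - i) =
      (q ^ m) ^ n * q ^ (a.1 * ((i : ℤ) + 1)) := fun i => by
    rw [← zpow_mul, ← zpow_mul, ← zpow_add₀ hq0, ← zpow_add₀ hq0]
    congr 1
    ring
  have e2 : ∀ i : ℕ, (q ^ m) ^ (n + 0 + i) * q ^ (-((a.1 + m) * (i : ℤ))) =
      (q ^ m) ^ n * q ^ (-(a.1 * (i : ℤ))) := fun i => by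
    rw [← zpow_mul, ← zpow_mul, ← zpow_add₀ hq0, ← zpow_add₀ hq0]
    congr 1
    ring
  congr 1 <;> refine finsum_congr fun i => ?_
  · simp only [βSplit, cf_dilate, LinearMap.smul_apply, map_smul, smul_smul]
    congr 1
    linear_combination (((i : ℂ) + 1) ^ a.2 / a.2.factorial) * e1 i
  · simp only [βSplit, cf_dilate, LinearMap.smul_apply, map_smul, smul_smul]
    congr 1
    linear_combination ((-(i : ℂ)) ^ a.2 / a.2.factorial) * e2 i

theorem quasiY_shift (m : ℤ) (u : Fock) :
    quasiY hW hℓ hq0 (Fock.shift m u) = dilate (q ^ m) (quasiY hW hℓ hq0 u) := by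
  induction u using Fock.contr_induction q ℓ with
  | one => rw [map_one (Fock.shift m), quasiY_one, dilate_idField]
  | add u v hu hv => rw [map_add, map_add, map_add, dilate_add, hu, hv]
  | smul s u hu => rw [map_smul, map_smul, map_smul, dilate_smul, hu]
  | X_mul a u hu hu' =>
    rw [map_mul, Fock.shift_X, quasiY_X_mul, quasiY_X_mul, Fock.contr_shift, hu, hu',
      nprod_dilate hW hq0, dilate_add]

theorem quasiY_X (r : ℤ) :
    quasiY hW hℓ hq0 (X (r, 0)) = dilate (q ^ r) (βField q hW) := by
  rw [← mul_one (X (r, 0)), quasiY_X_mul, quasiY_one, Derivation.map_one_eq_zero, map_zero,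
    add_zero]
  refine cf_ext fun n w => ?_
  have h1 : cf (dilate (q ^ r) (βField q hW)) n w = (q ^ r) ^ n • βOp q W (-n) w := rfl
  have hs : (βSplit hW (r, 0)).sm = 1 := rfl
  have hs' : (βSplit hW (r, 0)).sp = 0 := rfl
  rw [h1, SplitField.cf_nprod, hs, hs', ← zpow_mul]
  simp only [cf_idField]
  rcases lt_or_ge 0 n with hn | hn
  · obtain ⟨k, hk⟩ := Int.eq_ofNat_of_zero_le (show 0 ≤ n - 1 by omega)
    obtain rfl : n = k + 1 := by omega
    rw [finsum_eq_single _ k, finsum_eq_zero_of_forall_eq_zero, add_zero, if_pos (by omega)]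
    · simp only [βSplit, LinearMap.smul_apply]
      simp only [pow_zero, Nat.factorial_zero, Nat.cast_one, div_one, one_mul]
      rw [neg_add']
    · intro i
      rw [if_neg (by omega)]
    · intro i hi
      rw [if_neg (by omega), map_zero]
  · obtain ⟨k, rfl⟩ := Int.exists_eq_neg_ofNat hn
    rw [finsum_eq_zero_of_forall_eq_zero, zero_add, finsum_eq_single _ k, if_pos (by omega)]
    · simp only [βSplit, LinearMap.smul_apply]
      simp only [pow_zero, Nat.factorial_zero, Nat.cast_one, div_one, one_mul, neg_neg, mul_neg]
    · intro i hi
      rw [if_neg (by omega)]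
    · intro i
      rw [if_neg (by omega), map_zero]

end

/-! ### Transport of quasi modules along an isomorphism -/

section Transport

variable {V V' W : Type*} [AddCommGroup V] [Module ℂ V] [AddCommGroup V'] [Module ℂ V']
  [AddCommGroup W] [Module ℂ W]

theorem IsPhiQuasiModule.transport {𝒱 : VertexAlgebra V} {YW : V →ₗ[ℂ] VertexOperator ℂ W}
    (h : IsPhiQuasiModule 𝒱 YW) (e : V ≃ₗ[ℂ] V') :
    IsPhiQuasiModule (𝒱.transport e) (YW ∘ₗ e.symm.toLinearMap) where
  map_vac n w := by
    have : (YW ∘ₗ e.symm.toLinearMap) (𝒱.transport e).vac = YW 𝒱.vac :=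
      congrArg YW (e.symm_apply_apply 𝒱.vac)
    rw [this, h.map_vac]
  quasi_assoc u v := by
    obtain ⟨p, hp, h1, h2⟩ := h.quasi_assoc (e.symm u) (e.symm v)
    refine ⟨p, hp, h1, fun w i j => ?_⟩
    refine Eq.trans ?_ (h2 w i j)
    simp only [iterateCoeff]
    refine sum_congr rfl fun s _ => congrArg _ (finsum_congr fun k => ?_)
    have : (YW ∘ₗ e.symm.toLinearMap) (HVertexOperator.coeff ((𝒱.transport e).Y u) (i - k) v) =
        YW (HVertexOperator.coeff (𝒱.Y (e.symm u)) (i - k) (e.symm v)) :=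
      congrArg YW (e.symm_apply_apply _)
    rw [this]

end Transport

/-- A quasi module for the Heisenberg vertex algebra is determined by the generating fields. -/
theorem IsHeisenbergVA.quasiModule_ext {q ℓ : ℂ} {W : Type*} [AddCommGroup W] [Module ℂ W]
    {𝒱 : VertexAlgebra (VB q ℓ)} (h𝒱 : IsHeisenbergVA 𝒱)
    {YW YW' : VB q ℓ →ₗ[ℂ] VertexOperator ℂ W} (h : IsPhiQuasiModule 𝒱 YW)
    (h' : IsPhiQuasiModule 𝒱 YW') (hgen : ∀ r : ℤ,
      YW (ofB q ℓ (Finsupp.single r 1)) = YW' (ofB q ℓ (Finsupp.single r 1))) : YW = YW' := by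
  refine LinearMap.ext fun u => ?_
  induction u using VB_induction with
  | h1 =>
    refine cf_ext fun n w => ?_
    rw [← h𝒱.vac_eq, ← coeff_eq_cf, ← coeff_eq_cf, h.map_vac, h'.map_vac]
  | hadd u v hu hv => rw [map_add, map_add, hu, hv]
  | hsmul s u hu => rw [map_smul, map_smul, hu]
  | h r k u hu =>
    -- The vector `b_{-k-1} u` is a mode of the field of `b` applied to `u`, so its field is
    -- determined by those of `b` and `u`.
    rw [← h𝒱.Y_ofB, ncoeff_eq_cf]
    exact h.apply_cf_eq h' (hgen r) hu _

end QHeis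

end

theorem theorem3p4 (q : ℂ) (hq0 : q ≠ 0) (hq : ∀ n : ℕ, 0 < n → q ^ n ≠ 1) (ℓ : ℂ)
    (W : Type*) [AddCommGroup W] [Module ℂ W]
    [LieRingModule (QHeis.QHeisenberg q) W] [LieModule ℂ (QHeis.QHeisenberg q) W]
    (hW : QHeis.IsRestricted q W) (hℓ : QHeis.HasLevel q W ℓ) :
    (∃! 𝒱 : QHeis.VertexAlgebra (QHeis.VB q ℓ), QHeis.IsHeisenbergVA 𝒱) ∧
    ∀ 𝒱 : QHeis.VertexAlgebra (QHeis.VB q ℓ), QHeis.IsHeisenbergVA 𝒱 →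
      ∃ YW : QHeis.VB q ℓ →ₗ[ℂ] VertexOperator ℂ W,
        QHeis.IsPhiQuasiModule 𝒱 YW ∧
        QHeis.IsGammaCovariant 𝒱 YW ∧
        (∀ r : ℤ, YW (QHeis.ofB q ℓ (Finsupp.single r 1)) =
          QHeis.dilate (q ^ r) (QHeis.βField q hW)) ∧
        ∀ YW' : QHeis.VB q ℓ →ₗ[ℂ] VertexOperator ℂ W,
          QHeis.IsPhiQuasiModule 𝒱 YW' →
          (∀ r : ℤ, YW' (QHeis.ofB q ℓ (Finsupp.single r 1)) =
            QHeis.dilate (q ^ r) (QHeis.βField q hW)) →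
          YW' = YW := by
  refine ⟨⟨QHeis.heisVA q ℓ, QHeis.isHeisenbergVA_heisVA q ℓ,
    fun 𝒱 h => h.ext (QHeis.isHeisenbergVA_heisVA q ℓ)⟩, fun 𝒱 h => ?_⟩
  -- By uniqueness, only the structure transported from the Fock space has to be treated.
  obtain rfl : 𝒱 = QHeis.heisVA q ℓ := h.ext (QHeis.isHeisenbergVA_heisVA q ℓ)
  have hY := (QHeis.isPhiQuasiModule_quasiY hW hℓ hq0 hq).transport (QHeis.Fock.equivVB q ℓ)
  have hv : ∀ u, (QHeis.Fock.equivVB q ℓ).symm (QHeis.Fock.toVB q ℓ u) = u :=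
    (QHeis.Fock.equivVB q ℓ).symm_apply_apply
  have hgen : ∀ r : ℤ, (QHeis.quasiY hW hℓ hq0 ∘ₗ (QHeis.Fock.equivVB q ℓ).symm.toLinearMap)
      (QHeis.ofB q ℓ (Finsupp.single r 1)) = QHeis.dilate (q ^ r) (QHeis.βField q hW) := by
    intro r
    have h1 := QHeis.Fock.toVB_X_mul q ℓ r 0 1
    rw [mul_one, QHeis.Fock.toVB_one, Nat.cast_zero, neg_zero, zero_sub] at h1
    rw [QHeis.ofB, ← h1, LinearMap.comp_apply, LinearEquiv.coe_coe, hv, QHeis.quasiY_X]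
  refine ⟨_, hY, ⟨h.isAutomorphism, fun m v => ?_⟩, hgen, fun YW' h' hgen' =>
    h.quasiModule_ext h' hY fun r => (hgen' r).trans (hgen r).symm⟩
  -- On the Fock space `ρ_m` is the index shift, for which covariance is `quasiY_shift`.
  obtain ⟨u, rfl⟩ := QHeis.Fock.toVB_surjective v
  rw [QHeis.Fock.ρ_toVB, LinearMap.comp_apply, LinearMap.comp_apply, LinearEquiv.coe_coe, hv, hv,
    QHeis.quasiY_shift]
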